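/- Let $N\ge 2$ and $k\ge 2$, and let $\Omega\subset\mathbb{R}^N$ be a bounded connected open set with Lipschitz boundary. For every $i=1,\dots,k$ let the following be given. - A boundary datum $\varphi_i\in H^{1/2}(\partial\Omega)$ (the space of the traces on $\partial\Omega$ of the functions of $H^1(\Omega)$) with $\varphi_i\ge 0$, and $\varphi_i\varphi_j=0$ for $j\ne i$, almost everywhere on $\partial\Omega$ with respect to the $(N-1)$-dimensional Hausdorff measure. - A diffusion coefficient $d_i\in W^{2,\infty}(\Omega)$, continuous on $\overline\Omega$, with $d_i>0$ on $\overline\Omega$. - A function $f_i:\Omega\times[0,\infty)\to\mathbb{R}$, measurable in $x$ for every fixed $s\ge 0$, such that: - (A1) $f_i(x,s)$ is Lipschitz continuous in $s$, uniformly in $x\in\Omega$, and $f_i(x,0)=0$ for all $x\in\Omega$; - (A2) there exist $b_i\in L^\infty(\Omega)$ and $\bar s_i>0$ such that $|f_i(x,s)|\le b_i(x)\,s$ for all $x\in\Omega$ and $s\ge\bar s_i$, and $$\int_\Omega\left(d_i^2(x)|\nabla w(x)|^2-b_i(x)w^2(x)\right)dx>0\qquad\text{for all } w\in H^1_0(\Omega),\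 w\ne 0.$$ Put $F_i(x,s)=\int_0^s f_i(x,t)\,dt$. Let $\mathcal U$ be the set of all $k$-tuples $U=(u_1,\dots,u_k)\in (H^1(\Omega))^k$ such that, for all $i$, $u_i|_{\partial\Omega}=\varphi_i$ in the sense of traces and $u_i\ge 0$ a.e. in $\Omega$, and $u_iu_j=0$ a.e. in $\Omega$ for $i\ne j$. For $U\in\mathcal U$ let $$J(U)=\sum_{i=1}^k\int_\Omega\left(\tfrac12 d_i^2(x)|\nabla u_i(x)|^2-F_i(x,u_i(x))\right)dx .$$ Then all these integrands are integrable for every $U\in\mathcal U$, so that $J$ is finite on $\mathcal U$, and $J$ attains its minimum on $\mathcal U$: there is $U\in\mathcal U$ with $J(U)\le J(V)$ for all $V\in\mathcal U$. -/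

import Mathlib

open MeasureTheory Filter Topology Set
open scoped ENNReal NNReal ContDiff Gradient

noncomputable section

namespace Segregation

/-- Euclidean space `ℝᴺ`. -/
abbrev Eu (N : ℕ) : Type := EuclideanSpace ℝ (Fin N)

variable {N k : ℕ}

/-- Lipschitz boundary: near each boundary point `x` there are a unit vector `ν` and a Lipschitz
function `γ` such that, in a ball around `x`, `Ω` is the part lying strictly above the graph of `γ`
over the hyperplane `ν^⊥`, heights being measured along `ν`. The point `y - ⟪ν, y⟫ ν` is the
orthogonal projection of `y` to `ν^⊥`, so that only the values of `γ` on `ν^⊥` matter. -/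
def HasLipschitzBoundary (Ω : Set (Eu N)) : Prop :=
  ∀ x ∈ frontier Ω, ∃ r > (0 : ℝ), ∃ ν : Eu N, ‖ν‖ = 1 ∧ ∃ (K : ℝ≥0) (γ : Eu N → ℝ),
    LipschitzWith K γ ∧
      ∀ y ∈ Metric.ball x r, (y ∈ Ω ↔ γ (y - inner ℝ ν y • ν) < inner ℝ ν y)

/-- The `(N-1)`-dimensional Hausdorff measure on the boundary `∂Ω`. -/
def surfaceMeasure (Ω : Set (Eu N)) : Measure (Eu N) :=
  (Measure.hausdorffMeasure ((N : ℝ) - 1)).restrict (frontier Ω)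

/-- Test functions: `ψ ∈ C_c^∞(Ω)`. -/
def IsTest (Ω : Set (Eu N)) (ψ : Eu N → ℝ) : Prop :=
  ContDiff ℝ ∞ ψ ∧ HasCompactSupport ψ ∧ tsupport ψ ⊆ Ω

/-- `G` is a weak gradient of `u` in the open set `Ω`: both are locally integrable in `Ω`, and
`∫_Ω u ∂_v ψ = - ∫_Ω (G · v) ψ` for all test functions `ψ` and all directions `v`. -/
def HasWeakGrad (Ω : Set (Eu N)) (u : Eu N → ℝ) (G : Eu N → Eu N) : Prop :=
  LocallyIntegrableOn u Ω ∧ LocallyIntegrableOn G Ω ∧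
    ∀ ψ : Eu N → ℝ, IsTest Ω ψ → ∀ v : Eu N,
      ∫ x in Ω, u x * fderiv ℝ ψ x v = - ∫ x in Ω, inner ℝ (G x) v * ψ x

open Classical in
/-- The weak gradient `∇u` in `Ω` (unique up to null sets when it exists). -/
def weakGrad (Ω : Set (Eu N)) (u : Eu N → ℝ) : Eu N → Eu N :=
  if h : ∃ G, HasWeakGrad Ω u G then h.choose else 0

/-- `u ∈ H¹(Ω)`. -/
def MemH1 (Ω : Set (Eu N)) (u : Eu N → ℝ) : Prop :=
  MemLp u 2 (volume.restrict Ω) ∧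
    ∃ G, HasWeakGrad Ω u G ∧ MemLp G 2 (volume.restrict Ω)

/-- `vₙ → u` in `H¹(Ω)`, for smooth functions `vₙ` and `u ∈ H¹(Ω)`. -/
def TendstoH1 (Ω : Set (Eu N)) (v : ℕ → Eu N → ℝ) (u : Eu N → ℝ) : Prop :=
  Tendsto (fun n => eLpNorm (fun x => v n x - u x) 2 (volume.restrict Ω)) atTop (𝓝 0) ∧
    Tendsto (fun n => eLpNorm (fun x => ∇ (v n) x - weakGrad Ω u x) 2 (volume.restrict Ω))
      atTop (𝓝 0)

/-- `w ∈ H¹₀(Ω)`: the closure of `C_c^∞(Ω)` in `H¹(Ω)`. -/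
def MemH10 (Ω : Set (Eu N)) (w : Eu N → ℝ) : Prop :=
  MemH1 Ω w ∧ ∃ v : ℕ → Eu N → ℝ, (∀ n, IsTest Ω (v n)) ∧ TendstoH1 Ω v w

/-- `u|_{∂Ω} = φ` in the sense of traces: `(u, φ)` belongs to the closure in `H¹(Ω) × L²(∂Ω)` of the
set of pairs `(v|_Ω, v|_{∂Ω})`, `v` smooth on `ℝᴺ`. When `Ω` is bounded with Lipschitz boundary this
is the graph of the trace operator, the continuous extension of `v ↦ v|_{∂Ω}` to `H¹(Ω)`. -/
def HasTrace (Ω : Set (Eu N)) (u φ : Eu N → ℝ) : Prop :=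
  MemH1 Ω u ∧ MemLp φ 2 (surfaceMeasure Ω) ∧
    ∃ v : ℕ → Eu N → ℝ, (∀ n, ContDiff ℝ ∞ (v n)) ∧ TendstoH1 Ω v u ∧
      Tendsto (fun n => eLpNorm (fun x => v n x - φ x) 2 (surfaceMeasure Ω)) atTop (𝓝 0)

/-- `φ ∈ H^{1/2}(∂Ω)`: the space of the traces of the functions of `H¹(Ω)`. -/
def MemHHalf (Ω : Set (Eu N)) (φ : Eu N → ℝ) : Prop :=
  ∃ g : Eu N → ℝ, HasTrace Ω g φ

/-- `d ∈ W^{2,∞}(Ω)`: `d`, its weak gradient, and the weak gradients of the components of the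
latter are essentially bounded in `Ω`. -/
def MemW2Infty (Ω : Set (Eu N)) (d : Eu N → ℝ) : Prop :=
  MemLp d ∞ (volume.restrict Ω) ∧
    ∃ G, HasWeakGrad Ω d G ∧ MemLp G ∞ (volume.restrict Ω) ∧
      ∀ j : Fin N, ∃ H, HasWeakGrad Ω (fun x => G x j) H ∧ MemLp H ∞ (volume.restrict Ω)

/-- Admissible boundary data: `φᵢ ∈ H^{1/2}(∂Ω)`, `φᵢ ≥ 0`, and `φᵢ φⱼ = 0` for `i ≠ j`, almost
everywhere on `∂Ω`. -/
structure IsAdmissibleDatum (Ω : Set (Eu N)) (φ : Fin k → Eu N → ℝ) : Prop where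
  mem : ∀ i, MemHHalf Ω (φ i)
  nonneg : ∀ i, ∀ᵐ x ∂(surfaceMeasure Ω), 0 ≤ φ i x
  disjoint : ∀ i j, i ≠ j → ∀ᵐ x ∂(surfaceMeasure Ω), φ i x * φ j x = 0

/-- Diffusion coefficients: `d ∈ W^{2,∞}(Ω)`, represented by a function that is continuous on the
closure of `Ω`, with `d > 0` on the closure of `Ω`. -/
structure IsDiffusion (Ω : Set (Eu N)) (d : Eu N → ℝ) : Prop where
  mem : MemW2Infty Ω d
  cont : ContinuousOn d (closure Ω)
  pos : ∀ x ∈ closure Ω, 0 < d x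

/-- Assumption (A1) on `f : Ω × [0, ∞) → ℝ`. -/
structure AssumptionA1 (Ω : Set (Eu N)) (f : Eu N → ℝ → ℝ) : Prop where
  lipschitz : ∃ L : ℝ≥0, ∀ x ∈ Ω, LipschitzOnWith L (f x) (Ici 0)
  zero : ∀ x ∈ Ω, f x 0 = 0

/-- Assumption (A2) on `f : Ω × [0, ∞) → ℝ`, for the diffusion coefficient `d`. -/
def AssumptionA2 (Ω : Set (Eu N)) (d : Eu N → ℝ) (f : Eu N → ℝ → ℝ) : Prop :=
  ∃ b : Eu N → ℝ, MemLp b ∞ (volume.restrict Ω) ∧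
    (∃ sbar > (0 : ℝ), ∀ x ∈ Ω, ∀ s ≥ sbar, |f x s| ≤ b x * s) ∧
    ∀ w : Eu N → ℝ, MemH10 Ω w → ¬ (w =ᵐ[volume.restrict Ω] 0) →
      0 < ∫ x in Ω, (d x ^ 2 * ‖weakGrad Ω w x‖ ^ 2 - b x * w x ^ 2)

/-- The potential `F(x, s) = ∫₀ˢ f(x, t) dt`. -/
def potential (f : Eu N → ℝ → ℝ) (x : Eu N) (s : ℝ) : ℝ :=
  ∫ t in (0 : ℝ)..s, f x t

/-- The class `𝒰` of segregated `k`-tuples of nonnegative `H¹` functions with boundary values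
`φ`. -/
structure IsSegregated (Ω : Set (Eu N)) (φ U : Fin k → Eu N → ℝ) : Prop where
  mem : ∀ i, MemH1 Ω (U i)
  trace : ∀ i, HasTrace Ω (U i) (φ i)
  nonneg : ∀ i, ∀ᵐ x ∂(volume.restrict Ω), 0 ≤ U i x
  disjoint : ∀ i j, i ≠ j → ∀ᵐ x ∂(volume.restrict Ω), U i x * U j x = 0

/-- The energy density `½ d² |∇u|² - F(x, u)` of one component. -/
def energyDensity (Ω : Set (Eu N)) (d : Eu N → ℝ) (f : Eu N → ℝ → ℝ) (u : Eu N → ℝ)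
    (x : Eu N) : ℝ :=
  1 / 2 * d x ^ 2 * ‖weakGrad Ω u x‖ ^ 2 - potential f x (u x)

/-- The energy `J(U) = ∑ᵢ ∫_Ω (½ dᵢ² |∇uᵢ|² - Fᵢ(x, uᵢ)) dx`. -/
def energy (Ω : Set (Eu N)) (d : Fin k → Eu N → ℝ) (f : Fin k → Eu N → ℝ → ℝ)
    (U : Fin k → Eu N → ℝ) : ℝ :=
  ∑ i, ∫ x in Ω, energyDensity Ω (d i) (f i) (U i) x

end Segregation

end

/-! The proof is the direct method. Fix `H¹` extensions `g i` of the boundary data. For a segregated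
tuple the differences w = u - g have zero trace, hence lie in `H¹₀(Ω)` (`HasTrace.memH10`), where
(A2) speaks about them. The form ∫ (d²|∇w|² - b w²), assumed positive, even dominates a multiple of
the squared `H¹` norm (`exists_coercive`): otherwise a normalised sequence has a weak limit on which
the form is at most 0, so the limit is 0; by compactness the terms in w² then tend to 0, hence so do
the gradients, against the normalisation. Since F(x, s) ≤ b s²/2 + const, Young's inequality makes
the energy coercive in w (`exists_energy_lower_bound`).

The class of competitors is not empty (`exists_isSegregated`), and a minimizing sequence is bounded.
Along a common subsequence the differences converge strongly in `L²` and weakly in `H¹₀`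
(`exists_tendstoWeakH1`, by Rellich's theorem). The potential terms are continuous in `L²` and the
gradient terms are convex, so the energy is lower semicontinuous (`exists_energy_approx`). The limit
is again a competitor: boundary values survive because the limits of the differences stay in `H¹₀`,
sign and segregation because they pass to almost everywhere limits.

Traces and `H¹₀` are closures of sets of smooth functions, so two tools do most of the work.
`memH1_of_bounded_gradients` turns smooth approximants with merely bounded gradients into strongly
convergent ones, by Hahn–Banach. `stripEstimate_frontier` controls the mass of a smooth function in
a thin boundary layer by its boundary values and its gradient, so that functions with small boundary
values can be cut off at bounded cost. -/

namespace Segregation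

/-! ### Weak limits and closed subspaces in Hilbert spaces. -/

section Abstract

/-- Bounded sequences in a separable Hilbert space have weakly convergent subsequences. -/
theorem exists_weakly_convergent_subseq {Y : Type*} [NormedAddCommGroup Y] [InnerProductSpace ℝ Y]
    [CompleteSpace Y] [TopologicalSpace.SeparableSpace Y] {y : ℕ → Y} {C : ℝ}
    (hy : ∀ n, ‖y n‖ ≤ C) :
    ∃ (a : Y) (s : ℕ → ℕ), StrictMono s ∧
      ∀ z, Tendsto (fun n => inner ℝ (y (s n)) z) atTop (𝓝 (inner ℝ a z)) := by
  let D : Y → WeakDual ℝ Y := fun v => StrongDual.toWeakDual (InnerProductSpace.toDual ℝ Y v)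
  have hD : ∀ n, D (y n) ∈
      (WeakDual.toStrongDual ⁻¹' Metric.closedBall (0 : StrongDual ℝ Y) C) := by
    intro n
    have h : ‖InnerProductSpace.toDual ℝ Y (y n)‖ ≤ C := by
      rw [LinearIsometryEquiv.norm_map]; exact hy n
    simpa [D] using h
  obtain ⟨a, -, s, hs, ha⟩ := WeakDual.isSeqCompact_closedBall ℝ Y (0 : StrongDual ℝ Y) C hD
  refine ⟨(InnerProductSpace.toDual ℝ Y).symm (WeakDual.toStrongDual a), s, hs, fun z => ?_⟩
  have h := ((WeakDual.eval_continuous (𝕜 := ℝ) z).tendsto a).comp ha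
  rw [InnerProductSpace.toDual_symm_apply]
  exact h

/-- A weak form of Mazur's lemma: if the points `(x n, y n)` of a subspace `S` are such that `x n`
converges and `y n` stays bounded, then a weak limit of `(x n, y n)` is a strong limit of points
of `S`. -/
theorem exists_mem_closure_of_bounded {X Y : Type*} [NormedAddCommGroup X] [NormedSpace ℝ X]
    [NormedAddCommGroup Y] [InnerProductSpace ℝ Y]
    [CompleteSpace Y] [TopologicalSpace.SeparableSpace Y] (S : Submodule ℝ (X × Y))
    {x : ℕ → X} {y : ℕ → Y} {a : X} {C : ℝ} (hx : Tendsto x atTop (𝓝 a))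
    (hy : ∀ n, ‖y n‖ ≤ C) (hS : ∀ n, (x n, y n) ∈ S) :
    ∃ (b : Y) (s : ℕ → ℕ), StrictMono s ∧
      (∀ z, Tendsto (fun n => inner ℝ (y (s n)) z) atTop (𝓝 (inner ℝ b z))) ∧
      (a, b) ∈ closure (S : Set (X × Y)) := by
  obtain ⟨b, s, hs, hb⟩ := exists_weakly_convergent_subseq hy
  refine ⟨b, s, hs, hb, ?_⟩
  by_contra hmem
  obtain ⟨f, u, hfu, huf⟩ :=
    geometric_hahn_banach_point_closed (S.convex.closure) isClosed_closure hmem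
  have h0 : u < 0 := by simpa using huf 0 (subset_closure S.zero_mem)
  have hf0 : ∀ p ∈ S, f p = 0 := by
    intro p hp
    by_contra hne
    -- A functional bounded below on a subspace vanishes there: the multiple of `p` at which `f`
    -- equals `u` contradicts the strict inequality.
    have := huf ((u / f p) • p) (subset_closure (S.smul_mem _ hp))
    rw [map_smul, smul_eq_mul, div_mul_cancel₀ _ hne] at this
    exact lt_irrefl _ this
  have hsplit : ∀ (p : X) (q : Y), f (p, q) = f (p, 0) + (f.comp (ContinuousLinearMap.inr ℝ X Y)) q := by
    intro p q
    rw [ContinuousLinearMap.comp_apply, ContinuousLinearMap.inr_apply, ← map_add,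
      Prod.mk_add_mk, add_zero, zero_add]
  set g := (f.comp (ContinuousLinearMap.inr ℝ X Y)) with hg
  have hgz : ∀ q, g q = inner ℝ q ((InnerProductSpace.toDual ℝ Y).symm g) := by
    intro q; rw [real_inner_comm, InnerProductSpace.toDual_symm_apply]
  -- Strong convergence handles the first component, weak convergence and Riesz representation the
  -- second. As `f` vanishes on `S`, it vanishes at `(a, b)`, whereas separation gave `f (a, b) < u
  -- < 0`.
  have hlim : Tendsto (fun n => f (x (s n), y (s n))) atTop (𝓝 (f (a, b))) := by
    rw [hsplit a b, hgz b]
    refine Tendsto.congr (fun n => (by rw [hsplit, hgz])) (Tendsto.add ?_ (hb _))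
    have : Continuous fun p : X => f (p, 0) := by fun_prop
    exact (this.tendsto a).comp (hx.comp hs.tendsto_atTop)
  have : f (a, b) = 0 := tendsto_nhds_unique hlim (by simp [hf0 _ (hS _)])
  linarith

end Abstract

/-! ### Norms and pairings in `L²`. -/

section L2

variable {α E : Type*} [MeasurableSpace α] {μ : Measure α} [NormedAddCommGroup E]

theorem sq_eLpNorm_two {α E : Type*} [MeasurableSpace α] [ENorm E] (f : α → E) (μ : Measure α) :
    eLpNorm f 2 μ ^ 2 = ∫⁻ x, ‖f x‖ₑ ^ 2 ∂μ := by
  rw [eLpNorm_eq_lintegral_rpow_enorm_toReal (by simp) (by simp), ← ENNReal.rpow_natCast,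
    ← ENNReal.rpow_mul]
  simp

theorem ofReal_integral_norm_sq {f : α → E} (hf : MemLp f 2 μ) :
    ENNReal.ofReal (∫ x, ‖f x‖ ^ 2 ∂μ) = eLpNorm f 2 μ ^ 2 := by
  rw [sq_eLpNorm_two, ofReal_integral_eq_lintegral_ofReal (hf.integrable_norm_pow two_ne_zero)
    (ae_of_all _ fun _ => by positivity)]
  refine lintegral_congr fun x => ?_
  rw [ENNReal.ofReal_pow (norm_nonneg _), ofReal_norm]

theorem tendsto_eLpNorm_two_zero {α E : Type*} [MeasurableSpace α] [ENorm E] {μ : Measure α}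
    {f : ℕ → α → E} (h : Tendsto (fun n => ∫⁻ x, ‖f n x‖ₑ ^ 2 ∂μ) atTop (𝓝 0)) :
    Tendsto (fun n => eLpNorm (f n) 2 μ) atTop (𝓝 0) := by
  simp only [← sq_eLpNorm_two] at h
  have h2 := (ENNReal.continuous_rpow_const (y := 1 / 2)).tendsto 0 |>.comp h
  rw [ENNReal.zero_rpow_of_pos (by norm_num)] at h2
  refine h2.congr fun n => ?_
  rw [Function.comp_apply, ← ENNReal.rpow_natCast, ← ENNReal.rpow_mul]
  norm_num

theorem memLp_two_mul {f g : α → ℝ} (hf : MemLp f 2 μ) (hg : MemLp g 2 μ) :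
    Integrable (fun x => f x * g x) μ := hf.integrable_mul hg

theorem memLp_two_inner [InnerProductSpace ℝ E] {f g : α → E} (hf : MemLp f 2 μ)
    (hg : MemLp g 2 μ) : Integrable (fun x => inner ℝ (f x) (g x)) μ := by
  refine (memLp_two_mul hf.norm hg.norm).mono (hf.1.inner hg.1) (ae_of_all _ fun x => ?_)
  simpa using abs_real_inner_le_norm (f x) (g x)

theorem tendsto_eLpNorm_sub_of_tendsto_toLp {f : ℕ → Lp E 2 μ} {a : Lp E 2 μ} {g : ℕ → α → E}
    {b : α → E} (h : Tendsto f atTop (𝓝 a)) (hg : ∀ n, f n =ᵐ[μ] g n) (hb : a =ᵐ[μ] b) :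
    Tendsto (fun n => eLpNorm (fun x => g n x - b x) 2 μ) atTop (𝓝 0) := by
  rw [Lp.tendsto_Lp_iff_tendsto_eLpNorm'] at h
  refine h.congr fun n => eLpNorm_congr_ae ?_
  filter_upwards [hg n, hb] with x h1 h2
  simp [h1, h2]

theorem tendsto_integral_inner {F : Type*} [NormedAddCommGroup F] [InnerProductSpace ℝ F]
    {f : ℕ → α → F} {a g : α → F} (hf : ∀ n, MemLp (f n) 2 μ) (ha : MemLp a 2 μ)
    (hg : MemLp g 2 μ) (h : Tendsto (fun n => eLpNorm (fun x => f n x - a x) 2 μ) atTop (𝓝 0)) :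
    Tendsto (fun n => ∫ x, inner ℝ (f n x) (g x) ∂μ) atTop (𝓝 (∫ x, inner ℝ (a x) (g x) ∂μ)) := by
  have h1 := (Lp.tendsto_Lp_iff_tendsto_eLpNorm'' f hf a ha).2 h
  have h2 := Tendsto.inner (𝕜 := ℝ) h1 (tendsto_const_nhds (x := hg.toLp g))
  have key : ∀ (u : α → F) (hu : MemLp u 2 μ),
      inner ℝ (hu.toLp u) (hg.toLp g) = ∫ x, inner ℝ (u x) (g x) ∂μ := by
    intro u hu
    rw [L2.inner_def]
    refine integral_congr_ae ?_
    filter_upwards [hu.coeFn_toLp, hg.coeFn_toLp] with x h1 h2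
    rw [h1, h2]
  simpa only [key] using h2

end L2

/-! ### Calculus of weak gradients. -/

section WeakGradient

variable {N : ℕ} {Ω : Set (Eu N)}

theorem norm_gradient (v : Eu N → ℝ) (x : Eu N) : ‖∇ v x‖ = ‖fderiv ℝ v x‖ := by
  rw [gradient, LinearIsometryEquiv.norm_map]

theorem continuous_gradient {v : Eu N → ℝ} (hv : ContDiff ℝ ∞ v) : Continuous (∇ v) := by
  have : Continuous (fderiv ℝ v) := hv.continuous_fderiv (by simp)
  exact (InnerProductSpace.toDual ℝ (Eu N)).symm.continuous.comp this

theorem tsupport_fderiv_apply {ψ : Eu N → ℝ} (v : Eu N) :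
    tsupport (fun x => fderiv ℝ ψ x v) ⊆ tsupport ψ := tsupport_fderiv_apply_subset ℝ v

theorem integrable_smul_of_tsupport_subset {F : Type*} [NormedAddCommGroup F] [NormedSpace ℝ F]
    {g : Eu N → ℝ} {f : Eu N → F} (hf : LocallyIntegrableOn f Ω) (hg : Continuous g)
    (hc : HasCompactSupport g) (hs : tsupport g ⊆ Ω) : Integrable (fun x => g x • f x) := by
  have h1 : IntegrableOn f (tsupport g) := hf.integrableOn_compact_subset hs hc
  have h2 : IntegrableOn (fun x => g x • f x) (tsupport g) :=
    h1.continuousOn_smul hg.continuousOn hc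
  refine (integrableOn_iff_integrable_of_support_subset fun x hx => ?_).1 h2
  refine subset_tsupport g fun h => hx ?_
  simp [h]

theorem MemLp.locallyIntegrableOn_restrict {E : Type*} [NormedAddCommGroup E] {f : Eu N → E}
    {p : ℝ≥0∞} (hp : 1 ≤ p) (hf : MemLp f p (volume.restrict Ω)) : LocallyIntegrableOn f Ω :=
  locallyIntegrableOn_of_locallyIntegrable_restrict (hf.locallyIntegrable hp)

theorem IsTest.integrable_mul_fderiv {ψ u : Eu N → ℝ} (hψ : IsTest Ω ψ)
    (hu : LocallyIntegrableOn u Ω) (v : Eu N) :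
    IntegrableOn (fun x => u x * fderiv ℝ ψ x v) Ω := by
  have := integrable_smul_of_tsupport_subset hu
    ((hψ.1.continuous_fderiv (by simp)).clm_apply (continuous_const (y := v)))
    (hψ.2.1.fderiv_apply ℝ v) ((tsupport_fderiv_apply v).trans hψ.2.2)
  exact (this.congr (ae_of_all _ fun x => by simp [mul_comm])).integrableOn

theorem IsTest.integrable_inner_mul {ψ : Eu N → ℝ} {G : Eu N → Eu N} (hψ : IsTest Ω ψ)
    (hG : LocallyIntegrableOn G Ω) (v : Eu N) :
    IntegrableOn (fun x => inner ℝ (G x) v * ψ x) Ω := by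
  have := integrable_smul_of_tsupport_subset hG hψ.1.continuous hψ.2.1 hψ.2.2
  refine ((this.inner_const (𝕜 := ℝ) v).congr (ae_of_all _ fun x => ?_)).integrableOn
  simp [inner_smul_left, mul_comm]

/-- The fundamental lemma of the calculus of variations, applied to `G - G'`; its vector-valued
integrals against test functions are checked one direction `v` at a time. -/
theorem HasWeakGrad.unique (hΩ : IsOpen Ω) {u : Eu N → ℝ} {G G' : Eu N → Eu N}
    (h : HasWeakGrad Ω u G) (h' : HasWeakGrad Ω u G') : G =ᵐ[volume.restrict Ω] G' := by
  have hloc : LocallyIntegrableOn (fun x => G x - G' x) Ω := h.2.1.sub h'.2.1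
  have key := hΩ.ae_eq_zero_of_integral_contDiff_smul_eq_zero hloc (μ := volume) ?_
  · rw [Filter.EventuallyEq, ae_restrict_iff' hΩ.measurableSet]
    filter_upwards [key] with x hx hxΩ
    exact sub_eq_zero.1 (hx hxΩ)
  intro ψ h1 h2 h3
  have hψ : IsTest Ω ψ := ⟨h1, h2, h3⟩
  refine ext_inner_right ℝ fun v => ?_
  have hint := integrable_smul_of_tsupport_subset hloc h1.continuous h2 h3
  rw [← setIntegral_eq_integral_of_forall_compl_eq_zero (s := Ω), inner_zero_left,
    real_inner_comm, ← integral_inner hint.integrableOn]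
  · have e : ∀ x, inner ℝ v (ψ x • (G x - G' x)) =
        inner ℝ (G x) v * ψ x - inner ℝ (G' x) v * ψ x := by
      intro x
      rw [inner_smul_right, inner_sub_right, real_inner_comm v, real_inner_comm v]; ring
    simp only [e]
    rw [integral_sub (hψ.integrable_inner_mul h.2.1 v) (hψ.integrable_inner_mul h'.2.1 v)]
    have a := h.2.2 ψ hψ v
    have b := h'.2.2 ψ hψ v
    linarith
  · intro x hx
    rw [image_eq_zero_of_notMem_tsupport (fun h => hx (h3 h)), zero_smul]

theorem HasWeakGrad.congr {u u' : Eu N → ℝ} {G G' : Eu N → Eu N}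
    (h : HasWeakGrad Ω u G) (hu : u =ᵐ[volume.restrict Ω] u') (hG : G =ᵐ[volume.restrict Ω] G') :
    HasWeakGrad Ω u' G' := by
  refine ⟨h.1.congr hu, h.2.1.congr hG, fun ψ hψ v => ?_⟩
  have e1 : ∫ x in Ω, u' x * fderiv ℝ ψ x v = ∫ x in Ω, u x * fderiv ℝ ψ x v :=
    integral_congr_ae (by filter_upwards [hu] with x hx; rw [hx])
  have e2 : ∫ x in Ω, inner ℝ (G' x) v * ψ x = ∫ x in Ω, inner ℝ (G x) v * ψ x :=
    integral_congr_ae (by filter_upwards [hG] with x hx; rw [hx])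
  rw [e1, e2]; exact h.2.2 ψ hψ v

theorem HasWeakGrad.add {u u' : Eu N → ℝ} {G G' : Eu N → Eu N}
    (h : HasWeakGrad Ω u G) (h' : HasWeakGrad Ω u' G') :
    HasWeakGrad Ω (fun x => u x + u' x) (fun x => G x + G' x) := by
  refine ⟨h.1.add h'.1, h.2.1.add h'.2.1, fun ψ hψ v => ?_⟩
  simp only [add_mul, inner_add_left]
  rw [integral_add (hψ.integrable_mul_fderiv h.1 v) (hψ.integrable_mul_fderiv h'.1 v),
    integral_add (hψ.integrable_inner_mul h.2.1 v) (hψ.integrable_inner_mul h'.2.1 v),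
    h.2.2 ψ hψ v, h'.2.2 ψ hψ v]
  ring

theorem HasWeakGrad.const_smul {u : Eu N → ℝ} {G : Eu N → Eu N}
    (h : HasWeakGrad Ω u G) (c : ℝ) :
    HasWeakGrad Ω (fun x => c * u x) (fun x => c • G x) := by
  refine ⟨h.1.smul c, h.2.1.smul c, fun ψ hψ v => ?_⟩
  simp only [mul_assoc, inner_smul_left, integral_const_mul, RCLike.conj_to_real]
  rw [h.2.2 ψ hψ v]; ring

/-- Since `ψ` is supported in `Ω`, both integrals extend to the whole space, where integration by
parts leaves no boundary term. -/
theorem hasWeakGrad_of_contDiff {v : Eu N → ℝ} (hv : ContDiff ℝ ∞ v) :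
    HasWeakGrad Ω v (∇ v) := by
  have l1 : LocallyIntegrableOn v Ω := hv.continuous.locallyIntegrable.locallyIntegrableOn Ω
  have l2 : LocallyIntegrableOn (∇ v) Ω :=
    (continuous_gradient hv).locallyIntegrable.locallyIntegrableOn Ω
  refine ⟨l1, l2, fun ψ hψ w => ?_⟩
  have z : ∀ x, x ∉ Ω → ψ x = 0 := fun x hx =>
    image_eq_zero_of_notMem_tsupport (fun h => hx (hψ.2.2 h))
  have z' : ∀ x, x ∉ Ω → fderiv ℝ ψ x w = 0 := fun x hx =>
    image_eq_zero_of_notMem_tsupport (f := fun x => fderiv ℝ ψ x w)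
      (fun h => hx (hψ.2.2 (tsupport_fderiv_apply w h)))
  simp only [inner_gradient_left]
  rw [setIntegral_eq_integral_of_forall_compl_eq_zero (by intro x hx; simp [z' x hx]),
    setIntegral_eq_integral_of_forall_compl_eq_zero (by intro x hx; simp [z x hx])]
  have cv : Continuous fun x => fderiv ℝ v x w :=
    (hv.continuous_fderiv (by simp)).clm_apply continuous_const
  have cψ : Continuous fun x => fderiv ℝ ψ x w :=
    (hψ.1.continuous_fderiv (by simp)).clm_apply continuous_const
  refine integral_mul_fderiv_eq_neg_fderiv_mul_of_integrable ?_ ?_ ?_ ?_ ?_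
  · exact (cv.mul hψ.1.continuous).integrable_of_hasCompactSupport hψ.2.1.mul_left
  · exact (hv.continuous.mul cψ).integrable_of_hasCompactSupport (hψ.2.1.fderiv_apply ℝ w).mul_left
  · exact (hv.continuous.mul hψ.1.continuous).integrable_of_hasCompactSupport hψ.2.1.mul_left
  · exact fun x _ => hv.differentiable (by simp) x
  · exact fun x _ => hψ.1.differentiable (by simp) x

theorem IsTest.memLp {ψ : Eu N → ℝ} (hψ : IsTest Ω ψ) (p : ℝ≥0∞) (μ : Measure (Eu N))
    [IsFiniteMeasureOnCompacts μ] : MemLp ψ p μ :=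
  hψ.1.continuous.memLp_of_hasCompactSupport hψ.2.1

/-- For a fixed test function both sides of the defining identity are `L²` pairings with fixed
elements, hence continuous under `L²` convergence. -/
theorem hasWeakGrad_of_tendsto {u : ℕ → Eu N → ℝ} {a : Eu N → ℝ}
    {G : ℕ → Eu N → Eu N} {B : Eu N → Eu N} (h : ∀ n, HasWeakGrad Ω (u n) (G n))
    (hu : ∀ n, MemLp (u n) 2 (volume.restrict Ω)) (hG : ∀ n, MemLp (G n) 2 (volume.restrict Ω))
    (ha : MemLp a 2 (volume.restrict Ω)) (hB : MemLp B 2 (volume.restrict Ω))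
    (hua : Tendsto (fun n => eLpNorm (fun x => u n x - a x) 2 (volume.restrict Ω)) atTop (𝓝 0))
    (hGB : Tendsto (fun n => eLpNorm (fun x => G n x - B x) 2 (volume.restrict Ω)) atTop (𝓝 0)) :
    HasWeakGrad Ω a B := by
  refine ⟨MemLp.locallyIntegrableOn_restrict (by simp) ha,
    MemLp.locallyIntegrableOn_restrict (by simp) hB, fun ψ hψ v => ?_⟩
  have m1 : MemLp (fun x => fderiv ℝ ψ x v) 2 (volume.restrict Ω) :=
    ((hψ.1.continuous_fderiv (by simp)).clm_apply continuous_const).memLp_of_hasCompactSupport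
      (hψ.2.1.fderiv_apply ℝ v)
  have m2 : MemLp (fun x => ψ x • v) 2 (volume.restrict Ω) :=
    (hψ.1.continuous.smul continuous_const).memLp_of_hasCompactSupport hψ.2.1.smul_right
  have t1 := tendsto_integral_inner hu ha m1 hua
  have t2 := tendsto_integral_inner hG hB m2 hGB
  simp only [inner_smul_right, RCLike.inner_apply, RCLike.conj_to_real] at t1 t2
  refine tendsto_nhds_unique (f := fun n => ∫ x in Ω, u n x * fderiv ℝ ψ x v) ?_
    (Tendsto.congr (fun n => ?_) t2.neg) |>.trans ?_
  · simpa only [mul_comm] using t1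
  · rw [(h n).2.2 ψ hψ v]; simp only [mul_comm]
  · simp only [mul_comm]

theorem MemH1.hasWeakGrad {u : Eu N → ℝ} (h : MemH1 Ω u) : HasWeakGrad Ω u (weakGrad Ω u) := by
  obtain ⟨-, G, hG, -⟩ := h
  have hex : ∃ G, HasWeakGrad Ω u G := ⟨G, hG⟩
  rw [weakGrad, dif_pos hex]
  exact hex.choose_spec

theorem HasWeakGrad.weakGrad_ae_eq (hΩ : IsOpen Ω) {u : Eu N → ℝ} {G : Eu N → Eu N}
    (h : HasWeakGrad Ω u G) : weakGrad Ω u =ᵐ[volume.restrict Ω] G := by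
  have hex : ∃ G, HasWeakGrad Ω u G := ⟨G, h⟩
  rw [weakGrad, dif_pos hex]
  exact hex.choose_spec.unique hΩ h

theorem MemH1.memLp_weakGrad (hΩ : IsOpen Ω) {u : Eu N → ℝ} (h : MemH1 Ω u) :
    MemLp (weakGrad Ω u) 2 (volume.restrict Ω) := by
  obtain ⟨-, G, hG, hG2⟩ := h
  exact hG2.ae_eq (hG.weakGrad_ae_eq hΩ).symm

theorem MemH1.weakGrad_congr (hΩ : IsOpen Ω) {u u' : Eu N → ℝ} (h : MemH1 Ω u)
    (hu : u =ᵐ[volume.restrict Ω] u') :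
    weakGrad Ω u' =ᵐ[volume.restrict Ω] weakGrad Ω u :=
  (h.hasWeakGrad.congr hu .rfl).weakGrad_ae_eq hΩ

theorem MemH1.add {u u' : Eu N → ℝ} (h : MemH1 Ω u) (h' : MemH1 Ω u') :
    MemH1 Ω (fun x => u x + u' x) := by
  obtain ⟨h2, G, hG, hG2⟩ := h
  obtain ⟨h2', G', hG', hG2'⟩ := h'
  exact ⟨h2.add h2', _, hG.add hG', hG2.add hG2'⟩

theorem MemH1.weakGrad_add (hΩ : IsOpen Ω) {u u' : Eu N → ℝ} (h : MemH1 Ω u) (h' : MemH1 Ω u') :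
    weakGrad Ω (fun x => u x + u' x) =ᵐ[volume.restrict Ω]
      fun x => weakGrad Ω u x + weakGrad Ω u' x :=
  (h.hasWeakGrad.add h'.hasWeakGrad).weakGrad_ae_eq hΩ

theorem MemH1.const_mul {u : Eu N → ℝ} (h : MemH1 Ω u) (c : ℝ) : MemH1 Ω (fun x => c * u x) := by
  obtain ⟨h2, G, hG, hG2⟩ := h
  exact ⟨h2.const_mul c, _, hG.const_smul c, hG2.const_smul c⟩

theorem MemH1.weakGrad_const_mul (hΩ : IsOpen Ω) {u : Eu N → ℝ} (h : MemH1 Ω u) (c : ℝ) :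
    weakGrad Ω (fun x => c * u x) =ᵐ[volume.restrict Ω] fun x => c • weakGrad Ω u x :=
  (h.hasWeakGrad.const_smul c).weakGrad_ae_eq hΩ

end WeakGradient

/-! ### From bounded gradients to membership in `H¹`, with boundary values. -/

variable {N : ℕ} {Ω : Set (Eu N)}

theorem gradient_add {u v : Eu N → ℝ} (hu : ContDiff ℝ ∞ u) (hv : ContDiff ℝ ∞ v) (x : Eu N) :
    ∇ (u + v) x = ∇ u x + ∇ v x := by
  rw [gradient, gradient, gradient, fderiv_add (hu.differentiable (by simp) x)
    (hv.differentiable (by simp) x), map_add]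

theorem gradient_const_smul {u : Eu N → ℝ} (hu : ContDiff ℝ ∞ u) (c : ℝ) (x : Eu N) :
    ∇ (c • u) x = c • ∇ u x := by
  rw [gradient, gradient, fderiv_const_smul (hu.differentiable (by simp) x)]
  simp

/-- The restrictions `(v|_Ω, v, ∇v|_Ω)` of the functions `v` of a space `𝒞` of smooth functions, as
a subspace of `L²(Ω) × L²(σ) × L²(Ω)`. -/
def graphSubmodule (Ω : Set (Eu N)) (σ : Measure (Eu N)) (𝒞 : Submodule ℝ (Eu N → ℝ))
    (h𝒞 : ∀ v ∈ 𝒞, ContDiff ℝ ∞ v) :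
    Submodule ℝ ((Lp ℝ 2 (volume.restrict Ω) × Lp ℝ 2 σ) × Lp (Eu N) 2 (volume.restrict Ω)) where
  carrier := {p | ∃ v ∈ 𝒞, p.1.1 =ᵐ[volume.restrict Ω] v ∧ p.1.2 =ᵐ[σ] v ∧
    p.2 =ᵐ[volume.restrict Ω] ∇ v}
  add_mem' := by
    rintro p q ⟨v, hv, h1, h2, h3⟩ ⟨w, hw, k1, k2, k3⟩
    refine ⟨v + w, 𝒞.add_mem hv hw, ?_, ?_, ?_⟩
    · exact (Lp.coeFn_add p.1.1 q.1.1).trans (h1.add k1)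
    · exact (Lp.coeFn_add p.1.2 q.1.2).trans (h2.add k2)
    · refine (Lp.coeFn_add p.2 q.2).trans ((h3.add k3).trans (ae_of_all _ fun x => ?_))
      rw [gradient_add (h𝒞 v hv) (h𝒞 w hw)]
      rfl
  zero_mem' := by
    refine ⟨0, 𝒞.zero_mem, Lp.coeFn_zero _ _ _, Lp.coeFn_zero _ _ _, ?_⟩
    refine (Lp.coeFn_zero _ _ _).trans (ae_of_all _ fun x => ?_)
    simp [gradient]
  smul_mem' := by
    rintro c p ⟨v, hv, h1, h2, h3⟩
    refine ⟨c • v, 𝒞.smul_mem c hv, ?_, ?_, ?_⟩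
    · exact (Lp.coeFn_smul c p.1.1).trans (h1.const_smul c)
    · exact (Lp.coeFn_smul c p.1.2).trans (h2.const_smul c)
    · refine (Lp.coeFn_smul c p.2).trans ((h3.const_smul c).trans (ae_of_all _ fun x => ?_))
      rw [gradient_const_smul (h𝒞 v hv)]
      rfl

/-- Let the smooth functions `v n`, from a space `𝒞`, converge to `u` in `L²(Ω)` and to `φ` in
`L²(σ)`, and let their gradients be bounded in `L²(Ω)`. Then `u ∈ H¹(Ω)`, the gradients converge
weakly along a subsequence, and some functions of `𝒞` converge to `u` in `H¹(Ω)` and to `φ` in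
`L²(σ)`. -/
theorem memH1_of_bounded_gradients (hΩ : IsOpen Ω) (σ : Measure (Eu N))
    (𝒞 : Submodule ℝ (Eu N → ℝ)) (h𝒞 : ∀ v ∈ 𝒞, ContDiff ℝ ∞ v) {v : ℕ → Eu N → ℝ}
    (hv : ∀ n, v n ∈ 𝒞) {u φ : Eu N → ℝ} (hu : MemLp u 2 (volume.restrict Ω)) (hφ : MemLp φ 2 σ)
    (hvu : Tendsto (fun n => eLpNorm (fun x => v n x - u x) 2 (volume.restrict Ω)) atTop (𝓝 0))
    (hvφ : Tendsto (fun n => eLpNorm (fun x => v n x - φ x) 2 σ) atTop (𝓝 0)) {C : ℝ≥0}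
    (hC : ∀ n, eLpNorm (∇ (v n)) 2 (volume.restrict Ω) ≤ C) :
    MemH1 Ω u ∧
      (∃ p : ℕ → Eu N → ℝ, (∀ n, p n ∈ 𝒞) ∧ TendstoH1 Ω p u ∧
        Tendsto (fun n => eLpNorm (fun x => p n x - φ x) 2 σ) atTop (𝓝 0)) ∧
      ∃ s : ℕ → ℕ, StrictMono s ∧ ∀ Z : Eu N → Eu N, MemLp Z 2 (volume.restrict Ω) →
        Tendsto (fun n => ∫ x in Ω, inner ℝ (∇ (v (s n)) x) (Z x)) atTop
          (𝓝 (∫ x in Ω, inner ℝ (weakGrad Ω u x) (Z x))) := by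
  set μ := volume.restrict Ω with hμ
  have memLp_of_lt : ∀ {ν : Measure (Eu N)} {w a : Eu N → ℝ}, Continuous w → MemLp a 2 ν →
      eLpNorm (fun x => w x - a x) 2 ν < 1 → MemLp w 2 ν := by
    intro ν w a hw ha hlt
    have : MemLp (fun x => w x - a x) 2 ν :=
      ⟨hw.aestronglyMeasurable.sub ha.1, hlt.trans ENNReal.one_lt_top⟩
    exact (this.add ha).ae_eq (ae_of_all _ fun x => by simp)
  -- A smooth function need not be square integrable; the approximants are so once they are within
  -- distance 1 of the limits, hence the shift by `n0`.
  obtain ⟨n0, hn0⟩ := eventually_atTop.1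
    ((hvu.eventually (gt_mem_nhds one_pos)).and (hvφ.eventually (gt_mem_nhds one_pos)))
  have hcont : ∀ n, Continuous (v n) := fun n => (h𝒞 _ (hv n)).continuous
  have m1 : ∀ n, MemLp (v (n + n0)) 2 μ := fun n =>
    memLp_of_lt (hcont _) hu (hn0 (n + n0) (by omega)).1
  have m2 : ∀ n, MemLp (v (n + n0)) 2 σ := fun n =>
    memLp_of_lt (hcont _) hφ (hn0 (n + n0) (by omega)).2
  have m3 : ∀ n, MemLp (∇ (v n)) 2 μ := fun n =>
    ⟨(continuous_gradient (h𝒞 _ (hv n))).aestronglyMeasurable,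
      (hC n).trans_lt ENNReal.coe_lt_top⟩
  have t1 := (Lp.tendsto_Lp_iff_tendsto_eLpNorm'' _ m1 u hu).2
    ((tendsto_add_atTop_iff_nat n0).2 hvu)
  have t2 := (Lp.tendsto_Lp_iff_tendsto_eLpNorm'' _ m2 φ hφ).2
    ((tendsto_add_atTop_iff_nat n0).2 hvφ)
  have : Fact ((2 : ℝ≥0∞) ≠ ⊤) := ⟨by simp⟩
  have bd : ∀ n, ‖(m3 (n + n0)).toLp‖ ≤ C := by
    intro n
    rw [Lp.norm_toLp]
    exact ENNReal.toReal_le_of_le_ofReal C.2 (by simpa using hC (n + n0))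
  -- The values in `Ω` and the values for `σ` form the strongly convergent component; only the
  -- gradients need a weak limit.
  obtain ⟨b, s, hs, hweak, hcl⟩ := exists_mem_closure_of_bounded (graphSubmodule Ω σ 𝒞 h𝒞)
    (t1.prodMk_nhds t2) bd (fun n => ⟨v (n + n0), hv _, (m1 n).coeFn_toLp, (m2 n).coeFn_toLp,
      (m3 _).coeFn_toLp⟩)
  obtain ⟨q, hq, hqlim⟩ := mem_closure_iff_seq_limit.1 hcl
  choose p hp p1 p2 p3 using hq
  rw [Prod.tendsto_iff, Prod.tendsto_iff] at hqlim
  obtain ⟨⟨l1, l2⟩, l3⟩ := hqlim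
  have c1 := tendsto_eLpNorm_sub_of_tendsto_toLp l1 p1 hu.coeFn_toLp
  have c2 := tendsto_eLpNorm_sub_of_tendsto_toLp l2 p2 hφ.coeFn_toLp
  have c3 := tendsto_eLpNorm_sub_of_tendsto_toLp l3 p3 (ae_eq_refl _)
  have hG : HasWeakGrad Ω u b := hasWeakGrad_of_tendsto
    (fun n => hasWeakGrad_of_contDiff (h𝒞 _ (hp n)))
    (fun n => (Lp.memLp (q n).1.1).ae_eq (p1 n)) (fun n => (Lp.memLp (q n).2).ae_eq (p3 n))
    hu (Lp.memLp b) c1 c3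
  have hb := hG.weakGrad_ae_eq hΩ
  refine ⟨⟨hu, b, hG, Lp.memLp b⟩, ⟨p, hp, ⟨c1, ?_⟩, c2⟩, fun n => s n + n0,
    fun i j hij => by simpa using hs hij, fun Z hZ => ?_⟩
  · refine c3.congr fun n => eLpNorm_congr_ae ?_
    filter_upwards [hb] with x hx
    rw [hx]
  · have h := hweak hZ.toLp
    simp only [L2.inner_def] at h
    have e : ∫ x in Ω, inner ℝ (weakGrad Ω u x) (Z x) = ∫ x in Ω, inner ℝ (b x) (hZ.toLp Z x) := by
      refine integral_congr_ae ?_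
      filter_upwards [hb, hZ.coeFn_toLp] with x hx hx2
      rw [hx, hx2]
    rw [e]
    refine h.congr fun n => integral_congr_ae ?_
    filter_upwards [(m3 (s n + n0)).coeFn_toLp, hZ.coeFn_toLp] with x hx hx2
    rw [hx, hx2]

/-- The space `C_c^∞(Ω)`. -/
def testSpace (Ω : Set (Eu N)) : Submodule ℝ (Eu N → ℝ) where
  carrier := {ψ | IsTest Ω ψ}
  add_mem' := fun {f g} hf hg => ⟨hf.1.add hg.1, hf.2.1.add hg.2.1,
    (tsupport_add f g).trans (union_subset hf.2.2 hg.2.2)⟩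
  zero_mem' := ⟨contDiff_const, HasCompactSupport.zero, by simp⟩
  smul_mem' := fun c f hf => ⟨contDiff_const.smul hf.1, hf.2.1.smul_left (f := fun _ => c),
    (tsupport_smul_subset_right (fun _ => c) f).trans hf.2.2⟩

/-- With test functions as the approximating space and `σ = 0`, the boundary component disappears.
-/
theorem memH10_of_bounded_gradients (hΩ : IsOpen Ω) {v : ℕ → Eu N → ℝ} (hv : ∀ n, IsTest Ω (v n))
    {u : Eu N → ℝ} (hu : MemLp u 2 (volume.restrict Ω))
    (hvu : Tendsto (fun n => eLpNorm (fun x => v n x - u x) 2 (volume.restrict Ω)) atTop (𝓝 0))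
    {C : ℝ≥0} (hC : ∀ n, eLpNorm (∇ (v n)) 2 (volume.restrict Ω) ≤ C) :
    MemH10 Ω u ∧
      ∃ s : ℕ → ℕ, StrictMono s ∧ ∀ Z : Eu N → Eu N, MemLp Z 2 (volume.restrict Ω) →
        Tendsto (fun n => ∫ x in Ω, inner ℝ (∇ (v (s n)) x) (Z x)) atTop
          (𝓝 (∫ x in Ω, inner ℝ (weakGrad Ω u x) (Z x))) := by
  obtain ⟨h1, ⟨p, hp, hpu, -⟩, h3⟩ := memH1_of_bounded_gradients hΩ (0 : Measure (Eu N))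
    (testSpace Ω) (fun ψ hψ => hψ.1) hv hu (φ := 0) (by simp) hvu (by simp) hC
  exact ⟨⟨h1, p, hp, hpu⟩, h3⟩

/-! ### Translation estimates, averages over balls, and Rellich's theorem. -/

theorem _root_.ENNReal.add_sq_le (a b : ℝ≥0∞) : (a + b) ^ 2 ≤ 2 * (a ^ 2 + b ^ 2) := by
  have := ENNReal.rpow_add_le_mul_rpow_add_rpow a b (p := 2) (by norm_num)
  norm_num at this
  exact_mod_cast this

theorem sq_lintegral_le {α : Type*} [MeasurableSpace α] (ν : Measure α)
    {f : α → ℝ≥0∞} (hf : AEMeasurable f ν) : (∫⁻ x, f x ∂ν) ^ 2 ≤ ν univ * ∫⁻ x, f x ^ 2 ∂ν := by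
  have h := eLpNorm_le_eLpNorm_mul_rpow_measure_univ (p := 1) (q := 2) (μ := ν) (f := f)
    (by norm_num) hf.aestronglyMeasurable
  have h2 := pow_le_pow_left₀ (by positivity) h 2
  rw [mul_pow, sq_eLpNorm_two, eLpNorm_one_eq_lintegral_enorm, ← ENNReal.rpow_natCast (_ ^ _),
    ← ENNReal.rpow_mul, mul_comm] at h2
  norm_num at h2
  exact h2

theorem enorm_sq_integral_le {α : Type*} [MeasurableSpace α] (ν : Measure α)
    {f : α → ℝ} (hf : AEStronglyMeasurable f ν) :
    ‖∫ x, f x ∂ν‖ₑ ^ 2 ≤ ν univ * ∫⁻ x, ‖f x‖ₑ ^ 2 ∂ν :=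
  (pow_le_pow_left₀ (by positivity) (enorm_integral_le_lintegral_enorm f) 2).trans
    (sq_lintegral_le ν hf.enorm)

/-- The fundamental theorem of calculus along a segment, then Cauchy–Schwarz, whose factor is the
length `τ` of the interval. It serves both for translations (`τ = 1`) and for lines running down to
the boundary. -/
theorem enorm_sub_sq_le_lintegral {v : Eu N → ℝ} (hv : ContDiff ℝ ∞ v) (x h : Eu N) {τ : ℝ}
    (hτ : 0 ≤ τ) : ‖v (x + τ • h) - v x‖ₑ ^ 2 ≤
      ENNReal.ofReal τ * (‖h‖ₑ ^ 2 * ∫⁻ t in Ioc (0 : ℝ) τ, ‖∇ v (x + t • h)‖ₑ ^ 2) := by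
  have hd : ∀ t : ℝ, HasDerivAt (fun t : ℝ => v (x + t • h)) (fderiv ℝ v (x + t • h) h) t := by
    intro t
    have h1 : HasDerivAt (fun t : ℝ => x + t • h) h t := by
      simpa using ((hasDerivAt_id t).smul_const h).const_add x
    exact ((hv.differentiable (by simp) (x + t • h)).hasFDerivAt).comp_hasDerivAt t h1
  have hc : Continuous fun t : ℝ => fderiv ℝ v (x + t • h) h :=
    ((hv.continuous_fderiv (by simp)).comp (by fun_prop)).clm_apply continuous_const
  have hint := intervalIntegral.integral_eq_sub_of_hasDerivAt (fun t _ => hd t)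
    (hc.intervalIntegrable 0 τ)
  rw [intervalIntegral.integral_of_le hτ] at hint
  simp only [zero_smul, add_zero] at hint
  rw [← hint, ← lintegral_const_mul' _ _ (by simp)]
  refine (enorm_sq_integral_le _ hc.aestronglyMeasurable).trans ?_
  simp only [Measure.restrict_apply_univ, Real.volume_Ioc, sub_zero]
  gcongr with t
  rw [← mul_pow]
  refine pow_le_pow_left₀ (by positivity) ?_ 2
  rw [← ofReal_norm, ← ofReal_norm, ← ofReal_norm, ← ENNReal.ofReal_mul (norm_nonneg _),
    norm_gradient, mul_comm]
  exact ENNReal.ofReal_le_ofReal (ContinuousLinearMap.le_opNorm _ _)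

theorem measurable_enorm_gradient_sq {v : Eu N → ℝ} (hv : ContDiff ℝ ∞ v) :
    Measurable fun x => ‖∇ v x‖ₑ ^ 2 := (continuous_gradient hv).measurable.enorm.pow_const 2

theorem lintegral_enorm_sub_translate_sq_le {v : Eu N → ℝ} (hv : ContDiff ℝ ∞ v) (h : Eu N) :
    ∫⁻ x, ‖v (x + h) - v x‖ₑ ^ 2 ≤ ‖h‖ₑ ^ 2 * ∫⁻ x, ‖∇ v x‖ₑ ^ 2 := by
  calc ∫⁻ x, ‖v (x + h) - v x‖ₑ ^ 2
      ≤ ∫⁻ x, ‖h‖ₑ ^ 2 * ∫⁻ t in Ioc (0 : ℝ) 1, ‖∇ v (x + t • h)‖ₑ ^ 2 :=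
        lintegral_mono fun x => by
          simpa using enorm_sub_sq_le_lintegral hv x h zero_le_one
    _ = ‖h‖ₑ ^ 2 * ∫⁻ t in Ioc (0 : ℝ) 1, ∫⁻ x, ‖∇ v (x + t • h)‖ₑ ^ 2 := by
        rw [lintegral_const_mul' _ _ (by simp), lintegral_lintegral_swap]
        have : Continuous fun p : Eu N × ℝ => p.1 + p.2 • h := by fun_prop
        exact ((measurable_enorm_gradient_sq hv).comp this.measurable).aemeasurable
    _ = ‖h‖ₑ ^ 2 * ∫⁻ x, ‖∇ v x‖ₑ ^ 2 := by
        simp only [lintegral_add_right_eq_self (μ := (volume : Measure (Eu N)))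
          (fun x => ‖∇ v x‖ₑ ^ 2)]
        simp

theorem gradient_eq_zero_of_notMem_tsupport {ψ : Eu N → ℝ} {x : Eu N} (hx : x ∉ tsupport ψ) :
    ∇ ψ x = 0 := by
  have : fderiv ℝ ψ x = 0 := by
    by_contra h
    exact hx (support_fderiv_subset ℝ h)
  rw [gradient, this, map_zero]

theorem IsTest.lintegral_gradient {ψ : Eu N → ℝ} (hψ : IsTest Ω ψ) :
    ∫⁻ x, ‖∇ ψ x‖ₑ ^ 2 = ∫⁻ x in Ω, ‖∇ ψ x‖ₑ ^ 2 := by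
  refine (setLIntegral_eq_of_support_subset fun x hx => ?_).symm
  by_contra h
  exact hx (by simp [gradient_eq_zero_of_notMem_tsupport (fun h' => h (hψ.2.2 h'))])

/-- The mean of `ψ` over the ball of radius `δ` around `x`. -/
noncomputable def ballAverage (δ : ℝ) (ψ : Eu N → ℝ) (x : Eu N) : ℝ :=
  ∫ h, ψ (x + h) ∂(ProbabilityTheory.cond volume (Metric.ball (0 : Eu N) δ))

theorem isProbabilityMeasure_cond_ball {δ : ℝ} (hδ : 0 < δ) :
    IsProbabilityMeasure (ProbabilityTheory.cond volume (Metric.ball (0 : Eu N) δ)) :=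
  ProbabilityTheory.cond_isProbabilityMeasure_of_finite (Metric.measure_ball_pos _ _ hδ).ne'
    measure_ball_lt_top.ne

theorem IsTest.stronglyMeasurable_ballAverage {ψ : Eu N → ℝ} (hψ : IsTest Ω ψ) {δ : ℝ}
    (hδ : 0 < δ) : StronglyMeasurable (ballAverage δ ψ) := by
  have := isProbabilityMeasure_cond_ball (N := N) hδ
  have hc : Continuous (Function.uncurry fun x h : Eu N => ψ (x + h)) :=
    hψ.1.continuous.comp (by fun_prop)
  exact hc.stronglyMeasurable.integral_prod_right

/-- The difference is a mean of ψ(x + h) - ψ(x) over |h| < δ. Cauchy–Schwarz for a probability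
measure and Tonelli reduce it to the translation estimate on the whole space; test functions carry
no gradient outside `Ω`. -/
theorem IsTest.eLpNorm_ballAverage_sub_le {ψ : Eu N → ℝ} (hψ : IsTest Ω ψ) {δ : ℝ}
    (hδ : 0 < δ) : eLpNorm (fun x => ballAverage δ ψ x - ψ x) 2 (volume.restrict Ω) ≤
      ENNReal.ofReal δ * eLpNorm (∇ ψ) 2 (volume.restrict Ω) := by
  have := isProbabilityMeasure_cond_ball (N := N) hδ
  rw [← ENNReal.pow_le_pow_left_iff two_ne_zero, mul_pow, sq_eLpNorm_two, sq_eLpNorm_two,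
    ← hψ.lintegral_gradient]
  set ν := ProbabilityTheory.cond volume (Metric.ball (0 : Eu N) δ) with hν
  have hcont : ∀ x, Continuous fun h => ψ (x + h) := fun x => hψ.1.continuous.comp (by fun_prop)
  have hint : ∀ x, Integrable (fun h => ψ (x + h)) ν := by
    intro x
    obtain ⟨C, hC⟩ := hψ.1.continuous.bounded_above_of_compact_support hψ.2.1
    exact Integrable.of_bound (hcont x).aestronglyMeasurable C (ae_of_all _ fun h => hC _)
  calc ∫⁻ x in Ω, ‖ballAverage δ ψ x - ψ x‖ₑ ^ 2
      ≤ ∫⁻ x, ‖ballAverage δ ψ x - ψ x‖ₑ ^ 2 := setLIntegral_le_lintegral _ _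
    _ ≤ ∫⁻ x, ∫⁻ h, ‖ψ (x + h) - ψ x‖ₑ ^ 2 ∂ν := by
        refine lintegral_mono fun x => ?_
        have e : ballAverage δ ψ x - ψ x = ∫ h, (ψ (x + h) - ψ x) ∂ν := by
          rw [integral_sub (hint x) (integrable_const _)]; simp [ballAverage, hν]
        rw [e]
        simpa using enorm_sq_integral_le ν
          ((hcont x).sub continuous_const).aestronglyMeasurable
    _ = ∫⁻ h, (∫⁻ x, ‖ψ (x + h) - ψ x‖ₑ ^ 2) ∂ν := by
        rw [lintegral_lintegral_swap]
        have c1 : Continuous fun p : Eu N × Eu N => ψ (p.1 + p.2) - ψ p.1 :=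
          (hψ.1.continuous.comp (by fun_prop)).sub (hψ.1.continuous.comp continuous_fst)
        exact (c1.measurable.enorm.pow_const 2).aemeasurable
    _ ≤ ∫⁻ h, (ENNReal.ofReal δ ^ 2 * ∫⁻ x, ‖∇ ψ x‖ₑ ^ 2) ∂ν := by
        refine lintegral_mono_ae ?_
        have hae : ∀ᵐ h ∂ν, h ∈ Metric.ball (0 : Eu N) δ :=
          ProbabilityTheory.ae_cond_mem measurableSet_ball
        filter_upwards [hae] with h hh
        refine (lintegral_enorm_sub_translate_sq_le hψ.1 h).trans ?_
        gcongr
        rw [← ofReal_norm]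
        exact ENNReal.ofReal_le_ofReal (mem_ball_zero_iff.1 hh).le
    _ = _ := by simp

/-- For fixed `δ` this is a bound uniform in `x`, which supplies the dominating constant for
sequences bounded in `L²`. -/
theorem IsTest.enorm_ballAverage_sq_le {ψ : Eu N → ℝ} (hψ : IsTest Ω ψ) {δ : ℝ} (hδ : 0 < δ)
    (x : Eu N) : ‖ballAverage δ ψ x‖ₑ ^ 2 ≤
      (volume (Metric.ball (0 : Eu N) δ))⁻¹ * eLpNorm ψ 2 (volume.restrict Ω) ^ 2 := by
  have := isProbabilityMeasure_cond_ball (N := N) hδ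
  have hcont : Continuous fun h => ψ (x + h) := hψ.1.continuous.comp (by fun_prop)
  refine (enorm_sq_integral_le _ hcont.aestronglyMeasurable).trans ?_
  rw [measure_univ, one_mul, ProbabilityTheory.cond, lintegral_smul_measure, smul_eq_mul]
  gcongr
  refine (setLIntegral_le_lintegral _ _).trans ?_
  rw [lintegral_add_left_eq_self (μ := (volume : Measure (Eu N))) (fun y => ‖ψ y‖ₑ ^ 2),
    sq_eLpNorm_two]
  refine (setLIntegral_eq_of_support_subset fun y hy => ?_).symm.le
  by_contra h
  exact hy (by simp [image_eq_zero_of_notMem_tsupport (fun h' => h (hψ.2.2 h'))])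

/-- Written as a pairing with the indicator of a ball, the mean at each point converges when `ψ`
converges weakly in `L²(Ω)`. -/
theorem IsTest.ballAverage_eq {ψ : Eu N → ℝ} (hψ : IsTest Ω ψ) (δ : ℝ) (x : Eu N) :
    ballAverage δ ψ x = (volume (Metric.ball (0 : Eu N) δ))⁻¹.toReal *
      ∫ y in Ω, ψ y * (Metric.ball x δ).indicator 1 y := by
  rw [ballAverage, ProbabilityTheory.cond, integral_smul_measure, smul_eq_mul]
  congr 1
  rw [← integral_indicator measurableSet_ball, setIntegral_eq_integral_of_forall_compl_eq_zero,
    ← integral_add_left_eq_self (fun y => ψ y * (Metric.ball x δ).indicator 1 y) x]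
  · refine integral_congr_ae (ae_of_all _ fun h => ?_)
    by_cases hh : h ∈ Metric.ball (0 : Eu N) δ
    · have : x + h ∈ Metric.ball x δ := by simpa using hh
      simp only [indicator_of_mem hh, indicator_of_mem this, Pi.one_apply, mul_one]
    · have : x + h ∉ Metric.ball x δ := by simpa using hh
      simp only [indicator_of_notMem hh, indicator_of_notMem this, mul_zero]
  · intro y hy
    rw [image_eq_zero_of_notMem_tsupport (fun h => hy (hψ.2.2 h)), zero_mul]

/-- A weakly convergent sequence of test functions has strongly convergent means over balls. -/
theorem exists_tendsto_ballAverage (hb : Bornology.IsBounded Ω) {ψ : ℕ → Eu N → ℝ}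
    (hψ : ∀ n, IsTest Ω (ψ n)) {C : ℝ≥0} (hC : ∀ n, eLpNorm (ψ n) 2 (volume.restrict Ω) ≤ C)
    {a : Eu N → ℝ} (ha : ∀ z : Eu N → ℝ, MemLp z 2 (volume.restrict Ω) →
      Tendsto (fun n => ∫ x in Ω, ψ n x * z x) atTop (𝓝 (∫ x in Ω, a x * z x)))
    {δ : ℝ} (hδ : 0 < δ) :
    ∃ A : Eu N → ℝ, StronglyMeasurable A ∧
      Tendsto (fun n => eLpNorm (fun x => ballAverage δ (ψ n) x - A x) 2 (volume.restrict Ω))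
        atTop (𝓝 0) := by
  have : IsFiniteMeasure (volume.restrict Ω) := isFiniteMeasure_restrict.2 hb.measure_lt_top.ne
  set A : Eu N → ℝ := fun x => (volume (Metric.ball (0 : Eu N) δ))⁻¹.toReal *
      ∫ y in Ω, a y * (Metric.ball x δ).indicator 1 y with hA
  have hpt : ∀ x, Tendsto (fun n => ballAverage δ (ψ n) x) atTop (𝓝 (A x)) := by
    intro x
    simp only [(hψ _).ballAverage_eq]
    refine (ha _ ?_).const_mul _
    exact (memLp_const (1 : ℝ)).indicator measurableSet_ball
  have hmA : StronglyMeasurable A := stronglyMeasurable_of_tendsto atTop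
    (fun n => (hψ n).stronglyMeasurable_ballAverage hδ) (tendsto_pi_nhds.2 hpt)
  refine ⟨A, hmA, ?_⟩
  set M : ℝ≥0∞ := (volume (Metric.ball (0 : Eu N) δ))⁻¹ * (C : ℝ≥0∞) ^ 2 with hM
  have hMtop : M ≠ ⊤ := ENNReal.mul_ne_top
    (ENNReal.inv_ne_top.2 (Metric.measure_ball_pos _ _ hδ).ne') (by simp)
  have hbn : ∀ n x, ‖ballAverage δ (ψ n) x‖ₑ ^ 2 ≤ M := fun n x =>
    ((hψ n).enorm_ballAverage_sq_le hδ x).trans (by rw [hM]; gcongr; exact hC n)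
  have hbA : ∀ x, ‖A x‖ₑ ^ 2 ≤ M := fun x =>
    le_of_tendsto' (ENNReal.Tendsto.pow (hpt x).enorm) fun n => hbn n x
  have hsq : Tendsto (fun n => ∫⁻ x in Ω, ‖ballAverage δ (ψ n) x - A x‖ₑ ^ 2) atTop (𝓝 0) := by
    have := tendsto_lintegral_of_dominated_convergence (μ := volume.restrict Ω)
      (F := fun n x => ‖ballAverage δ (ψ n) x - A x‖ₑ ^ 2) (f := 0) (fun _ => 4 * M) ?_ ?_ ?_ ?_
    · simpa using this
    · exact fun n => (((hψ n).stronglyMeasurable_ballAverage hδ).sub hmA).measurable.enorm.pow_const 2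
    · refine fun n => ae_of_all _ fun x => ?_
      have h1 : ‖ballAverage δ (ψ n) x - A x‖ₑ ≤ ‖ballAverage δ (ψ n) x‖ₑ + ‖A x‖ₑ := enorm_sub_le
      calc ‖ballAverage δ (ψ n) x - A x‖ₑ ^ 2 ≤ (‖ballAverage δ (ψ n) x‖ₑ + ‖A x‖ₑ) ^ 2 := by gcongr
        _ ≤ 2 * (‖ballAverage δ (ψ n) x‖ₑ ^ 2 + ‖A x‖ₑ ^ 2) := ENNReal.add_sq_le _ _
        _ ≤ 2 * (M + M) := by gcongr; exacts [hbn n x, hbA x]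
        _ = 4 * M := by ring
    · rw [lintegral_const]
      exact ENNReal.mul_ne_top (ENNReal.mul_ne_top (by simp) hMtop) (measure_ne_top _ _)
    · refine ae_of_all _ fun x => ?_
      simpa using ENNReal.Tendsto.pow (n := 2) ((hpt x).sub_const (A x)).enorm
  exact tendsto_eLpNorm_two_zero hsq

/-- Rellich's theorem, for test functions. -/
theorem exists_tendsto_of_bounded_gradients (hb : Bornology.IsBounded Ω)
    {ψ : ℕ → Eu N → ℝ} (hψ : ∀ n, IsTest Ω (ψ n)) {C : ℝ≥0}
    (hC : ∀ n, eLpNorm (ψ n) 2 (volume.restrict Ω) ≤ C)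
    (hC' : ∀ n, eLpNorm (∇ (ψ n)) 2 (volume.restrict Ω) ≤ C) :
    ∃ (s : ℕ → ℕ) (u : Eu N → ℝ), StrictMono s ∧ MemLp u 2 (volume.restrict Ω) ∧
      Tendsto (fun n => eLpNorm (fun x => ψ (s n) x - u x) 2 (volume.restrict Ω)) atTop (𝓝 0) := by
  set μ := volume.restrict Ω with hμ
  have : Fact ((2 : ℝ≥0∞) ≠ ⊤) := ⟨by simp⟩
  have hm : ∀ n, MemLp (ψ n) 2 μ := fun n => (hψ n).memLp _ _
  obtain ⟨a, s, hs, ha⟩ := exists_weakly_convergent_subseq (y := fun n => (hm n).toLp) (C := C)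
    (fun n => by
      rw [Lp.norm_toLp]
      exact ENNReal.toReal_le_of_le_ofReal C.2 (by simpa using hC n))
  have ha' : ∀ z : Eu N → ℝ, MemLp z 2 μ →
      Tendsto (fun n => ∫ x in Ω, ψ (s n) x * z x) atTop (𝓝 (∫ x in Ω, a x * z x)) := by
    intro z hz
    have h := ha hz.toLp
    simp only [L2.inner_def] at h
    have e : ∫ x in Ω, a x * z x = ∫ x in Ω, inner ℝ (a x) (hz.toLp z x) := by
      refine integral_congr_ae ?_
      filter_upwards [hz.coeFn_toLp] with x hx2
      rw [hx2]; simp [mul_comm]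
    rw [e]
    refine h.congr fun n => integral_congr_ae ?_
    filter_upwards [(hm (s n)).coeFn_toLp, hz.coeFn_toLp] with x hx hx2
    rw [hx, hx2]; simp [mul_comm]
  -- The bounded gradients keep each function within `δ C` of its ball means, uniformly in `n`, and
  -- for fixed `δ` the means converge strongly.
  have hcau : CauchySeq fun n => (hm (s n)).toLp := by
    rw [EMetric.cauchySeq_iff]
    intro ε hε
    obtain ⟨r, hr0, hr⟩ := ENNReal.lt_iff_exists_nnreal_btwn.1 hε
    have hr0' : (0 : ℝ) < r := by exact_mod_cast hr0
    have hCpos : (0 : ℝ) < C + 1 := by positivity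
    -- This makes `δ C ≤ r / 4`; the summand 1 avoids division by zero. Two errors `r / 4` put each
    -- late function within `r / 2` of `A`.
    set δ : ℝ := r / (4 * (C + 1)) with hδd
    have hδ : 0 < δ := by positivity
    obtain ⟨A, hmA, hA⟩ := exists_tendsto_ballAverage hb (fun n => hψ (s n)) (fun n => hC (s n)) ha' hδ
    obtain ⟨n0, hn0⟩ := eventually_atTop.1 (hA.eventually
      (ge_mem_nhds (show (0 : ℝ≥0∞) < ENNReal.ofReal (r / 4) by simpa using hr0)))
    have hclose : ∀ n ≥ n0, eLpNorm (fun x => ψ (s n) x - A x) 2 μ ≤ ENNReal.ofReal (r / 2) := by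
      intro n hn
      have h1 := (hψ (s n)).eLpNorm_ballAverage_sub_le hδ
      have h2 : ENNReal.ofReal δ * eLpNorm (∇ (ψ (s n))) 2 μ ≤ ENNReal.ofReal (r / 4) := by
        calc _ ≤ ENNReal.ofReal δ * ENNReal.ofReal C := by gcongr; simpa using hC' (s n)
          _ = ENNReal.ofReal (δ * C) := (ENNReal.ofReal_mul hδ.le).symm
          _ ≤ _ := by
            refine ENNReal.ofReal_le_ofReal ?_
            rw [hδd, div_mul_eq_mul_div, div_le_div_iff₀ (by positivity) (by norm_num)]
            nlinarith [C.2]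
      have m1 := ((hψ (s n)).stronglyMeasurable_ballAverage hδ).aestronglyMeasurable (μ := μ)
      have m2 := (hψ (s n)).1.continuous.aestronglyMeasurable (μ := μ)
      have e : (fun x => ψ (s n) x - A x) = (fun x => ψ (s n) x - ballAverage δ (ψ (s n)) x) +
          fun x => ballAverage δ (ψ (s n)) x - A x := by ext x; simp
      rw [e]
      refine (eLpNorm_add_le (m2.sub m1) (m1.sub hmA.aestronglyMeasurable) (by simp)).trans ?_
      rw [eLpNorm_sub_comm (ψ (s n)) (ballAverage δ (ψ (s n)))]
      calc _ ≤ ENNReal.ofReal (r / 4) + ENNReal.ofReal (r / 4) :=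
            add_le_add (h1.trans h2) (hn0 n hn)
        _ = _ := by rw [← ENNReal.ofReal_add (by positivity) (by positivity)]; ring_nf
    refine ⟨n0, fun m hm' n hn => lt_of_le_of_lt ?_ hr⟩
    rw [Lp.edist_toLp_toLp]
    have e : ψ (s m) - ψ (s n) = (fun x => ψ (s m) x - A x) + fun x => A x - ψ (s n) x := by
      ext x; simp
    have m2 := fun n => (hψ (s n)).1.continuous.aestronglyMeasurable (μ := μ)
    rw [e]
    refine (eLpNorm_add_le ((m2 m).sub hmA.aestronglyMeasurable)
      (hmA.aestronglyMeasurable.sub (m2 n)) (by simp)).trans ?_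
    rw [eLpNorm_sub_comm A (ψ (s n))]
    calc _ ≤ ENNReal.ofReal (r / 2) + ENNReal.ofReal (r / 2) :=
          add_le_add (hclose m hm') (hclose n hn)
      _ = r := by rw [← ENNReal.ofReal_add (by positivity) (by positivity)]; simp
  obtain ⟨u, hu⟩ := cauchySeq_tendsto_of_complete hcau
  exact ⟨s, u, hs, Lp.memLp u,
    tendsto_eLpNorm_sub_of_tendsto_toLp hu (fun n => (hm (s n)).coeFn_toLp) (ae_eq_refl _)⟩

/-! ### Surface measure of a graph and integration over a strip above it. -/

section Graph

/-- The hyperplane `ν^⊥`. -/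
noncomputable abbrev hyperplane (ν : Eu N) : Submodule ℝ (Eu N) := (ℝ ∙ ν)ᗮ

theorem sub_inner_smul_mem_hyperplane {ν : Eu N} (hν : ‖ν‖ = 1) (x : Eu N) :
    x - inner ℝ ν x • ν ∈ hyperplane ν := by
  rw [Submodule.mem_orthogonal_singleton_iff_inner_right, inner_sub_right, inner_smul_right,
    real_inner_self_eq_norm_sq, hν]
  ring

/-- The orthogonal projection to `ν^⊥`, for a unit vector `ν`. -/
noncomputable def hyperplaneProj {ν : Eu N} (hν : ‖ν‖ = 1) : Eu N →L[ℝ] hyperplane ν :=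
  (ContinuousLinearMap.id ℝ (Eu N) - (innerSL ℝ ν).smulRight ν).codRestrict (hyperplane ν)
    (fun x => by simpa using sub_inner_smul_mem_hyperplane hν x)

theorem coe_hyperplaneProj {ν : Eu N} (hν : ‖ν‖ = 1) (x : Eu N) :
    (hyperplaneProj hν x : Eu N) = x - inner ℝ ν x • ν := by
  simp [hyperplaneProj]

theorem norm_sub_inner_smul_le {ν : Eu N} (hν : ‖ν‖ = 1) (x : Eu N) :
    ‖x - inner ℝ ν x • ν‖ ≤ ‖x‖ := by
  refine le_of_sq_le_sq ?_ (norm_nonneg x)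
  rw [norm_sub_sq_real, inner_smul_right, norm_smul, hν, real_inner_comm, mul_one,
    Real.norm_eq_abs, sq_abs]
  nlinarith [sq_nonneg (inner ℝ x ν)]

theorem lipschitzWith_hyperplaneProj {ν : Eu N} (hν : ‖ν‖ = 1) :
    LipschitzWith 1 (hyperplaneProj hν) := by
  refine (hyperplaneProj hν).lipschitzWith_of_opNorm_le ?_
  refine ContinuousLinearMap.opNorm_le_bound _ zero_le_one fun x => ?_
  rw [NNReal.coe_one, one_mul]
  change ‖(hyperplaneProj hν x : Eu N)‖ ≤ ‖x‖
  rw [coe_hyperplaneProj]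
  exact norm_sub_inner_smul_le hν x

theorem inner_hyperplane {ν : Eu N} (y : hyperplane ν) : inner ℝ ν (y : Eu N) = 0 :=
  (Submodule.mem_orthogonal_singleton_iff_inner_right).1 y.2

/-- The decomposition `ℝᴺ = ν^⊥ × ℝ`. -/
noncomputable def hyperplaneProdEquiv {ν : Eu N} (hν : ‖ν‖ = 1) : (hyperplane ν × ℝ) ≃L[ℝ] Eu N :=
  ContinuousLinearEquiv.equivOfInverse
    ((hyperplane ν).subtypeL.coprod (ContinuousLinearMap.toSpanSingleton ℝ ν))
    ((hyperplaneProj hν).prod (innerSL ℝ ν))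
    (by
      rintro ⟨y, t⟩
      have h : inner ℝ ν ((y : Eu N) + t • ν) = t := by
        rw [inner_add_right, inner_hyperplane, inner_smul_right, real_inner_self_eq_norm_sq, hν]
        ring
      refine Prod.ext (Subtype.ext ?_) ?_
      · change ((hyperplaneProj hν ((y : Eu N) + t • ν) : hyperplane ν) : Eu N) = y
        rw [coe_hyperplaneProj, h, add_sub_cancel_right]
      · simpa using h)
    (by intro x; simp [coe_hyperplaneProj])

theorem hyperplaneProdEquiv_apply {ν : Eu N} (hν : ‖ν‖ = 1) (y : hyperplane ν) (t : ℝ) :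
    hyperplaneProdEquiv hν (y, t) = (y : Eu N) + t • ν := by
  simp [hyperplaneProdEquiv]

theorem hyperplaneProj_add_smul {ν : Eu N} (hν : ‖ν‖ = 1) (y : hyperplane ν) (t : ℝ) :
    hyperplaneProj hν ((y : Eu N) + t • ν) = y := by
  refine Subtype.ext ?_
  rw [coe_hyperplaneProj, inner_add_right, inner_hyperplane, inner_smul_right,
    real_inner_self_eq_norm_sq, hν]
  simp

theorem finrank_hyperplane {ν : Eu N} (hν : ‖ν‖ = 1) :
    (Module.finrank ℝ (hyperplane ν) : ℝ) = (N : ℝ) - 1 := by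
  have h0 : ν ≠ 0 := by rintro rfl; simp at hν
  have h1 := Submodule.finrank_add_finrank_orthogonal (ℝ ∙ ν)
  rw [finrank_span_singleton h0, finrank_euclideanSpace_fin] at h1
  have h2 : (1 : ℝ) + Module.finrank ℝ (hyperplane ν) = N := by exact_mod_cast h1
  linarith

theorem isAddHaarMeasure_hausdorff_hyperplane {ν : Eu N} (hν : ‖ν‖ = 1) :
    (Measure.hausdorffMeasure ((N : ℝ) - 1) : Measure (hyperplane ν)).IsAddHaarMeasure := by
  rw [← finrank_hyperplane hν]; infer_instance

/-- The projection of a piece of a graph over `ν^⊥` does not increase the surface measure. -/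
theorem lintegral_graph_le {ν : Eu N} (hν : ‖ν‖ = 1) (hN : 1 ≤ N) {γ : Eu N → ℝ}
    (hγ : Continuous γ) {S : Set (Eu N)} (hS : IsClosed S) {g : Eu N → ℝ≥0∞} (hg : Measurable g) :
    ∫⁻ y : hyperplane ν in {y : hyperplane ν | (y : Eu N) + γ y • ν ∈ S}, g ((y : Eu N) + γ y • ν)
        ∂(Measure.hausdorffMeasure ((N : ℝ) - 1)) ≤
      ∫⁻ x in S, g x ∂(Measure.hausdorffMeasure ((N : ℝ) - 1)) := by
  have hN' : (0 : ℝ) ≤ (N : ℝ) - 1 := by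
    rw [sub_nonneg]; exact_mod_cast hN
  have hb : Continuous fun y : hyperplane ν => (y : Eu N) + γ y • ν := by fun_prop
  have hP := (hyperplaneProj hν).continuous
  set D : Set (hyperplane ν) := {y | (y : Eu N) + γ y • ν ∈ S} with hD
  have hDm : MeasurableSet D := (hS.preimage hb).measurableSet
  set b' : Eu N → Eu N := fun x => (hyperplaneProj hν x : Eu N) + γ (hyperplaneProj hν x) • ν with hb'
  have hb'c : Continuous b' := hb.comp hP
  -- The part of `S` lying on the graph, as the fixed points of the vertical projection onto the
  -- graph.
  set S' : Set (Eu N) := {x ∈ S | b' x = x} with hS'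
  have hS'm : MeasurableSet S' := (hS.inter (isClosed_eq hb'c continuous_id)).measurableSet
  -- The orthogonal projection is 1-Lipschitz and so does not increase Hausdorff measure; this
  -- one-sided comparison replaces the area formula.
  have hle : (Measure.hausdorffMeasure ((N : ℝ) - 1) : Measure (hyperplane ν)).restrict D ≤
      ((Measure.hausdorffMeasure ((N : ℝ) - 1) : Measure (Eu N)).restrict S').map
        (hyperplaneProj hν) := by
    refine Measure.le_iff.2 fun A hA => ?_
    rw [Measure.restrict_apply hA, Measure.map_apply hP.measurable hA,
      Measure.restrict_apply (hP.measurable hA)]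
    have hsub : A ∩ D ⊆ hyperplaneProj hν '' (hyperplaneProj hν ⁻¹' A ∩ S') := by
      rintro y ⟨hyA, hyD⟩
      have hy := hyperplaneProj_add_smul hν y (γ y)
      refine ⟨(y : Eu N) + γ y • ν, ⟨?_, hyD, ?_⟩, hy⟩
      · rw [mem_preimage, hy]; exact hyA
      · simp only [hb', hy]
    refine (measure_mono hsub).trans ?_
    simpa using (lipschitzWith_hyperplaneProj hν).hausdorffMeasure_image_le hN'
      (hyperplaneProj hν ⁻¹' A ∩ S')
  refine (lintegral_mono' hle le_rfl).trans ?_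
  rw [lintegral_map (f := fun y : hyperplane ν => g ((y : Eu N) + γ y • ν))
    (hg.comp hb.measurable) hP.measurable]
  calc ∫⁻ x in S', g (b' x) ∂(Measure.hausdorffMeasure ((N : ℝ) - 1))
      = ∫⁻ x in S', g x ∂(Measure.hausdorffMeasure ((N : ℝ) - 1)) :=
        setLIntegral_congr_fun hS'm fun x hx => by rw [hx.2]
    _ ≤ _ := lintegral_mono_set fun x hx => hx.1

/-- Integration over a strip of height `a` above a graph over `ν^⊥`. -/
theorem exists_lintegral_strip_le {ν : Eu N} (hν : ‖ν‖ = 1) (hN : 1 ≤ N) :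
    ∃ c : ℝ≥0∞, c ≠ ⊤ ∧ ∀ (γ : Eu N → ℝ), Continuous γ → ∀ S : Set (Eu N), IsClosed S →
      ∀ g : Eu N → ℝ≥0∞, Measurable g → ∀ a : ℝ,
      ∫⁻ x in {x | (γ (x - inner ℝ ν x • ν) < inner ℝ ν x ∧
            inner ℝ ν x < γ (x - inner ℝ ν x • ν) + a) ∧
          (x - inner ℝ ν x • ν) + γ (x - inner ℝ ν x • ν) • ν ∈ S},
          g ((x - inner ℝ ν x • ν) + γ (x - inner ℝ ν x • ν) • ν) ≤
        c * ENNReal.ofReal a * ∫⁻ x in S, g x ∂(Measure.hausdorffMeasure ((N : ℝ) - 1)) := by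
  have hH := isAddHaarMeasure_hausdorff_hyperplane hν
  set μH : Measure (hyperplane ν) := Measure.hausdorffMeasure ((N : ℝ) - 1) with hμH
  set e := hyperplaneProdEquiv hν with he
  -- Hausdorff measure of dimension `N - 1` is a Haar measure on the hyperplane, so by uniqueness of
  -- Haar measure its product with length is Lebesgue measure up to a finite factor, whose value is
  -- irrelevant.
  obtain ⟨c, hc, hvol⟩ : ∃ c : ℝ≥0∞, c ≠ ⊤ ∧
      (volume : Measure (Eu N)) = c • (μH.prod volume).map e :=
    ⟨Measure.addHaarScalarFactor volume ((μH.prod volume).map e), ENNReal.coe_ne_top,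
      Measure.isAddLeftInvariant_eq_smul _ _⟩
  refine ⟨c, hc, fun γ hγ S hS g hg a => ?_⟩
  have hPc : Continuous fun x : Eu N => x - inner ℝ ν x • ν := by fun_prop
  have hγP : Continuous fun x : Eu N => γ (x - inner ℝ ν x • ν) := hγ.comp hPc
  have hic : Continuous fun x : Eu N => inner ℝ ν x := by fun_prop
  have hbc : Continuous fun x : Eu N =>
    (x - inner ℝ ν x • ν) + γ (x - inner ℝ ν x • ν) • ν := hPc.add (hγP.smul continuous_const)
  set T : Set (Eu N) := {x | (γ (x - inner ℝ ν x • ν) < inner ℝ ν x ∧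
            inner ℝ ν x < γ (x - inner ℝ ν x • ν) + a) ∧
          (x - inner ℝ ν x • ν) + γ (x - inner ℝ ν x • ν) • ν ∈ S} with hT
  have hTm : MeasurableSet T := ((measurableSet_lt hγP.measurable hic.measurable).inter
    (measurableSet_lt hic.measurable (hγP.add continuous_const).measurable)).inter
    (hS.preimage hbc).measurableSet
  set D : Set (hyperplane ν) := {y | (y : Eu N) + γ y • ν ∈ S} with hD
  have hb : Continuous fun y : hyperplane ν => (y : Eu N) + γ y • ν := by fun_prop
  have hDm : MeasurableSet D := (hS.preimage hb).measurableSet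
  have hFm : Measurable (T.indicator fun x =>
      g ((x - inner ℝ ν x • ν) + γ (x - inner ℝ ν x • ν) • ν)) :=
    (hg.comp hbc.measurable).indicator hTm
  rw [← lintegral_indicator hTm, hvol, lintegral_smul_measure, smul_eq_mul, mul_assoc,
    lintegral_map hFm e.continuous.measurable,
    lintegral_prod (fun p => T.indicator (fun x =>
      g ((x - inner ℝ ν x • ν) + γ (x - inner ℝ ν x • ν) • ν)) (e p))
      (hFm.comp e.continuous.measurable).aemeasurable]
  gcongr
  have hinner : ∀ (y : hyperplane ν) (t : ℝ), inner ℝ ν (e (y, t)) = t := by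
    intro y t
    rw [he, hyperplaneProdEquiv_apply, inner_add_right, inner_hyperplane, inner_smul_right,
      real_inner_self_eq_norm_sq, hν]
    ring
  have hproj : ∀ (y : hyperplane ν) (t : ℝ), e (y, t) - t • ν = y := by
    intro y t
    rw [he, hyperplaneProdEquiv_apply]; simp
  calc ∫⁻ y, ∫⁻ t, T.indicator (fun x =>
          g ((x - inner ℝ ν x • ν) + γ (x - inner ℝ ν x • ν) • ν)) (e (y, t)) ∂volume ∂μH
      = ∫⁻ y, ENNReal.ofReal a * D.indicator (fun y => g ((y : Eu N) + γ y • ν)) y ∂μH := by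
        refine lintegral_congr fun y => ?_
        by_cases hy : y ∈ D
        · have : ∀ t, T.indicator (fun x =>
              g ((x - inner ℝ ν x • ν) + γ (x - inner ℝ ν x • ν) • ν)) (e (y, t)) =
              (Ioo (γ y) (γ y + a)).indicator (fun _ => g ((y : Eu N) + γ y • ν)) t := by
            intro t
            have hiff : e (y, t) ∈ T ↔ t ∈ Ioo (γ y) (γ y + a) := by
              simp only [hT, mem_ofPred_eq, hinner, hproj, mem_Ioo]
              exact and_iff_left hy
            by_cases ht : t ∈ Ioo (γ y) (γ y + a)
            · rw [indicator_of_mem ht, indicator_of_mem (hiff.2 ht), hinner, hproj]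
            · rw [indicator_of_notMem ht, indicator_of_notMem (mt hiff.1 ht)]
          simp only [this]
          rw [lintegral_indicator measurableSet_Ioo, setLIntegral_const, Real.volume_Ioo,
            indicator_of_mem hy, mul_comm]
          simp
        · have : ∀ t, e (y, t) ∉ T := by
            intro t ht
            have := ht.2
            rw [hinner, hproj] at this
            exact hy this
          simp [indicator_of_notMem (this _), indicator_of_notMem hy]
    _ = ENNReal.ofReal a * ∫⁻ y in D, g ((y : Eu N) + γ y • ν) ∂μH := by
        rw [lintegral_const_mul' _ _ (by simp), lintegral_indicator hDm]
    _ ≤ _ := by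
        gcongr
        exact lintegral_graph_le hν hN hγ hS hg

end Graph

/-! ### The `L²` estimate in a thin layer along a Lipschitz boundary. -/

theorem sub_inner_smul_invariant {ν : Eu N} (hν : ‖ν‖ = 1) (x : Eu N) (s : ℝ) :
    (x - s • ν) - inner ℝ ν (x - s • ν) • ν = x - inner ℝ ν x • ν := by
  rw [inner_sub_right, inner_smul_right, real_inner_self_eq_norm_sq, hν]
  module

theorem inner_sub_smul_unit {ν : Eu N} (hν : ‖ν‖ = 1) (x : Eu N) (s : ℝ) :
    inner ℝ ν (x - s • ν) = inner ℝ ν x - s := by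
  rw [inner_sub_right, inner_smul_right, real_inner_self_eq_norm_sq, hν]
  ring

/-- One inequality passes from `Ω` to its closure by continuity; the other holds because the open
set `Ω` does not meet its frontier. -/
theorem eq_of_mem_frontier_chart (hΩ : IsOpen Ω) {x₀ ν : Eu N} {r : ℝ} {γ : Eu N → ℝ}
    (hγ : Continuous γ)
    (hchart : ∀ y ∈ Metric.ball x₀ r, (y ∈ Ω ↔ γ (y - inner ℝ ν y • ν) < inner ℝ ν y))
    {y : Eu N} (hy : y ∈ frontier Ω) (hyr : y ∈ Metric.ball x₀ r) :
    γ (y - inner ℝ ν y • ν) = inner ℝ ν y := by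
  have hc : Continuous fun x : Eu N => γ (x - inner ℝ ν x • ν) := hγ.comp (by fun_prop)
  have hi : Continuous fun x : Eu N => inner ℝ ν x := by fun_prop
  refine le_antisymm ?_ ?_
  · have hcl : y ∈ closure (Metric.ball x₀ r ∩ Ω) :=
      Metric.isOpen_ball.inter_closure ⟨hyr, frontier_subset_closure hy⟩
    refine closure_minimal (t := {x | γ (x - inner ℝ ν x • ν) ≤ inner ℝ ν x}) ?_
      (isClosed_le hc hi) hcl
    exact fun x hx => ((hchart x hx.1).1 hx.2).le
  · rw [hΩ.frontier_eq] at hy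
    exact not_lt.1 (mt (hchart y hyr).2 hy.2)

/-- The estimate `∫_{Ω ∩ {dist(x, s) < ε}} v² ≤ C (ε ∫_{∂Ω} v² + ε² ∫_Ω |∇v|²)` for all smooth `v`
and all small `ε`. -/
def StripEstimate (Ω s : Set (Eu N)) : Prop :=
  ∃ C : ℝ≥0∞, C ≠ ⊤ ∧ ∃ ε₀ > (0 : ℝ), ∀ ε : ℝ, 0 < ε → ε < ε₀ → ∀ v : Eu N → ℝ, ContDiff ℝ ∞ v →
    ∫⁻ x in Ω ∩ Metric.thickening ε s, ‖v x‖ₑ ^ 2 ≤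
      C * (ENNReal.ofReal ε * ∫⁻ x, ‖v x‖ₑ ^ 2 ∂(surfaceMeasure Ω) +
        ENNReal.ofReal ε ^ 2 * ∫⁻ x in Ω, ‖∇ v x‖ₑ ^ 2)

/-- From a point of the layer go in direction `-ν` until the graph is hit, after a length less than
`(1 + K) ε`. The value at the starting point is controlled by the value at the hitting point and the
gradient along the way; integrating the first costs one factor `ε`, the second two. -/
theorem stripEstimate_chart (hN : 1 ≤ N) (hΩ : IsOpen Ω) {x₀ ν : Eu N} {r : ℝ} (hr : 0 < r)
    (hν : ‖ν‖ = 1) {K : ℝ≥0} {γ : Eu N → ℝ} (hγ : LipschitzWith K γ)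
    (hchart : ∀ y ∈ Metric.ball x₀ r, (y ∈ Ω ↔ γ (y - inner ℝ ν y • ν) < inner ℝ ν y)) :
    StripEstimate Ω (frontier Ω ∩ Metric.ball x₀ (r / 2)) := by
  obtain ⟨c, hc, hstrip⟩ := exists_lintegral_strip_le hν hN
  have hK : (0 : ℝ) ≤ K := K.2
  refine ⟨2 * (c * ENNReal.ofReal (1 + K) + ENNReal.ofReal (1 + K) ^ 2), ?_,
    r / (2 * (2 + K)), by positivity, fun ε hε hε0 v hv => ?_⟩
  · exact ENNReal.mul_ne_top (by simp) (ENNReal.add_ne_top.2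
      ⟨ENNReal.mul_ne_top hc (by simp), by simp⟩)
  set a : ℝ := (1 + K) * ε with ha
  have ha0 : 0 < a := by positivity
  -- The bound on `ε` was chosen for this: all vertical segments in use then stay in the chart ball
  -- of radius `r`.
  have har : ε + a < r / 2 := by
    rw [lt_div_iff₀ (by positivity)] at hε0
    rw [ha]; linarith
  set A := Ω ∩ Metric.thickening ε (frontier Ω ∩ Metric.ball x₀ (r / 2)) with hA
  have hAm : MeasurableSet A := (hΩ.inter Metric.isOpen_thickening).measurableSet
  set b : Eu N → Eu N := fun x =>
    (x - inner ℝ ν x • ν) + γ (x - inner ℝ ν x • ν) • ν with hb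
  have hPc : Continuous fun x : Eu N => x - inner ℝ ν x • ν := by fun_prop
  have hbc : Continuous b := hPc.add ((hγ.continuous.comp hPc).smul continuous_const)
  -- the geometry of the lines in direction `ν`
  have geom : ∀ x ∈ A, ∃ τ, 0 < τ ∧ τ < a ∧ b x = x + τ • (-ν) ∧
      γ (x - inner ℝ ν x • ν) = inner ℝ ν x - τ ∧ b x ∈ frontier Ω ∧
      ∀ t, 0 < t → t < τ → x + t • (-ν) ∈ Ω := by
    rintro x ⟨hxΩ, hxt⟩
    obtain ⟨y, ⟨hyf, hyb⟩, hxy⟩ := Metric.mem_thickening_iff.1 hxt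
    rw [Metric.mem_ball] at hyb
    have hyr : y ∈ Metric.ball x₀ r := by rw [Metric.mem_ball]; linarith
    have hline : ∀ t, 0 ≤ t → t ≤ a → x - t • ν ∈ Metric.ball x₀ r := by
      intro t ht hta
      rw [Metric.mem_ball]
      have h1 : dist (x - t • ν) x = t := by
        rw [dist_eq_norm, sub_sub_cancel_left, norm_neg, norm_smul, hν, Real.norm_of_nonneg ht,
          mul_one]
      have := dist_triangle4 (x - t • ν) x y x₀
      linarith
    have hxr : x ∈ Metric.ball x₀ r := by simpa using hline 0 le_rfl ha0.le
    have hy := eq_of_mem_frontier_chart hΩ hγ.continuous hchart hyf hyr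
    have hlt := (hchart x hxr).1 hxΩ
    have h1 : |inner ℝ ν x - inner ℝ ν y| ≤ dist x y := by
      rw [← inner_sub_right, dist_eq_norm]
      simpa [hν] using abs_real_inner_le_norm ν (x - y)
    have h2 : |γ (x - inner ℝ ν x • ν) - γ (y - inner ℝ ν y • ν)| ≤ K * dist x y := by
      rw [← Real.dist_eq]
      refine (hγ.dist_le_mul _ _).trans ?_
      gcongr
      rw [dist_eq_norm, dist_eq_norm]
      have : x - inner ℝ ν x • ν - (y - inner ℝ ν y • ν) =
          (x - y) - inner ℝ ν (x - y) • ν := by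
        rw [inner_sub_right]; module
      rw [this]
      exact norm_sub_inner_smul_le hν _
    -- The height of `x` above the graph. It vanishes at the nearby frontier point `y` and is
    -- Lipschitz with constant `1 + K`, whence `τ < a`.
    set τ := inner ℝ ν x - γ (x - inner ℝ ν x • ν) with hτ
    have hτ0 : 0 < τ := sub_pos.2 hlt
    have hτa : τ < a := by
      have h1' := (abs_le.1 h1).2
      have h2' := (abs_le.1 h2).1
      have : (1 + K) * dist x y < (1 + K) * ε := by gcongr
      rw [ha]
      linarith
    have hbx : b x = x - τ • ν := by
      simp only [hb, hτ]
      module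
    have hin : ∀ t, 0 ≤ t → t < τ → x - t • ν ∈ Ω := by
      intro t ht htτ
      rw [hchart _ (hline t ht (by linarith)), sub_inner_smul_invariant hν,
        inner_sub_smul_unit hν]
      linarith
    refine ⟨τ, hτ0, hτa, by rw [hbx]; module, by rw [hτ]; ring, ?_, fun t ht htτ => ?_⟩
    · rw [hΩ.frontier_eq]
      constructor
      · have hcl : τ ∈ closure (Ico 0 τ) := by
          rw [closure_Ico hτ0.ne]; exact right_mem_Icc.2 hτ0.le
        have hcont : Continuous fun t : ℝ => x - t • ν := by fun_prop
        rw [hbx]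
        exact map_mem_closure (f := fun t : ℝ => x - t • ν) hcont hcl fun t ht => hin t ht.1 ht.2
      · rw [hbx, hchart _ (hline τ hτ0.le hτa.le), sub_inner_smul_invariant hν,
          inner_sub_smul_unit hν]
        simp [hτ]
    · have := hin t ht.le htτ
      rwa [sub_eq_add_neg, ← smul_neg] at this
  -- Extension by zero outside `Ω`, so that the segments can all be lengthened to `a` and
  -- translation invariance on the whole space applies.
  set h : Eu N → ℝ≥0∞ := Ω.indicator fun x => ‖∇ v x‖ₑ ^ 2 with hh
  have hhm : Measurable h := (measurable_enorm_gradient_sq hv).indicator hΩ.measurableSet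
  have hpt : ∀ x ∈ A, ‖v x‖ₑ ^ 2 ≤ 2 * (‖v (b x)‖ₑ ^ 2 +
      ENNReal.ofReal a * ∫⁻ t in Ioo (0 : ℝ) a, h (x + t • (-ν))) := by
    intro x hx
    obtain ⟨τ, hτ0, hτa, hbx, -, -, hin⟩ := geom x hx
    have h1 := enorm_sub_sq_le_lintegral hv x (-ν) hτ0.le
    have h2 : ‖v x‖ₑ ≤ ‖v (b x)‖ₑ + ‖v (x + τ • (-ν)) - v x‖ₑ := by
      rw [← hbx]
      calc ‖v x‖ₑ = ‖v (b x) - (v (b x) - v x)‖ₑ := by rw [sub_sub_cancel]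
        _ ≤ _ := enorm_sub_le
    have h3 : ‖(-ν)‖ₑ = 1 := by rw [enorm_neg, ← ofReal_norm, hν, ENNReal.ofReal_one]
    rw [h3, one_pow, one_mul] at h1
    calc ‖v x‖ₑ ^ 2 ≤ (‖v (b x)‖ₑ + ‖v (x + τ • (-ν)) - v x‖ₑ) ^ 2 := by gcongr
      _ ≤ 2 * (‖v (b x)‖ₑ ^ 2 + ‖v (x + τ • (-ν)) - v x‖ₑ ^ 2) := ENNReal.add_sq_le _ _
      _ ≤ _ := by
        gcongr
        refine h1.trans (mul_le_mul' (ENNReal.ofReal_le_ofReal hτa.le) ?_)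
        rw [setLIntegral_congr Ioo_ae_eq_Ioc.symm]
        calc ∫⁻ t in Ioo (0 : ℝ) τ, ‖∇ v (x + t • (-ν))‖ₑ ^ 2
            = ∫⁻ t in Ioo (0 : ℝ) τ, h (x + t • (-ν)) := by
              refine setLIntegral_congr_fun measurableSet_Ioo fun t ht => ?_
              rw [hh, indicator_of_mem (hin t ht.1 ht.2)]
          _ ≤ _ := lintegral_mono_set (Ioo_subset_Ioo_right hτa.le)
  have hvb : Measurable fun x => ‖v (b x)‖ₑ ^ 2 :=
    (hv.continuous.comp hbc).measurable.enorm.pow_const 2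
  have I1 : ∫⁻ x in A, ‖v (b x)‖ₑ ^ 2 ≤
      c * ENNReal.ofReal a * ∫⁻ x, ‖v x‖ₑ ^ 2 ∂(surfaceMeasure Ω) := by
    refine le_trans (lintegral_mono_set fun x hx => ?_) (hstrip γ hγ.continuous (frontier Ω)
      isClosed_frontier (fun x => ‖v x‖ₑ ^ 2) (hv.continuous.measurable.enorm.pow_const 2) a)
    obtain ⟨τ, hτ0, hτa, -, hγx, hf, -⟩ := geom x hx
    refine ⟨⟨?_, ?_⟩, hf⟩ <;> rw [hγx] <;> linarith
  have I2 : ∫⁻ x in A, (∫⁻ t in Ioo (0 : ℝ) a, h (x + t • (-ν))) ≤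
      ENNReal.ofReal a * ∫⁻ x in Ω, ‖∇ v x‖ₑ ^ 2 := by
    refine (setLIntegral_le_lintegral _ _).trans ?_
    rw [lintegral_lintegral_swap]
    · simp only [lintegral_add_right_eq_self (μ := (volume : Measure (Eu N))) h]
      rw [setLIntegral_const, Real.volume_Ioo, sub_zero, mul_comm, hh,
        lintegral_indicator hΩ.measurableSet]
    · have : Continuous fun p : Eu N × ℝ => p.1 + p.2 • (-ν) := by fun_prop
      exact (hhm.comp this.measurable).aemeasurable
  calc ∫⁻ x in A, ‖v x‖ₑ ^ 2
      ≤ ∫⁻ x in A, 2 * (‖v (b x)‖ₑ ^ 2 +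
          ENNReal.ofReal a * ∫⁻ t in Ioo (0 : ℝ) a, h (x + t • (-ν))) :=
        setLIntegral_mono' hAm hpt
    _ = 2 * ((∫⁻ x in A, ‖v (b x)‖ₑ ^ 2) + ENNReal.ofReal a *
          ∫⁻ x in A, (∫⁻ t in Ioo (0 : ℝ) a, h (x + t • (-ν)))) := by
        rw [lintegral_const_mul' _ _ (by simp), lintegral_add_left hvb,
          lintegral_const_mul' _ _ (by simp)]
    _ ≤ 2 * (c * ENNReal.ofReal a * ∫⁻ x, ‖v x‖ₑ ^ 2 ∂(surfaceMeasure Ω) +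
          ENNReal.ofReal a * (ENNReal.ofReal a * ∫⁻ x in Ω, ‖∇ v x‖ₑ ^ 2)) := by gcongr
    _ ≤ _ := by
        have e : ENNReal.ofReal a = ENNReal.ofReal (1 + K) * ENNReal.ofReal ε :=
          ENNReal.ofReal_mul (by positivity)
        rw [e]
        set p := ENNReal.ofReal (1 + K)
        set q := ENNReal.ofReal ε
        set X := ∫⁻ x, ‖v x‖ₑ ^ 2 ∂(surfaceMeasure Ω)
        set Y := ∫⁻ x in Ω, ‖∇ v x‖ₑ ^ 2
        calc 2 * (c * (p * q) * X + p * q * (p * q * Y))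
            = 2 * (c * p) * (q * X) + 2 * p ^ 2 * (q ^ 2 * Y) := by ring
          _ ≤ (2 * (c * p + p ^ 2)) * (q * X) + (2 * (c * p + p ^ 2)) * (q ^ 2 * Y) := by
              gcongr
              · exact le_self_add
              · exact le_add_self
          _ = _ := by ring

/-- The estimate is inherited by subsets and finite unions and holds near each boundary point, so
compactness of the frontier gives it globally. -/
theorem stripEstimate_frontier (hN : 1 ≤ N) (hΩ : IsOpen Ω) (hb : Bornology.IsBounded Ω)
    (hL : HasLipschitzBoundary Ω) : StripEstimate Ω (frontier Ω) := by
  have hcomp : IsCompact (frontier Ω) :=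
    hb.isCompact_closure.of_isClosed_subset isClosed_frontier frontier_subset_closure
  refine hcomp.induction_on (p := StripEstimate Ω) ?_ ?_ ?_ ?_
  · exact ⟨0, by simp, 1, one_pos, fun ε _ _ v _ => by simp⟩
  · rintro s t hst ⟨C, hC, ε₀, hε₀, h⟩
    exact ⟨C, hC, ε₀, hε₀, fun ε h1 h2 v hv => (lintegral_mono_set
      (inter_subset_inter_right _ (Metric.thickening_subset_of_subset ε hst))).trans (h ε h1 h2 v hv)⟩
  · rintro s t ⟨C, hC, ε₀, hε₀, h⟩ ⟨C', hC', ε₀', hε₀', h'⟩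
    refine ⟨C + C', ENNReal.add_ne_top.2 ⟨hC, hC'⟩, min ε₀ ε₀', lt_min hε₀ hε₀',
      fun ε h1 h2 v hv => ?_⟩
    rw [Metric.thickening_union, inter_union_distrib_left, add_mul]
    exact (lintegral_union_le _ _ _).trans (add_le_add (h ε h1 (h2.trans_le (min_le_left _ _)) v hv)
      (h' ε h1 (h2.trans_le (min_le_right _ _)) v hv))
  · intro x hx
    obtain ⟨r, hr, ν, hν, K, γ, hγ, hchart⟩ := hL x hx
    exact ⟨_, inter_mem_nhdsWithin _ (Metric.ball_mem_nhds x (half_pos hr)),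
      stripEstimate_chart hN hΩ hr hν hγ hchart⟩

/-! ### Cutoff functions; zero trace implies `H¹₀`. -/

open scoped Convolution in
/-- Lipschitz functions with values in `[0, 1]` have smooth approximations with the same Lipschitz
constant, which are local averages. -/
theorem exists_contDiff_lipschitz_approx {g : Eu N → ℝ} {K : ℝ≥0} (hg : LipschitzWith K g)
    (hg01 : ∀ x, g x ∈ Icc (0 : ℝ) 1) {ρ : ℝ} (hρ : 0 < ρ) :
    ∃ χ : Eu N → ℝ, ContDiff ℝ ∞ χ ∧ LipschitzWith K χ ∧ (∀ x, χ x ∈ Icc (0 : ℝ) 1) ∧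
      ∀ x c, (∀ y ∈ Metric.ball x ρ, g y = c) → χ x = c := by
  let φ : ContDiffBump (0 : Eu N) := ⟨ρ / 2, ρ, by positivity, by linarith⟩
  have hφint : Integrable (φ.normed volume) := φ.integrable_normed
  have hint : ∀ x, Integrable fun t => φ.normed volume t * g (x - t) := by
    intro x
    have hc : Continuous fun t => g (x - t) := hg.continuous.comp (by fun_prop)
    refine hφint.mul_bdd (c := 1) hc.aestronglyMeasurable (ae_of_all _ fun t => ?_)
    rw [Real.norm_of_nonneg (hg01 _).1]
    exact (hg01 _).2
  have hform : ∀ x, (φ.normed volume ⋆[ContinuousLinearMap.lsmul ℝ ℝ, volume] g) x =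
      ∫ t, φ.normed volume t * g (x - t) := fun x => by
    simp [convolution_def]
  refine ⟨φ.normed volume ⋆[ContinuousLinearMap.lsmul ℝ ℝ, volume] g, ?_, ?_, ?_, ?_⟩
  · exact φ.hasCompactSupport_normed.contDiff_convolution_left _ φ.contDiff_normed
      hg.continuous.locallyIntegrable
  · refine LipschitzWith.of_dist_le_mul fun x y => ?_
    rw [hform, hform, Real.dist_eq, ← integral_sub (hint x) (hint y), ← Real.norm_eq_abs]
    calc ‖∫ t, (φ.normed volume t * g (x - t) - φ.normed volume t * g (y - t))‖
        ≤ ∫ t, φ.normed volume t * (K * dist x y) := by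
          refine norm_integral_le_of_norm_le (hφint.mul_const _) (ae_of_all _ fun t => ?_)
          rw [← mul_sub, norm_mul, Real.norm_of_nonneg (φ.nonneg_normed t), ← dist_eq_norm]
          refine mul_le_mul_of_nonneg_left ?_ (φ.nonneg_normed t)
          simpa using hg.dist_le_mul (x - t) (y - t)
      _ = K * dist x y := by rw [integral_mul_const, φ.integral_normed, one_mul]
  · intro x
    rw [hform]
    refine ⟨integral_nonneg fun t => mul_nonneg (φ.nonneg_normed t) (hg01 _).1, ?_⟩
    rw [← φ.integral_normed (μ := volume)]
    refine integral_mono (hint x) hφint fun t => ?_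
    exact mul_le_of_le_one_right (φ.nonneg_normed t) (hg01 _).2
  · intro x c hc
    rw [φ.normed_convolution_eq_right, hc x (Metric.mem_ball_self hρ)]
    exact fun y hy => by rw [hc y hy, hc x (Metric.mem_ball_self hρ)]

theorem norm_gradient_le_of_lipschitz {χ : Eu N → ℝ} {K : ℝ≥0} (h : LipschitzWith K χ) (x : Eu N) :
    ‖∇ χ x‖ ≤ K := by
  rw [norm_gradient]
  exact norm_fderiv_le_of_lipschitz ℝ h

/-- A piecewise linear function of the distance to the complement, rising from 0 at distance `ε` to
1 at distance `2 ε`, is mollified at scale `ε / 2`. This keeps the Lipschitz constant, and the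
margins `ε / 2` and `3 ε` absorb the averaging. -/
theorem exists_cutoff (hN : 1 ≤ N) (hb : Bornology.IsBounded Ω) {ε : ℝ} (hε : 0 < ε) :
    ∃ χ : Eu N → ℝ, IsTest Ω χ ∧ (∀ x, χ x ∈ Icc (0 : ℝ) 1) ∧ (∀ x, ‖∇ χ x‖ ≤ ε⁻¹) ∧
      ∀ x ∈ Ω, x ∉ Metric.thickening (3 * ε) (frontier Ω) → χ x = 1 ∧ ∇ χ x = 0 := by
  -- A nonempty complement is needed because `Metric.infDist` to the empty set is 0 by convention.
  have hne : Ω ≠ univ := by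
    rintro rfl
    have : Nonempty (Fin N) := ⟨⟨0, hN⟩⟩
    exact NormedSpace.unbounded_univ ℝ (Eu N) hb
  have hcne : (Ωᶜ).Nonempty := nonempty_compl.2 hne
  set ρ : Eu N → ℝ := fun x => Metric.infDist x Ωᶜ with hρ
  have hρlip : LipschitzWith 1 ρ := Metric.lipschitz_infDist_pt _
  set g : Eu N → ℝ := fun x => max 0 (min 1 (ε⁻¹ * (ρ x - ε))) with hg
  have hglip : LipschitzWith (Real.toNNReal ε⁻¹) g := by
    have h1 : LipschitzWith (Real.toNNReal ε⁻¹) fun x => ε⁻¹ * (ρ x - ε) := by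
      refine LipschitzWith.of_dist_le_mul fun x y => ?_
      rw [Real.dist_eq, ← mul_sub, abs_mul, abs_of_pos (inv_pos.2 hε),
        Real.coe_toNNReal _ (inv_pos.2 hε).le]
      gcongr
      simpa [Real.dist_eq] using hρlip.dist_le_mul x y
    exact (h1.const_min 1).const_max 0
  have hg01 : ∀ x, g x ∈ Icc (0 : ℝ) 1 := fun x =>
    ⟨le_max_left _ _, max_le zero_le_one (min_le_left _ _)⟩
  obtain ⟨χ, hχ, hlip, hχ01, hχloc⟩ := exists_contDiff_lipschitz_approx hglip hg01 (half_pos hε)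
  have hclose : ∀ {x y}, y ∈ Metric.ball x (ε / 2) → |ρ y - ρ x| < ε / 2 := by
    intro x y hy
    have := hρlip.dist_le_mul y x
    rw [NNReal.coe_one, one_mul, Real.dist_eq] at this
    exact this.trans_lt hy
  have hsupp : tsupport χ ⊆ {x | ε / 2 ≤ ρ x} := by
    refine closure_minimal (fun x hx => ?_) (isClosed_le continuous_const hρlip.continuous)
    by_contra hlt
    rw [mem_ofPred_eq, not_le] at hlt
    refine hx (hχloc x 0 fun y hy => ?_)
    have h1 := (abs_lt.1 (hclose hy)).2
    have h2 : ε⁻¹ * (ρ y - ε) ≤ 0 := mul_nonpos_of_nonneg_of_nonpos (inv_pos.2 hε).le (by linarith)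
    exact max_eq_left ((min_le_right _ _).trans h2)
  have hsub : tsupport χ ⊆ Ω := by
    intro x hx
    by_contra hxΩ
    have h1 : ε / 2 ≤ ρ x := hsupp hx
    have h2 : ρ x = 0 := Metric.infDist_zero_of_mem hxΩ
    linarith
  refine ⟨χ, ⟨hχ, ?_, hsub⟩, hχ01, fun x => ?_, fun x hx hxt => ?_⟩
  · exact hb.isCompact_closure.of_isClosed_subset (isClosed_tsupport χ)
      (hsub.trans subset_closure)
  · simpa [Real.coe_toNNReal _ (inv_pos.2 hε).le] using norm_gradient_le_of_lipschitz hlip x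
  · have h1 : χ x = 1 := by
      refine hχloc x 1 fun y hy => ?_
      obtain ⟨z, hz, hxz⟩ := exists_mem_frontier_infDist_compl_eq_dist hx hne
      have h3 : 3 * ε ≤ ρ x := by
        by_contra hlt
        exact hxt (Metric.mem_thickening_iff.2 ⟨z, hz, hxz ▸ not_le.1 hlt⟩)
      have h4 := (abs_lt.1 (hclose hy)).1
      have h2 : 1 ≤ ε⁻¹ * (ρ y - ε) := by
        rw [inv_mul_eq_div, le_div_iff₀ hε]; linarith
      simp [hg, min_eq_left h2]
    refine ⟨h1, ?_⟩
    -- The value 1 is the maximum of `χ`, so the gradient vanishes there, even at the edge of the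
    -- region.
    have hmax : IsLocalMax χ x := Eventually.of_forall fun y => by rw [h1]; exact (hχ01 y).2
    rw [gradient, hmax.fderiv_eq_zero, map_zero]

theorem gradient_mul {u v : Eu N → ℝ} (hu : ContDiff ℝ ∞ u) (hv : ContDiff ℝ ∞ v) (x : Eu N) :
    ∇ (fun y => u y * v y) x = u x • ∇ v x + v x • ∇ u x := by
  rw [gradient, gradient, gradient, fderiv_fun_mul (hu.differentiable (by simp) x)
    (hv.differentiable (by simp) x), map_add]
  simp

theorem IsTest.mul_contDiff {χ v : Eu N → ℝ} (hχ : IsTest Ω χ) (hv : ContDiff ℝ ∞ v) :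
    IsTest Ω (fun x => χ x * v x) :=
  ⟨hχ.1.mul hv, hχ.2.1.mul_right, (tsupport_mul_subset_left).trans hχ.2.2⟩

/-- The gradient of a smooth function times a cutoff function of the boundary strip of width `ε`. -/
theorem eLpNorm_gradient_cutoff_mul_sq_le (hΩ : IsOpen Ω) {χ v : Eu N → ℝ} (hχ : ContDiff ℝ ∞ χ)
    (hχ01 : ∀ x, χ x ∈ Icc (0 : ℝ) 1) {ε : ℝ} (hχε : ∀ x, ‖∇ χ x‖ ≤ ε⁻¹)
    {s : Set (Eu N)} (hs : IsOpen s) (hχs : ∀ x ∈ Ω, x ∉ s → ∇ χ x = 0) (hv : ContDiff ℝ ∞ v) :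
    eLpNorm (∇ (fun x => χ x * v x)) 2 (volume.restrict Ω) ^ 2 ≤
      2 * (eLpNorm (∇ v) 2 (volume.restrict Ω) ^ 2 +
        ENNReal.ofReal ε⁻¹ ^ 2 * ∫⁻ x in Ω ∩ s, ‖v x‖ₑ ^ 2) := by
  rw [sq_eLpNorm_two, sq_eLpNorm_two, inter_comm Ω s, ← Measure.restrict_restrict hs.measurableSet,
    ← lintegral_const_mul' _ _ (by simp), ← lintegral_indicator hs.measurableSet,
    ← lintegral_add_left (measurable_enorm_gradient_sq hv), ← lintegral_const_mul' _ _ (by simp)]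
  refine setLIntegral_mono' hΩ.measurableSet fun x hx => ?_
  refine le_trans ?_ (mul_le_mul_right (add_le_add_right
    (show ‖v x • ∇ χ x‖ₑ ^ 2 ≤ _ from ?_) _) _)
  · rw [gradient_mul hχ hv]
    refine (pow_le_pow_left₀ (by positivity) (enorm_add_le _ _) 2).trans
      ((ENNReal.add_sq_le _ _).trans ?_)
    gcongr
    rw [← ofReal_norm, ← ofReal_norm, norm_smul, Real.norm_of_nonneg (hχ01 x).1]
    exact ENNReal.ofReal_le_ofReal (mul_le_of_le_one_left (norm_nonneg _) (hχ01 x).2)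
  · by_cases hxs : x ∈ s
    · rw [indicator_of_mem hxs, ← mul_pow, enorm_smul, mul_comm]
      gcongr
      rw [← ofReal_norm]
      exact ENNReal.ofReal_le_ofReal (hχε x)
    · simp [hχs x hx hxs]

/-- Split χv - w = χ(v - w) + (χ - 1)w: the first term is at most |v - w|, the second tends to 0 by
dominated convergence. -/
theorem tendsto_eLpNorm_cutoff_mul_sub {α : Type*} [MeasurableSpace α] {μ : Measure α}
    {χ v : ℕ → α → ℝ} {w : α → ℝ} (hχm : ∀ n, AEStronglyMeasurable (χ n) μ)
    (hχ01 : ∀ n x, χ n x ∈ Icc (0 : ℝ) 1) (hχ : ∀ᵐ x ∂μ, ∀ᶠ n in atTop, χ n x = 1)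
    (hv : ∀ n, AEStronglyMeasurable (v n) μ) (hw : MemLp w 2 μ)
    (hvw : Tendsto (fun n => eLpNorm (fun x => v n x - w x) 2 μ) atTop (𝓝 0)) :
    Tendsto (fun n => eLpNorm (fun x => χ n x * v n x - w x) 2 μ) atTop (𝓝 0) := by
  have h1 : Tendsto (fun n => eLpNorm (fun x => (χ n x - 1) * w x) 2 μ) atTop (𝓝 0) := by
    refine tendsto_eLpNorm_two_zero ?_
    have hle : ∀ n x, ‖(χ n x - 1) * w x‖ₑ ^ 2 ≤ ‖w x‖ₑ ^ 2 := by
      intro n x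
      gcongr
      rw [← ofReal_norm, ← ofReal_norm, norm_mul]
      refine ENNReal.ofReal_le_ofReal (mul_le_of_le_one_left (norm_nonneg _) ?_)
      rw [Real.norm_eq_abs, abs_le]
      constructor <;> linarith [(hχ01 n x).1, (hχ01 n x).2]
    have := tendsto_lintegral_of_dominated_convergence' (μ := μ)
      (F := fun n x => ‖(χ n x - 1) * w x‖ₑ ^ 2) (f := 0) (fun x => ‖w x‖ₑ ^ 2)
      (fun n => (((hχm n).sub aestronglyMeasurable_const).mul hw.1).enorm.pow_const 2)
      (fun n => ae_of_all _ (hle n)) ?_ ?_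
    · simpa using this
    · rw [← sq_eLpNorm_two]; exact ENNReal.pow_ne_top hw.2.ne
    · filter_upwards [hχ] with x hx
      refine tendsto_const_nhds.congr' ?_
      filter_upwards [hx] with n hn
      simp [hn]
  refine tendsto_of_tendsto_of_tendsto_of_le_of_le tendsto_const_nhds (by simpa using hvw.add h1)
    (fun _ => zero_le) fun n => ?_
  have e : (fun x => χ n x * v n x - w x) =
      (fun x => χ n x * (v n x - w x)) + fun x => (χ n x - 1) * w x := by
    ext x; simp only [Pi.add_apply]; ring
  simp only [e]
  refine (eLpNorm_add_le ((hχm n).mul ((hv n).sub hw.1))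
    (((hχm n).sub aestronglyMeasurable_const).mul hw.1) (by simp)).trans (add_le_add ?_ le_rfl)
  refine eLpNorm_mono fun x => ?_
  change ‖χ n x * (v n x - w x)‖ ≤ _
  rw [norm_mul, Real.norm_of_nonneg (hχ01 n x).1]
  exact mul_le_of_le_one_left (norm_nonneg _) (hχ01 n x).2

theorem TendstoH1.eventually_eLpNorm_gradient_le (hΩ : IsOpen Ω) {w : Eu N → ℝ} (hw : MemH1 Ω w)
    {v : ℕ → Eu N → ℝ} (hv : ∀ n, ContDiff ℝ ∞ (v n)) (h : TendstoH1 Ω v w) :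
    ∀ᶠ n in atTop, eLpNorm (∇ (v n)) 2 (volume.restrict Ω) ≤
      1 + eLpNorm (weakGrad Ω w) 2 (volume.restrict Ω) := by
  filter_upwards [h.2.eventually (ge_mem_nhds one_pos)] with n hn
  have hG := hw.memLp_weakGrad hΩ
  have e : ∇ (v n) = (fun x => ∇ (v n) x - weakGrad Ω w x) + weakGrad Ω w := by
    ext x; simp
  rw [e]
  exact (eLpNorm_add_le ((continuous_gradient (hv n)).aestronglyMeasurable.sub hG.1) hG.1
    (by simp)).trans (add_le_add_left hn _)

/-- Functions in `H¹(Ω)` with zero trace belong to `H¹₀(Ω)`. -/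
theorem HasTrace.memH10 (hN : 1 ≤ N) (hΩ : IsOpen Ω) (hb : Bornology.IsBounded Ω)
    (hL : HasLipschitzBoundary Ω) {w : Eu N → ℝ} (hw : HasTrace Ω w 0) : MemH10 Ω w := by
  obtain ⟨C, hC, ε₀, hε₀, hstrip⟩ := stripEstimate_frontier hN hΩ hb hL
  obtain ⟨hH1, -, v, hv, ⟨t1, t2⟩, t3⟩ := hw
  simp only [Pi.zero_apply, sub_zero] at t3
  set μ := volume.restrict Ω with hμ
  have hGw := hH1.memLp_weakGrad hΩ
  set M : ℝ≥0∞ := 1 + eLpNorm (weakGrad Ω w) 2 μ with hM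
  have hMtop : M ≠ ⊤ := ENNReal.add_ne_top.2 ⟨by simp, hGw.2.ne⟩
  -- The layer outside which the cutoff is 1 has width `3 * ε j`, at most `ε₀ / 2`.
  set ε : ℕ → ℝ := fun j => ε₀ / (6 * (j + 1)) with hε
  have hεpos : ∀ j, 0 < ε j := fun j => by positivity
  have hεlt : ∀ j, 3 * ε j < ε₀ := by
    intro j
    rw [hε, ← mul_div_assoc, div_lt_iff₀ (by positivity)]
    have : (0 : ℝ) ≤ j := Nat.cast_nonneg j
    nlinarith
  have hεlim : Tendsto ε atTop (𝓝 0) := by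
    have := (tendsto_one_div_add_atTop_nhds_zero_nat (𝕜 := ℝ)).const_mul (ε₀ / 6)
    rw [mul_zero] at this
    refine this.congr fun j => ?_
    rw [hε]; field_simp
  -- The approximant is chosen after the layer, with squared boundary norm at most `ε j`. Then ε⁻²
  -- times the strip estimate stays bounded: its boundary term is of order ε·ε, and its gradient
  -- term of order ε².
  have hsel : ∀ j, ∃ n, j ≤ n ∧ eLpNorm (∇ (v n)) 2 μ ≤ M ∧
      eLpNorm (v n) 2 (surfaceMeasure Ω) ^ 2 ≤ ENNReal.ofReal (ε j) := by
    intro j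
    have e2 := TendstoH1.eventually_eLpNorm_gradient_le hΩ hH1 hv ⟨t1, t2⟩
    have e3 := (ENNReal.Tendsto.pow (n := 2) t3).eventually (ge_mem_nhds
      (show (0 : ℝ≥0∞) ^ 2 < ENNReal.ofReal (ε j) by simpa using hεpos j))
    obtain ⟨n, h1, h2, h3⟩ := ((eventually_ge_atTop j).and (e2.and e3)).exists
    exact ⟨n, h1, h2, h3⟩
  choose m hjm hm1 hm2 using hsel
  choose χ hχtest hχ01 hχgrad hχone using fun j => exists_cutoff hN hb (hεpos j)
  set B : ℝ≥0∞ := 2 * (M ^ 2 + C * (3 + 9 * M ^ 2)) with hB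
  have hBtop : B ≠ ⊤ := by
    refine ENNReal.mul_ne_top (by simp) (ENNReal.add_ne_top.2 ⟨by simp [hMtop],
      ENNReal.mul_ne_top hC (ENNReal.add_ne_top.2 ⟨by simp, ENNReal.mul_ne_top (by simp) ?_⟩)⟩)
    simp [hMtop]
  have hbound : ∀ j, eLpNorm (∇ (fun x => χ j x * v (m j) x)) 2 μ ^ 2 ≤ B := by
    intro j
    refine (eLpNorm_gradient_cutoff_mul_sq_le hΩ (hχtest j).1 (hχ01 j) (hχgrad j)
      (Metric.isOpen_thickening (δ := 3 * ε j) (E := frontier Ω))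
      (fun x h1 h2 => (hχone j x h1 h2).2) (hv (m j))).trans ?_
    have hs := hstrip (3 * ε j) (by linarith [hεpos j]) (hεlt j) (v (m j)) (hv (m j))
    rw [← sq_eLpNorm_two (v (m j)) (surfaceMeasure Ω), ← sq_eLpNorm_two (∇ (v (m j))) μ,
      ENNReal.ofReal_mul (by norm_num),
      ENNReal.ofReal_ofNat] at hs
    set e := ENNReal.ofReal (ε j) with he
    have hee : ENNReal.ofReal (ε j)⁻¹ * e = 1 := by
      rw [he, ← ENNReal.ofReal_mul (inv_pos.2 (hεpos j)).le, inv_mul_cancel₀ (hεpos j).ne',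
        ENNReal.ofReal_one]
    set e' := ENNReal.ofReal (ε j)⁻¹ with he'
    rw [hB]
    refine mul_le_mul_right (add_le_add (pow_le_pow_left₀ (by positivity) (hm1 j) 2) ?_) _
    · calc e' ^ 2 * ∫⁻ x in Ω ∩ Metric.thickening (3 * ε j) (frontier Ω), ‖v (m j) x‖ₑ ^ 2
          ≤ e' ^ 2 * (C * (3 * e * e + (3 * e) ^ 2 * M ^ 2)) := by
            gcongr
            refine hs.trans ?_
            gcongr
            · exact hm2 j
            · exact hm1 j
        _ = (e' * e) ^ 2 * (C * (3 + 9 * M ^ 2)) := by ring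
        _ = C * (3 + 9 * M ^ 2) := by rw [hee, one_pow, one_mul]
  -- A quantity is at most 1 or at most its square; this avoids a square root.
  have hbound' : ∀ j, eLpNorm (∇ (fun x => χ j x * v (m j) x)) 2 μ ≤ ((B + 1).toNNReal : ℝ≥0∞) := by
    intro j
    rw [ENNReal.coe_toNNReal (by simp [hBtop])]
    rcases le_total (eLpNorm (∇ (fun x => χ j x * v (m j) x)) 2 μ) 1 with h | h
    · exact h.trans le_add_self
    · exact (le_self_pow₀ h two_ne_zero).trans ((hbound j).trans le_self_add)
  refine (memH10_of_bounded_gradients hΩ (fun j => (hχtest j).mul_contDiff (hv (m j))) hH1.1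
    ?_ hbound').1
  refine tendsto_eLpNorm_cutoff_mul_sub (fun j => (hχtest j).1.continuous.aestronglyMeasurable)
    hχ01 ?_ (fun j => (hv (m j)).continuous.aestronglyMeasurable) hH1.1
    (t1.comp (tendsto_atTop_mono hjm tendsto_id))
  filter_upwards [ae_restrict_mem hΩ.measurableSet] with x hx
  have hxf : x ∉ frontier Ω := by
    rw [hΩ.frontier_eq]; exact fun h => h.2 hx
  have hev : ∀ᶠ δ in 𝓝 (0 : ℝ), x ∉ Metric.thickening (3 * δ) (frontier Ω) := by
    have h1 : x ∉ closure (frontier Ω) := by rwa [isClosed_frontier.closure_eq]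
    rw [Metric.closure_eq_iInter_thickening, mem_iInter₂] at h1
    push Not at h1
    obtain ⟨δ, hδ, hxδ⟩ := h1
    filter_upwards [gt_mem_nhds (show (0 : ℝ) < δ / 3 by positivity)] with t ht hxt
    exact hxδ (Metric.thickening_mono (by linarith) _ hxt)
  filter_upwards [hεlim.eventually hev] with j hj
  exact (hχone j x hx hj).1

/-! ### Linear operations on traces. -/

section TraceAlgebra

theorem tendsto_eLpNorm_add_sub {α E : Type*} [MeasurableSpace α] {μ : Measure α}
    [NormedAddCommGroup E] {f g : ℕ → α → E} {a b c : α → E}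
    (hf : ∀ n, AEStronglyMeasurable (f n) μ) (hg : ∀ n, AEStronglyMeasurable (g n) μ)
    (ha : AEStronglyMeasurable a μ) (hb : AEStronglyMeasurable b μ)
    (hfa : Tendsto (fun n => eLpNorm (fun x => f n x - a x) 2 μ) atTop (𝓝 0))
    (hgb : Tendsto (fun n => eLpNorm (fun x => g n x - b x) 2 μ) atTop (𝓝 0))
    (hc : c =ᵐ[μ] fun x => a x + b x) :
    Tendsto (fun n => eLpNorm (fun x => f n x + g n x - c x) 2 μ) atTop (𝓝 0) := by
  refine tendsto_of_tendsto_of_tendsto_of_le_of_le tendsto_const_nhds (by simpa using hfa.add hgb)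
    (fun _ => zero_le) fun n => ?_
  have e : (fun x => f n x + g n x - c x) =ᵐ[μ]
      (fun x => f n x - a x) + fun x => g n x - b x := by
    filter_upwards [hc] with x hx
    simp only [hx, Pi.add_apply]; abel
  dsimp only
  rw [eLpNorm_congr_ae e]
  exact eLpNorm_add_le ((hf n).sub ha) ((hg n).sub hb) (by simp)

theorem tendsto_eLpNorm_const_smul_sub {α E : Type*} [MeasurableSpace α] {μ : Measure α}
    [NormedAddCommGroup E] [NormedSpace ℝ E] {f : ℕ → α → E} {a c : α → E} (t : ℝ)
    (hfa : Tendsto (fun n => eLpNorm (fun x => f n x - a x) 2 μ) atTop (𝓝 0))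
    (hc : c =ᵐ[μ] fun x => t • a x) :
    Tendsto (fun n => eLpNorm (fun x => t • f n x - c x) 2 μ) atTop (𝓝 0) := by
  have h := ENNReal.Tendsto.const_mul (a := ‖t‖ₑ) hfa (Or.inr (by simp))
  rw [mul_zero] at h
  refine h.congr fun n => ?_
  rw [← eLpNorm_const_smul]
  refine eLpNorm_congr_ae ?_
  filter_upwards [hc] with x hx
  simp [hx, smul_sub]

theorem TendstoH1.add (hΩ : IsOpen Ω) {u u' : Eu N → ℝ} {v v' : ℕ → Eu N → ℝ} (hu : MemH1 Ω u)
    (hu' : MemH1 Ω u') (hv : ∀ n, ContDiff ℝ ∞ (v n)) (hv' : ∀ n, ContDiff ℝ ∞ (v' n))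
    (h : TendstoH1 Ω v u) (h' : TendstoH1 Ω v' u') :
    TendstoH1 Ω (fun n => v n + v' n) (fun x => u x + u' x) := by
  refine ⟨tendsto_eLpNorm_add_sub (fun n => (hv n).continuous.aestronglyMeasurable)
    (fun n => (hv' n).continuous.aestronglyMeasurable) hu.1.1 hu'.1.1 h.1 h'.1 .rfl, ?_⟩
  simp only [gradient_add (hv _) (hv' _)]
  exact tendsto_eLpNorm_add_sub (fun n => (continuous_gradient (hv n)).aestronglyMeasurable)
    (fun n => (continuous_gradient (hv' n)).aestronglyMeasurable) (hu.memLp_weakGrad hΩ).1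
    (hu'.memLp_weakGrad hΩ).1 h.2 h'.2 (hu.weakGrad_add hΩ hu')

theorem TendstoH1.const_smul (hΩ : IsOpen Ω) {u : Eu N → ℝ} {v : ℕ → Eu N → ℝ} (hu : MemH1 Ω u)
    (hv : ∀ n, ContDiff ℝ ∞ (v n)) (h : TendstoH1 Ω v u) (t : ℝ) :
    TendstoH1 Ω (fun n => t • v n) (fun x => t * u x) := by
  refine ⟨tendsto_eLpNorm_const_smul_sub t h.1 .rfl, ?_⟩
  simp only [gradient_const_smul (hv _)]
  exact tendsto_eLpNorm_const_smul_sub t h.2 (hu.weakGrad_const_mul hΩ t)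

theorem MemH10.const_mul (hΩ : IsOpen Ω) {w : Eu N → ℝ} (h : MemH10 Ω w) (t : ℝ) :
    MemH10 Ω (fun x => t * w x) := by
  obtain ⟨h1, v, hv, hvw⟩ := h
  exact ⟨h1.const_mul t, _, fun n => (testSpace Ω).smul_mem t (hv n),
    hvw.const_smul hΩ h1 (fun n => (hv n).1) t⟩

theorem HasTrace.add (hΩ : IsOpen Ω) {u u' φ φ' : Eu N → ℝ} (h : HasTrace Ω u φ)
    (h' : HasTrace Ω u' φ') : HasTrace Ω (fun x => u x + u' x) (fun x => φ x + φ' x) := by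
  obtain ⟨h1, h2, v, hv, h3, h4⟩ := h
  obtain ⟨h1', h2', v', hv', h3', h4'⟩ := h'
  exact ⟨h1.add h1', h2.add h2', _, fun n => (hv n).add (hv' n), h3.add hΩ h1 h1' hv hv' h3',
    tendsto_eLpNorm_add_sub (fun n => (hv n).continuous.aestronglyMeasurable)
    (fun n => (hv' n).continuous.aestronglyMeasurable) h2.1 h2'.1 h4 h4' .rfl⟩

theorem HasTrace.const_mul (hΩ : IsOpen Ω) {u φ : Eu N → ℝ} (h : HasTrace Ω u φ) (t : ℝ) :
    HasTrace Ω (fun x => t * u x) (fun x => t * φ x) := by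
  obtain ⟨h1, h2, v, hv, h3, h4⟩ := h
  exact ⟨h1.const_mul t, h2.const_mul t, _, fun n => contDiff_const.smul (hv n),
    h3.const_smul hΩ h1 hv t, tendsto_eLpNorm_const_smul_sub t h4 .rfl⟩

theorem HasTrace.sub (hΩ : IsOpen Ω) {u u' φ φ' : Eu N → ℝ} (h : HasTrace Ω u φ)
    (h' : HasTrace Ω u' φ') : HasTrace Ω (fun x => u x - u' x) (fun x => φ x - φ' x) := by
  simpa [sub_eq_add_neg] using h.add hΩ (h'.const_mul hΩ (-1))

theorem HasTrace.congr {u φ φ' : Eu N → ℝ} (h : HasTrace Ω u φ)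
    (hφ : φ =ᵐ[surfaceMeasure Ω] φ') : HasTrace Ω u φ' := by
  obtain ⟨h1, h2, v, hv, h3, h4⟩ := h
  refine ⟨h1, h2.ae_eq hφ, v, hv, h3, h4.congr fun n => eLpNorm_congr_ae ?_⟩
  filter_upwards [hφ] with x hx
  rw [hx]

/-- Test functions vanish on the frontier, since their supports lie in the open set `Ω`; the same
approximants therefore serve. -/
theorem MemH10.hasTrace_zero (hΩ : IsOpen Ω) {w : Eu N → ℝ} (h : MemH10 Ω w) :
    HasTrace Ω w 0 := by
  obtain ⟨h1, v, hv, hvw⟩ := h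
  refine ⟨h1, MemLp.zero, v, fun n => (hv n).1, hvw, ?_⟩
  refine tendsto_const_nhds.congr fun n => ?_
  symm
  rw [eLpNorm_congr_ae (g := 0), eLpNorm_zero]
  filter_upwards [ae_restrict_mem isClosed_frontier.measurableSet] with x hx
  have hx' : x ∉ tsupport (v n) := fun h => by
    rw [hΩ.frontier_eq] at hx
    exact hx.2 ((hv n).2.2 h)
  simp [image_eq_zero_of_notMem_tsupport hx']

theorem HasTrace.finset_sum (hΩ : IsOpen Ω) {ι : Type*} (s : Finset ι) {u φ : ι → Eu N → ℝ}
    (h : ∀ i ∈ s, HasTrace Ω (u i) (φ i)) :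
    HasTrace Ω (fun x => ∑ i ∈ s, u i x) (fun x => ∑ i ∈ s, φ i x) := by
  classical
  induction s using Finset.induction_on with
  | empty =>
    have h0 : IsTest Ω (0 : Eu N → ℝ) := (testSpace Ω).zero_mem
    have := memH10_of_bounded_gradients hΩ (fun _ : ℕ => h0) (u := 0) (by simp) (by simp) (C := 0)
      (fun n => by
        have : ∇ (0 : Eu N → ℝ) = 0 := by ext x; simp [gradient]
        simp [this])
    simp only [Finset.sum_empty]
    exact this.1.hasTrace_zero hΩ
  | insert i s hi ih =>
    simp only [Finset.sum_insert hi]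
    exact (h i (by simp)).add hΩ (ih fun j hj => h j (by simp [hj]))

end TraceAlgebra

/-! ### Positive parts, their traces, and a first competitor. -/

section PositivePart

/-- A smooth approximation of the positive part. -/
noncomputable def smoothPosPart (ε s : ℝ) : ℝ := (√(s ^ 2 + ε ^ 2) - ε + s) / 2

theorem contDiff_smoothPosPart {ε : ℝ} (hε : 0 < ε) : ContDiff ℝ ∞ (smoothPosPart ε) := by
  have h : ContDiff ℝ ∞ fun s : ℝ => √(s ^ 2 + ε ^ 2) :=
    (by fun_prop : ContDiff ℝ ∞ fun s : ℝ => s ^ 2 + ε ^ 2).sqrt fun s => by positivity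
  unfold smoothPosPart
  fun_prop

theorem smoothPosPart_zero {ε : ℝ} (hε : 0 < ε) : smoothPosPart ε 0 = 0 := by
  simp [smoothPosPart, Real.sqrt_sq hε.le]

/-- The triangle inequality in the plane for the points (s, ε) and (t, ε). -/
theorem sqrt_sq_add_sq_le (ε s t : ℝ) : √(s ^ 2 + ε ^ 2) ≤ √(t ^ 2 + ε ^ 2) + |s - t| := by
  refine Real.sqrt_le_iff.2 ⟨by positivity, ?_⟩
  have h1 := Real.sq_sqrt (show 0 ≤ t ^ 2 + ε ^ 2 by positivity)
  have h2 : |t| ≤ √(t ^ 2 + ε ^ 2) := Real.abs_le_sqrt (by nlinarith [sq_nonneg ε])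
  have h3 : t * (s - t) ≤ √(t ^ 2 + ε ^ 2) * |s - t| :=
    (le_abs_self _).trans (by rw [abs_mul]; gcongr)
  nlinarith [sq_abs (s - t)]

theorem lipschitzWith_smoothPosPart (ε : ℝ) : LipschitzWith 1 (smoothPosPart ε) := by
  refine LipschitzWith.of_dist_le_mul fun s t => ?_
  rw [NNReal.coe_one, one_mul, Real.dist_eq, Real.dist_eq, abs_le, smoothPosPart, smoothPosPart]
  have h1 := sqrt_sq_add_sq_le ε s t
  have h2 := sqrt_sq_add_sq_le ε t s
  rw [abs_sub_comm] at h2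
  constructor <;> linarith [le_abs_self (s - t), neg_abs_le (s - t)]

theorem tendsto_smoothPosPart {ε : ℕ → ℝ} (hε : Tendsto ε atTop (𝓝 0)) (s : ℝ) :
    Tendsto (fun n => smoothPosPart (ε n) s) atTop (𝓝 (max s 0)) := by
  have hc : Continuous fun e : ℝ => smoothPosPart e s := by
    unfold smoothPosPart; fun_prop
  have h := (hc.tendsto 0).comp hε
  have e : smoothPosPart 0 s = max s 0 := by
    simp only [smoothPosPart, ne_eq, OfNat.ofNat_ne_zero, not_false_eq_true, zero_pow, add_zero,
      Real.sqrt_sq_eq_abs, sub_zero]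
    rcases le_total s 0 with hs | hs
    · rw [abs_of_nonpos hs, max_eq_right hs]; ring
    · rw [abs_of_nonneg hs, max_eq_left hs]; ring
  rwa [e] at h

theorem eLpNorm_gradient_comp_le {η : ℝ → ℝ} (hη : ContDiff ℝ ∞ η) (hη1 : LipschitzWith 1 η)
    {v : Eu N → ℝ} (hv : ContDiff ℝ ∞ v) (μ : Measure (Eu N)) :
    eLpNorm (∇ (fun x => η (v x))) 2 μ ≤ eLpNorm (∇ v) 2 μ := by
  refine eLpNorm_mono fun x => ?_
  rw [norm_gradient, norm_gradient]
  have h := (hη.differentiable (by simp) (v x)).hasDerivAt.comp_hasFDerivAt x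
    (hv.differentiable (by simp) x).hasFDerivAt
  have e : fderiv ℝ (fun x => η (v x)) x = deriv η (v x) • fderiv ℝ v x := h.fderiv
  rw [e, norm_smul]
  refine mul_le_of_le_one_left (norm_nonneg _) ?_
  simpa using norm_deriv_le_of_lipschitz (x₀ := v x) hη1

/-- The Lipschitz bound reduces η(v) to η(u), and dominated convergence handles η(u) - p(u), since
both are at most |u|. -/
theorem tendsto_eLpNorm_comp_sub {α : Type*} [MeasurableSpace α] {μ : Measure α}
    {η : ℕ → ℝ → ℝ} {p : ℝ → ℝ} (hη : ∀ n, LipschitzWith 1 (η n)) (hη0 : ∀ n, η n 0 = 0)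
    (hp : ∀ s, Tendsto (fun n => η n s) atTop (𝓝 (p s))) {v : ℕ → α → ℝ} {u : α → ℝ}
    (hv : ∀ n, AEStronglyMeasurable (v n) μ) (hu : MemLp u 2 μ)
    (hvu : Tendsto (fun n => eLpNorm (fun x => v n x - u x) 2 μ) atTop (𝓝 0)) :
    MemLp (fun x => p (u x)) 2 μ ∧
      Tendsto (fun n => eLpNorm (fun x => η n (v n x) - p (u x)) 2 μ) atTop (𝓝 0) := by
  have hle : ∀ n s, |η n s| ≤ |s| := by
    intro n s
    simpa [Real.dist_eq, hη0] using (hη n).dist_le_mul s 0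
  have hple : ∀ s, |p s| ≤ |s| := fun s => le_of_tendsto' (hp s).abs fun n => hle n s
  have hηu : ∀ n, AEStronglyMeasurable (fun x => η n (u x)) μ := fun n =>
    (hη n).continuous.comp_aestronglyMeasurable hu.1
  have hpu : AEStronglyMeasurable (fun x => p (u x)) μ :=
    aestronglyMeasurable_of_tendsto_ae atTop hηu (ae_of_all _ fun x => hp (u x))
  refine ⟨hu.of_le hpu (ae_of_all _ fun x => hple (u x)), ?_⟩
  have h1 : Tendsto (fun n => eLpNorm (fun x => η n (u x) - p (u x)) 2 μ) atTop (𝓝 0) := by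
    refine tendsto_eLpNorm_two_zero ?_
    have := tendsto_lintegral_of_dominated_convergence' (μ := μ)
      (F := fun n x => ‖η n (u x) - p (u x)‖ₑ ^ 2) (f := 0) (fun x => ‖2 * u x‖ₑ ^ 2)
      (fun n => ((hηu n).sub hpu).enorm.pow_const 2) (fun n => ae_of_all _ fun x => ?_) ?_ ?_
    · simpa using this
    · dsimp only
      gcongr
      rw [← ofReal_norm, ← ofReal_norm]
      refine ENNReal.ofReal_le_ofReal ((norm_sub_le _ _).trans ?_)
      rw [norm_mul, Real.norm_eq_abs, Real.norm_eq_abs, Real.norm_eq_abs, Real.norm_eq_abs, abs_two]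
      linarith [hle n (u x), hple (u x)]
    · rw [← sq_eLpNorm_two]; exact ENNReal.pow_ne_top (hu.const_mul 2).2.ne
    · refine ae_of_all _ fun x => ?_
      simpa using ENNReal.Tendsto.pow (n := 2) ((hp (u x)).sub_const (p (u x))).enorm
  refine tendsto_of_tendsto_of_tendsto_of_le_of_le tendsto_const_nhds (by simpa using hvu.add h1)
    (fun _ => zero_le) fun n => ?_
  have e : (fun x => η n (v n x) - p (u x)) =
      (fun x => η n (v n x) - η n (u x)) + fun x => η n (u x) - p (u x) := by
    ext x; simp
  simp only [e]
  refine (eLpNorm_add_le (((hη n).continuous.comp_aestronglyMeasurable (hv n)).sub (hηu n))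
    ((hηu n).sub hpu) (by simp)).trans (add_le_add ?_ le_rfl)
  refine eLpNorm_mono fun x => ?_
  simpa [Real.dist_eq] using (hη n).dist_le_mul (v n x) (u x)

/-- The space of smooth functions on `ℝᴺ`. -/
def smoothSpace (N : ℕ) : Submodule ℝ (Eu N → ℝ) where
  carrier := {v | ContDiff ℝ ∞ v}
  add_mem' := fun {f g} (hf : ContDiff ℝ ∞ f) (hg : ContDiff ℝ ∞ g) => hf.add hg
  zero_mem' := (contDiff_const : ContDiff ℝ ∞ fun _ : Eu N => (0 : ℝ))
  smul_mem' := fun c f (hf : ContDiff ℝ ∞ f) => (contDiff_const (c := c)).smul hf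

/-- The trace of the positive part is the positive part of the trace. -/
theorem HasTrace.posPart (hΩ : IsOpen Ω) {u φ : Eu N → ℝ} (h : HasTrace Ω u φ) :
    HasTrace Ω (fun x => max (u x) 0) (fun x => max (φ x) 0) := by
  obtain ⟨h1, h2, v, hv, h3, h4⟩ := h
  obtain ⟨n₀, hn₀⟩ := eventually_atTop.1 (h3.eventually_eLpNorm_gradient_le hΩ h1 hv)
  have hGtop : 1 + eLpNorm (weakGrad Ω u) 2 (volume.restrict Ω) ≠ ⊤ :=
    ENNReal.add_ne_top.2 ⟨by simp, (h1.memLp_weakGrad hΩ).2.ne⟩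
  set ε : ℕ → ℝ := fun n => 1 / ((n : ℝ) + 1) with hε
  have hεpos : ∀ n, 0 < ε n := fun n => by positivity
  have hlim := fun s => tendsto_smoothPosPart tendsto_one_div_add_atTop_nhds_zero_nat s
  obtain ⟨m1, c1⟩ := tendsto_eLpNorm_comp_sub (fun n => lipschitzWith_smoothPosPart (ε n))
    (fun n => smoothPosPart_zero (hεpos n)) hlim
    (fun n => (hv (n + n₀)).continuous.aestronglyMeasurable) h1.1
    ((tendsto_add_atTop_iff_nat n₀).2 h3.1)
  obtain ⟨m2, c2⟩ := tendsto_eLpNorm_comp_sub (fun n => lipschitzWith_smoothPosPart (ε n))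
    (fun n => smoothPosPart_zero (hεpos n)) hlim
    (fun n => (hv (n + n₀)).continuous.aestronglyMeasurable) h2
    ((tendsto_add_atTop_iff_nat n₀).2 h4)
  -- The 1-Lipschitz compositions do not increase gradients, so bounded gradients suffice and no
  -- formula for the weak gradient of a positive part is needed.
  obtain ⟨k1, ⟨p, hp, k2, k3⟩, -⟩ := memH1_of_bounded_gradients hΩ (surfaceMeasure Ω)
    (smoothSpace N) (fun v hv => hv)
    (v := fun n x => smoothPosPart (ε n) (v (n + n₀) x))
    (fun n => (contDiff_smoothPosPart (hεpos n)).comp (hv (n + n₀))) m1 m2 c1 c2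
    (C := (1 + eLpNorm (weakGrad Ω u) 2 (volume.restrict Ω)).toNNReal) (fun n => by
      rw [ENNReal.coe_toNNReal hGtop]
      exact (eLpNorm_gradient_comp_le (contDiff_smoothPosPart (hεpos n))
        (lipschitzWith_smoothPosPart (ε n)) (hv _) _).trans (hn₀ (n + n₀) (by omega)))
  exact ⟨k1, m2, p, hp, k2, k3⟩

end PositivePart

/-- The class `𝒰` is not empty. -/
theorem exists_isSegregated {k : ℕ} (hΩ : IsOpen Ω) {φ : Fin k → Eu N → ℝ}
    (hφ : IsAdmissibleDatum Ω φ) : ∃ U, IsSegregated Ω φ U := by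
  choose g hg using hφ.mem
  set p : Fin k → Eu N → ℝ := fun i x => max (g i x) 0 with hp
  -- At each point at most one component can exceed the sum of all the others, which gives
  -- segregation. On the boundary at most one datum is nonzero, so the same operation returns the
  -- data.
  have htr : ∀ i, HasTrace Ω (fun x => max (p i x - ∑ j ∈ Finset.univ.erase i, p j x) 0)
      (φ i) := by
    intro i
    have hpt : ∀ i, HasTrace Ω (p i) (fun x => max (φ i x) 0) := fun i => (hg i).posPart hΩ
    refine (((hpt i).sub hΩ (HasTrace.finset_sum hΩ _ fun j _ => hpt j)).posPart hΩ).congr ?_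
    have h1 := ae_all_iff.2 hφ.nonneg
    have h2 : ∀ᵐ x ∂(surfaceMeasure Ω), ∀ j, i ≠ j → φ i x * φ j x = 0 := by
      rw [ae_all_iff]; intro j
      by_cases hij : i = j
      · simp [hij]
      · filter_upwards [hφ.disjoint i j hij] with x hx _ using hx
    filter_upwards [h1, h2] with x h1 h2
    have h3 : ∀ j, max (φ j x) 0 = φ j x := fun j => max_eq_left (h1 j)
    simp only [h3]
    rcases (h1 i).eq_or_lt with h0 | h0
    · rw [← h0]
      exact max_eq_right (sub_nonpos.2 (Finset.sum_nonneg fun j _ => h1 j))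
    · rw [Finset.sum_eq_zero, sub_zero, h3]
      intro j hj
      exact (mul_eq_zero.1 (h2 j (Finset.ne_of_mem_erase hj).symm)).resolve_left h0.ne'
  refine ⟨_, fun i => (htr i).1, htr, fun i => ae_of_all _ fun x => le_max_right _ _,
    fun i j hij => ae_of_all _ fun x => ?_⟩
  have hpos : ∀ j, 0 ≤ p j x := fun j => le_max_right _ _
  have hle : ∀ i j, i ≠ j → p j x ≤ ∑ l ∈ Finset.univ.erase i, p l x := fun i j hij =>
    Finset.single_le_sum (f := fun l => p l x) (fun l _ => hpos l) (by simp [hij.symm])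
  rcases le_total (p i x) (p j x) with h | h
  · rw [max_eq_right (a := p i x - _) (by linarith [hle i j hij]), zero_mul]
  · rw [max_eq_right (a := p j x - _) (by linarith [hle j i hij.symm]), mul_zero]

/-! ### Growth and measurability of the potential. -/

section Potential

variable {f : Eu N → ℝ → ℝ} {L : ℝ≥0} {x : Eu N}

theorem abs_le_of_lipschitzOnWith {h : ℝ → ℝ} (hL : LipschitzOnWith L h (Ici 0)) (h0 : h 0 = 0)
    {t : ℝ} (ht : 0 ≤ t) : |h t| ≤ L * t := by
  have := hL.dist_le_mul t ht 0 self_mem_Ici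
  simpa [Real.dist_eq, h0, abs_of_nonneg ht] using this

theorem intervalIntegrable_of_lipschitzOnWith {h : ℝ → ℝ} (hL : LipschitzOnWith L h (Ici 0))
    {s t : ℝ} (hs : 0 ≤ s) (ht : 0 ≤ t) : IntervalIntegrable h volume s t :=
  (hL.continuousOn.mono fun _ hr => (le_min hs ht).trans hr.1).intervalIntegrable

theorem potential_sub_le (hL : LipschitzOnWith L (f x) (Ici 0)) (h0 : f x 0 = 0) {s t : ℝ}
    (hs : 0 ≤ s) (ht : 0 ≤ t) :
    |potential f x s - potential f x t| ≤ L * (s + t) * |s - t| := by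
  rw [potential, potential, intervalIntegral.integral_interval_sub_left
    (intervalIntegrable_of_lipschitzOnWith hL le_rfl hs)
    (intervalIntegrable_of_lipschitzOnWith hL le_rfl ht), ← Real.norm_eq_abs]
  refine intervalIntegral.norm_integral_le_of_norm_le_const fun r hr => ?_
  have hr0 : 0 ≤ r := (le_min ht hs).trans hr.1.le
  have hr1 : r ≤ s + t := hr.2.trans (max_le (by linarith) (by linarith))
  exact (abs_le_of_lipschitzOnWith hL h0 hr0).trans (by gcongr)

theorem abs_potential_le (hL : LipschitzOnWith L (f x) (Ici 0)) (h0 : f x 0 = 0) {s : ℝ}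
    (hs : 0 ≤ s) : |potential f x s| ≤ L * s ^ 2 := by
  have := potential_sub_le hL h0 hs le_rfl
  simp only [potential, intervalIntegral.integral_same, sub_zero, add_zero, abs_of_nonneg hs] at this ⊢
  linarith

/-- Up to `σ` the Lipschitz bound costs at most `L σ²`; beyond `σ` integrate `β t` and drop the
negative term from the lower limit. The growth bound at `σ` itself forces `β ≥ 0`. -/
theorem potential_le (hL : LipschitzOnWith L (f x) (Ici 0)) (h0 : f x 0 = 0) {β σ : ℝ} (hσ : 0 < σ)
    (hβ : ∀ s ≥ σ, |f x s| ≤ β * s) {s : ℝ} (hs : 0 ≤ s) :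
    potential f x s ≤ 1 / 2 * β * s ^ 2 + L * σ ^ 2 := by
  have hβ0 : 0 ≤ β := by
    have := (abs_nonneg _).trans (hβ σ le_rfl)
    exact nonneg_of_mul_nonneg_left this hσ
  rcases le_total s σ with h | h
  · have h1 := (le_abs_self _).trans (abs_potential_le hL h0 hs)
    have h2 : (L : ℝ) * s ^ 2 ≤ L * σ ^ 2 := by gcongr
    have h3 : 0 ≤ 1 / 2 * β * s ^ 2 := by positivity
    linarith
  · have h1 := (le_abs_self _).trans (abs_potential_le hL h0 hσ.le)
    have h2 : potential f x s = potential f x σ + ∫ t in σ..s, f x t :=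
      (intervalIntegral.integral_add_adjacent_intervals
        (intervalIntegrable_of_lipschitzOnWith hL le_rfl hσ.le)
        (intervalIntegrable_of_lipschitzOnWith hL hσ.le hs)).symm
    have h3 : ∫ t in σ..s, f x t ≤ ∫ t in σ..s, β * t :=
      intervalIntegral.integral_mono_on h (intervalIntegrable_of_lipschitzOnWith hL hσ.le hs)
        ((continuous_const.mul continuous_id).intervalIntegrable _ _)
        fun t ht => (le_abs_self _).trans (hβ t ht.1)
    rw [intervalIntegral.integral_const_mul, integral_id] at h3
    have h4 : 0 ≤ β * σ ^ 2 := by positivity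
    rw [h2]
    linarith

/-- A Carathéodory function agrees almost everywhere with a jointly measurable function. -/
theorem exists_stronglyMeasurable_uncurry {X : Type*} [MeasurableSpace X] {μ : Measure X}
    {f : X → ℝ → ℝ} (hf : ∀ s, 0 ≤ s → AEMeasurable (fun x => f x s) μ)
    (hc : ∀ᵐ x ∂μ, ContinuousOn (f x) (Ici 0)) :
    ∃ g : ℝ → X → ℝ, StronglyMeasurable (Function.uncurry g) ∧
      ∀ᵐ x ∂μ, ∀ s, 0 ≤ s → g s x = f x s := by
  have hr : ∀ r : ℚ, AEMeasurable (fun x => f x (max r 0)) μ := fun r => hf _ (le_max_right _ _)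
  have hgood : ∀ᵐ x ∂μ, ContinuousOn (f x) (Ici 0) ∧
      ∀ r : ℚ, f x (max r 0) = (hr r).mk _ x := by
    filter_upwards [hc, ae_all_iff.2 fun r => (hr r).ae_eq_mk] with x h1 h2 using ⟨h1, h2⟩
  -- Off one null set the function is continuous in `s` and equals measurable representatives at all
  -- rationals; density then gives measurability at every real `s`.
  obtain ⟨T, hTsub, hTm, hT⟩ := exists_measurable_superset_of_null (ae_iff.1 hgood)
  have hTgood : ∀ x ∉ T, ContinuousOn (f x) (Ici 0) ∧
      ∀ r : ℚ, f x (max r 0) = (hr r).mk _ x := fun x hx => by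
    by_contra h; exact hx (hTsub h)
  set g : ℝ → X → ℝ := fun s => Tᶜ.indicator fun x => f x (max s 0) with hg
  have hgc : ∀ x, Continuous fun s => g s x := by
    intro x
    by_cases hx : x ∈ T
    · have : ∀ s, g s x = 0 := fun s => indicator_of_notMem (by simpa using hx) _
      simp only [this]; exact continuous_const
    · have : ∀ s, g s x = f x (max s 0) := fun s =>
        indicator_of_mem (s := Tᶜ) hx (fun x => f x (max s 0))
      simp only [this]
      exact (hTgood x hx).1.comp_continuous (continuous_id.max continuous_const)
        fun s => mem_Ici.2 (le_max_right _ _)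
  have hgrat : ∀ r : ℚ, Measurable (g r) := by
    intro r
    have : g r = Tᶜ.indicator ((hr r).mk _) := by
      ext x
      by_cases hx : x ∈ Tᶜ
      · rw [hg]
        simp only [indicator_of_mem hx]
        exact (hTgood x hx).2 r
      · rw [hg]; simp only [indicator_of_notMem hx]
    rw [this]
    exact (hr r).measurable_mk.indicator hTm.compl
  have hgm : ∀ s, StronglyMeasurable (g s) := by
    intro s
    obtain ⟨r, hrmem, hrlim⟩ := mem_closure_iff_seq_limit.1 (Rat.denseRange_cast (𝕜 := ℝ) s)
    choose q hq using hrmem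
    refine (measurable_of_tendsto_metrizable (f := fun n => g (r n)) (fun n => ?_) ?_).stronglyMeasurable
    · rw [← hq n]; exact hgrat (q n)
    · exact tendsto_pi_nhds.2 fun x => ((hgc x).tendsto s).comp hrlim
  refine ⟨g, stronglyMeasurable_uncurry_of_continuous_of_stronglyMeasurable hgc hgm, ?_⟩
  filter_upwards [measure_eq_zero_iff_ae_notMem.1 hT] with x hx s hs
  rw [hg]
  simp only [indicator_of_mem (s := Tᶜ) hx, max_eq_left hs]

/-- Substituting t = u(x) r turns the variable upper limit into the fixed interval from 0 to 1, so
measurability of parameter integrals applies. -/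
theorem aestronglyMeasurable_potential {μ : Measure (Eu N)}
    (hf : ∀ s, 0 ≤ s → AEMeasurable (fun x => f x s) μ)
    (hc : ∀ᵐ x ∂μ, ContinuousOn (f x) (Ici 0)) {u : Eu N → ℝ} (hu : AEMeasurable u μ)
    (hu0 : ∀ᵐ x ∂μ, 0 ≤ u x) : AEStronglyMeasurable (fun x => potential f x (u x)) μ := by
  obtain ⟨g, hg, hgf⟩ := exists_stronglyMeasurable_uncurry hf hc
  set u' := hu.mk u with hu'
  have hum : Measurable u' := hu.measurable_mk
  have h1 : StronglyMeasurable fun p : Eu N × ℝ => g (u' p.1 * p.2) p.1 :=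
    hg.comp_measurable (((hum.comp measurable_fst).mul measurable_snd).prodMk measurable_fst)
  have h2 : StronglyMeasurable fun x => u' x * ∫ t in Ioc (0 : ℝ) 1, g (u' x * t) x :=
    hum.stronglyMeasurable.mul h1.integral_prod_right'
  refine ⟨_, h2, ?_⟩
  filter_upwards [hgf, hu0, hu.ae_eq_mk] with x h3 h4 h5
  rw [potential, ← intervalIntegral.integral_of_le zero_le_one, show u' x = u x from h5.symm,
    intervalIntegral.mul_integral_comp_mul_left (f := fun t => g t x)]
  simp only [mul_zero, mul_one]
  refine intervalIntegral.integral_congr fun t ht => ?_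
  rw [uIcc_of_le h4] at ht
  exact (h3 t ht.1).symm

end Potential

/-! ### Integrability of the energy density. -/

section Energy

variable {d : Eu N → ℝ} {f : Eu N → ℝ → ℝ}

theorem IsDiffusion.exists_bounds (hb : Bornology.IsBounded Ω) (hne : Ω.Nonempty)
    (hd : IsDiffusion Ω d) :
    ∃ m M : ℝ, 0 < m ∧ ∀ x ∈ Ω, m ≤ d x ^ 2 ∧ d x ^ 2 ≤ M := by
  have hc : ContinuousOn (fun x => d x ^ 2) (closure Ω) := hd.cont.pow 2
  obtain ⟨y, hy, hmin⟩ := hb.isCompact_closure.exists_isMinOn hne.closure hc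
  obtain ⟨z, -, hmax⟩ := hb.isCompact_closure.exists_isMaxOn hne.closure hc
  exact ⟨d y ^ 2, d z ^ 2, pow_pos (hd.pos y hy) 2, fun x hx =>
    ⟨hmin (subset_closure hx), hmax (subset_closure hx)⟩⟩

theorem IsDiffusion.aestronglyMeasurable_sq (hΩ : IsOpen Ω) (hd : IsDiffusion Ω d) :
    AEStronglyMeasurable (fun x => d x ^ 2) (volume.restrict Ω) :=
  ((hd.cont.mono subset_closure).pow 2).aestronglyMeasurable hΩ.measurableSet

theorem integrableOn_mul_of_le {c h : Eu N → ℝ} {M : ℝ}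
    (hc : AEStronglyMeasurable c (volume.restrict Ω)) (hM : ∀ᵐ x ∂(volume.restrict Ω), |c x| ≤ M)
    (hh : IntegrableOn h Ω) : IntegrableOn (fun x => c x * h x) Ω :=
  Integrable.bdd_mul (c := M) hh hc hM

theorem integrable_norm_sq {E : Type*} [NormedAddCommGroup E] {α : Type*} [MeasurableSpace α]
    {μ : Measure α} {g : α → E} (hg : MemLp g 2 μ) : Integrable (fun x => ‖g x‖ ^ 2) μ :=
  hg.integrable_norm_pow two_ne_zero

theorem integrable_sq {α : Type*} [MeasurableSpace α]
    {μ : Measure α} {g : α → ℝ} (hg : MemLp g 2 μ) : Integrable (fun x => g x ^ 2) μ := by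
  simpa using integrable_norm_sq hg

theorem IsDiffusion.integrable_mul_norm_sq (hΩ : IsOpen Ω) (hb : Bornology.IsBounded Ω)
    (hne : Ω.Nonempty) (hd : IsDiffusion Ω d) {G : Eu N → Eu N}
    (hG : MemLp G 2 (volume.restrict Ω)) : IntegrableOn (fun x => d x ^ 2 * ‖G x‖ ^ 2) Ω := by
  obtain ⟨m, M, hm, hM⟩ := hd.exists_bounds hb hne
  refine integrableOn_mul_of_le (M := M) (hd.aestronglyMeasurable_sq hΩ) ?_ (integrable_norm_sq hG)
  filter_upwards [ae_restrict_mem hΩ.measurableSet] with x hx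
  rw [abs_of_nonneg (sq_nonneg _)]
  exact (hM x hx).2

theorem integrable_potential (hΩ : IsOpen Ω)
    (hf_meas : ∀ s : ℝ, 0 ≤ s → AEMeasurable (fun x => f x s) (volume.restrict Ω))
    (hA1 : AssumptionA1 Ω f) {u : Eu N → ℝ} (hu : MemLp u 2 (volume.restrict Ω))
    (hu0 : ∀ᵐ x ∂(volume.restrict Ω), 0 ≤ u x) :
    IntegrableOn (fun x => potential f x (u x)) Ω := by
  obtain ⟨L, hL⟩ := hA1.lipschitz
  have hmem := ae_restrict_mem hΩ.measurableSet (μ := (volume : Measure (Eu N)))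
  refine ((integrable_sq hu).const_mul (L : ℝ)).mono' (aestronglyMeasurable_potential hf_meas
    ?_ hu.1.aemeasurable hu0) ?_
  · filter_upwards [hmem] with x hx using (hL x hx).continuousOn
  · filter_upwards [hmem, hu0] with x hx h0
    exact abs_potential_le (hL x hx) (hA1.zero x hx) h0

theorem integrableOn_energyDensity (hΩ : IsOpen Ω) (hb : Bornology.IsBounded Ω) (hne : Ω.Nonempty)
    (hd : IsDiffusion Ω d)
    (hf_meas : ∀ s : ℝ, 0 ≤ s → AEMeasurable (fun x => f x s) (volume.restrict Ω))
    (hA1 : AssumptionA1 Ω f) {u : Eu N → ℝ} (hu : MemH1 Ω u)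
    (hu0 : ∀ᵐ x ∂(volume.restrict Ω), 0 ≤ u x) : IntegrableOn (energyDensity Ω d f u) Ω := by
  have h1 := (hd.integrable_mul_norm_sq hΩ hb hne (hu.memLp_weakGrad hΩ)).const_mul (1 / 2)
  exact (h1.sub (integrable_potential hΩ hf_meas hA1 hu.1 hu0)).congr
    (ae_of_all _ fun x => by simp only [Pi.sub_apply, energyDensity]; ring)

end Energy

/-! ### Continuity of quadratic functionals in `L²`. -/

section Convergence

variable {α : Type*} [MeasurableSpace α] {μ : Measure α}

theorem eLpNorm_le_of_integral_sq_le {E : Type*} [NormedAddCommGroup E] {g : α → E}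
    (hg : MemLp g 2 μ) {R : ℝ} (hR : ∫ x, ‖g x‖ ^ 2 ∂μ ≤ R) :
    eLpNorm g 2 μ ≤ ((√R).toNNReal : ℝ≥0∞) := by
  have hR0 : 0 ≤ R := (integral_nonneg fun x => by positivity).trans hR
  rw [← ENNReal.pow_le_pow_left_iff two_ne_zero, ← ofReal_integral_norm_sq hg]
  change _ ≤ ENNReal.ofReal (√R) ^ 2
  rw [← ENNReal.ofReal_pow (Real.sqrt_nonneg R), Real.sq_sqrt hR0]
  exact ENNReal.ofReal_le_ofReal hR

theorem tendsto_integral_norm_sq_sub {E : Type*} [NormedAddCommGroup E] {u : ℕ → α → E} {a : α → E}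
    (hu : ∀ n, MemLp (u n) 2 μ) (ha : MemLp a 2 μ)
    (h : Tendsto (fun n => eLpNorm (fun x => u n x - a x) 2 μ) atTop (𝓝 0)) :
    Tendsto (fun n => ∫ x, ‖u n x - a x‖ ^ 2 ∂μ) atTop (𝓝 0) := by
  have h1 := (ENNReal.tendsto_toReal (a := 0) (by simp)).comp (ENNReal.Tendsto.pow (n := 2) h |>.trans
    (by simp))
  refine h1.congr fun n => ?_
  have h2 := ofReal_integral_norm_sq ((hu n).sub ha)
  simp only [Function.comp_apply]
  rw [show (fun x => u n x - a x) = u n - a from rfl, ← h2, ENNReal.toReal_ofReal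
    (integral_nonneg fun x => by positivity)]
  rfl

/-- Functionals with locally Lipschitz integrands of quadratic growth are continuous in `L²`. -/
theorem tendsto_integral_of_quadratic {u : ℕ → α → ℝ} {a : α → ℝ} (hu : ∀ n, MemLp (u n) 2 μ)
    (ha : MemLp a 2 μ) (h : Tendsto (fun n => eLpNorm (fun x => u n x - a x) 2 μ) atTop (𝓝 0))
    {q : ℕ → α → ℝ} {p : α → ℝ} (hq : ∀ n, Integrable (q n) μ) (hp : Integrable p μ) {K : ℝ}
    (hK : ∀ n, ∀ᵐ x ∂μ, |q n x - p x| ≤ K * (|u n x| + |a x|) * |u n x - a x|) (hK0 : 0 ≤ K) :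
    Tendsto (fun n => ∫ x, q n x ∂μ) atTop (𝓝 (∫ x, p x ∂μ)) := by
  have t1 := tendsto_integral_norm_sq_sub hu ha h
  have hm : ∀ n, MemLp (fun x => |u n x - a x|) 2 μ := fun n => ((hu n).sub ha).abs
  have t2 : Tendsto (fun n => ∫ x, |u n x - a x| * |a x| ∂μ) atTop (𝓝 0) := by
    have := tendsto_integral_inner (f := fun n x => |u n x - a x|) (a := fun _ => 0) hm
      (by simp) ha.abs (by
        refine h.congr fun n => eLpNorm_congr_norm_ae (ae_of_all _ fun x => by simp))
    simpa [mul_comm] using this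
  -- From |u| + |a| ≤ |u - a| + 2|a|, the error is at most K(|u - a|² + 2|u - a||a|).
  have t3 := (t1.add (t2.const_mul 2)).const_mul K
  rw [mul_zero, add_zero, mul_zero] at t3
  rw [tendsto_iff_norm_sub_tendsto_zero]
  refine squeeze_zero (fun _ => norm_nonneg _) (fun n => ?_) t3
  rw [← integral_sub (hq n) hp]
  have i1 : Integrable (fun x => ‖u n x - a x‖ ^ 2) μ := integrable_norm_sq ((hu n).sub ha)
  have i2 : Integrable (fun x => |u n x - a x| * |a x|) μ := memLp_two_mul (hm n) ha.abs
  rw [← integral_const_mul, ← integral_add i1 (i2.const_mul 2), ← integral_const_mul]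
  refine norm_integral_le_of_norm_le ((i1.add (i2.const_mul 2)).const_mul K) ?_
  filter_upwards [hK n] with x hx
  refine hx.trans ?_
  rw [mul_assoc]
  refine mul_le_mul_of_nonneg_left ?_ hK0
  have h1 : |u n x| ≤ |u n x - a x| + |a x| := by
    simpa using abs_add_le (u n x - a x) (a x)
  rw [Real.norm_eq_abs]
  nlinarith [abs_nonneg (u n x - a x), abs_nonneg (a x)]

theorem exists_subseq_tendsto_ae {u : ℕ → α → ℝ} {a : α → ℝ} (hu : ∀ n, MemLp (u n) 2 μ)
    (ha : MemLp a 2 μ) (h : Tendsto (fun n => eLpNorm (fun x => u n x - a x) 2 μ) atTop (𝓝 0)) :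
    ∃ s : ℕ → ℕ, StrictMono s ∧ ∀ᵐ x ∂μ, Tendsto (fun n => u (s n) x) atTop (𝓝 (a x)) :=
  (tendstoInMeasure_of_tendsto_eLpNorm (p := 2) (by simp) (fun n => (hu n).1) ha.1
    h).exists_seq_tendsto_ae

end Convergence

/-! ### Weak compactness in `H¹₀`. -/

section WeakConvergence

/-- Convergence in `L²(Ω)`, with weak convergence in `L²(Ω)` of the gradients. -/
structure TendstoWeakH1 (Ω : Set (Eu N)) (u : ℕ → Eu N → ℝ) (a : Eu N → ℝ) : Prop where
  strong : Tendsto (fun n => eLpNorm (fun x => u n x - a x) 2 (volume.restrict Ω)) atTop (𝓝 0)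
  weak : ∀ Z : Eu N → Eu N, MemLp Z 2 (volume.restrict Ω) →
    Tendsto (fun n => ∫ x in Ω, inner ℝ (weakGrad Ω (u n) x) (Z x)) atTop
      (𝓝 (∫ x in Ω, inner ℝ (weakGrad Ω a x) (Z x)))

theorem TendstoWeakH1.comp {u : ℕ → Eu N → ℝ} {a : Eu N → ℝ} (h : TendstoWeakH1 Ω u a)
    {s : ℕ → ℕ} (hs : StrictMono s) : TendstoWeakH1 Ω (fun n => u (s n)) a :=
  ⟨h.strong.comp hs.tendsto_atTop, fun Z hZ => (h.weak Z hZ).comp hs.tendsto_atTop⟩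

theorem TendstoWeakH1.add_const (hΩ : IsOpen Ω) {u : ℕ → Eu N → ℝ} {a g : Eu N → ℝ}
    (hu : ∀ n, MemH1 Ω (u n)) (ha : MemH1 Ω a) (hg : MemH1 Ω g) (h : TendstoWeakH1 Ω u a) :
    TendstoWeakH1 Ω (fun n x => u n x + g x) (fun x => a x + g x) := by
  refine ⟨by simpa using h.strong, fun Z hZ => ?_⟩
  have key : ∀ v, MemH1 Ω v → ∫ x in Ω, inner ℝ (weakGrad Ω (fun x => v x + g x) x) (Z x) =
      (∫ x in Ω, inner ℝ (weakGrad Ω v x) (Z x)) + ∫ x in Ω, inner ℝ (weakGrad Ω g x) (Z x) := by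
    intro v hv
    rw [← integral_add (memLp_two_inner (hv.memLp_weakGrad hΩ) hZ)
      (memLp_two_inner (hg.memLp_weakGrad hΩ) hZ)]
    refine integral_congr_ae ?_
    filter_upwards [hv.weakGrad_add hΩ hg] with x hx
    rw [hx, inner_add_left]
  rw [key a ha]
  simp only [key _ (hu _)]
  exact (h.weak Z hZ).add_const _

/-- Bounded sequences in `H¹₀(Ω)` have subsequences that converge strongly in `L²(Ω)` and weakly in
`H¹₀(Ω)`. -/
theorem exists_tendstoWeakH1 (hΩ : IsOpen Ω) (hb : Bornology.IsBounded Ω) {w : ℕ → Eu N → ℝ}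
    (hw : ∀ n, MemH10 Ω (w n)) {C : ℝ≥0}
    (hC : ∀ n, eLpNorm (w n) 2 (volume.restrict Ω) ≤ C)
    (hC' : ∀ n, eLpNorm (weakGrad Ω (w n)) 2 (volume.restrict Ω) ≤ C) :
    ∃ (s : ℕ → ℕ) (a : Eu N → ℝ), StrictMono s ∧ MemH10 Ω a ∧
      TendstoWeakH1 Ω (fun n => w (s n)) a := by
  set μ := volume.restrict Ω with hμ
  set δ : ℕ → ℝ≥0∞ := fun n => ((n : ℝ≥0∞) + 1)⁻¹ with hδ
  have hδpos : ∀ n, 0 < δ n := fun n => by simp [hδ]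
  have hδ1 : ∀ n, δ n ≤ 1 := fun n => by simp [hδ]
  have hδlim : Tendsto δ atTop (𝓝 0) := by
    have := ENNReal.tendsto_inv_nat_nhds_zero.comp (tendsto_add_atTop_nat 1)
    simpa [hδ, Function.comp_def] using this
  -- Each function is replaced by a test function at `H¹` distance tending to 0, which affects
  -- neither the strong nor the weak limits.
  have hsel : ∀ n, ∃ ψ, IsTest Ω ψ ∧ eLpNorm (fun x => ψ x - w n x) 2 μ ≤ δ n ∧
      eLpNorm (fun x => ∇ ψ x - weakGrad Ω (w n) x) 2 μ ≤ δ n := by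
    intro n
    obtain ⟨-, v, hv, hv1, hv2⟩ := hw n
    obtain ⟨j, h1, h2⟩ := ((hv1.eventually (ge_mem_nhds (hδpos n))).and
      (hv2.eventually (ge_mem_nhds (hδpos n)))).exists
    exact ⟨v j, hv j, h1, h2⟩
  choose ψ hψ h1 h2 using hsel
  have hwm : ∀ n, MemLp (w n) 2 μ := fun n => (hw n).1.1
  have hGm : ∀ n, MemLp (weakGrad Ω (w n)) 2 μ := fun n => (hw n).1.memLp_weakGrad hΩ
  have hψm : ∀ n, AEStronglyMeasurable (ψ n) μ := fun n => (hψ n).1.continuous.aestronglyMeasurable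
  have hgm : ∀ n, AEStronglyMeasurable (∇ (ψ n)) μ := fun n =>
    (continuous_gradient (hψ n).1).aestronglyMeasurable
  have b1 : ∀ n, eLpNorm (ψ n) 2 μ ≤ ((1 + C : ℝ≥0) : ℝ≥0∞) := by
    intro n
    have e : ψ n = (fun x => ψ n x - w n x) + w n := by ext x; simp
    rw [e, ENNReal.coe_add]
    exact (eLpNorm_add_le ((hψm n).sub (hwm n).1) (hwm n).1 (by simp)).trans
      (add_le_add ((h1 n).trans (hδ1 n)) (hC n))
  have b2 : ∀ n, eLpNorm (∇ (ψ n)) 2 μ ≤ ((1 + C : ℝ≥0) : ℝ≥0∞) := by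
    intro n
    have e : ∇ (ψ n) = (fun x => ∇ (ψ n) x - weakGrad Ω (w n) x) + weakGrad Ω (w n) := by
      ext x; simp
    rw [e, ENNReal.coe_add]
    exact (eLpNorm_add_le ((hgm n).sub (hGm n).1) (hGm n).1 (by simp)).trans
      (add_le_add ((h2 n).trans (hδ1 n)) (hC' n))
  have hgL : ∀ n, MemLp (∇ (ψ n)) 2 μ := fun n => ⟨hgm n, (b2 n).trans_lt ENNReal.coe_lt_top⟩
  obtain ⟨s₁, a, hs₁, ha, hsa⟩ := exists_tendsto_of_bounded_gradients hb hψ b1 b2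
  obtain ⟨ha0, s₂, hs₂, hweak⟩ := memH10_of_bounded_gradients hΩ (fun n => hψ (s₁ n)) ha hsa
    (fun n => b2 (s₁ n))
  have hs : StrictMono fun n => s₁ (s₂ n) := hs₁.comp hs₂
  refine ⟨fun n => s₁ (s₂ n), a, hs, ha0, ?_, fun Z hZ => ?_⟩
  · refine tendsto_of_tendsto_of_tendsto_of_le_of_le tendsto_const_nhds
      (by simpa using (hδlim.comp hs.tendsto_atTop).add (hsa.comp hs₂.tendsto_atTop))
      (fun _ => zero_le) fun n => ?_
    set j := s₁ (s₂ n)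
    have e : (fun x => w j x - a x) = (w j - ψ j) + fun x => ψ j x - a x := by
      ext x; simp
    change eLpNorm (fun x => w j x - a x) 2 μ ≤ _
    rw [e]
    refine (eLpNorm_add_le ((hwm j).1.sub (hψm j)) ((hψm j).sub ha.1) (by simp)).trans
      (add_le_add ?_ le_rfl)
    rw [eLpNorm_sub_comm]
    exact h1 j
  · have hd : ∀ n, MemLp (fun x => ∇ (ψ n) x - weakGrad Ω (w n) x) 2 μ := fun n =>
      (hgL n).sub (hGm n)
    have t := tendsto_integral_inner (fun n => hd (s₁ (s₂ n))) (a := fun _ => 0) (by simp) hZ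
      (by
        simp only [sub_zero]
        exact tendsto_of_tendsto_of_tendsto_of_le_of_le tendsto_const_nhds
          (hδlim.comp hs.tendsto_atTop) (fun _ => zero_le) fun n => h2 _)
    have t2 := (hweak Z hZ).sub t
    simp only [inner_zero_left, integral_zero, sub_zero] at t2
    refine t2.congr fun n => ?_
    rw [← integral_sub (memLp_two_inner (hgL _) hZ) (memLp_two_inner (hd _) hZ)]
    refine integral_congr_ae (ae_of_all _ fun x => ?_)
    simp only [inner_sub_left]
    ring

end WeakConvergence

/-! ### Lower semicontinuity of the gradient term and coercivity of the quadratic form. -/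

section Coercivity

variable {d b : Eu N → ℝ}

/-- The square of the norm of `H¹(Ω)`. -/
noncomputable def sqNormH1 (Ω : Set (Eu N)) (w : Eu N → ℝ) : ℝ :=
  (∫ x in Ω, w x ^ 2) + ∫ x in Ω, ‖weakGrad Ω w x‖ ^ 2

theorem sqNormH1_nonneg (Ω : Set (Eu N)) (w : Eu N → ℝ) : 0 ≤ sqNormH1 Ω w :=
  add_nonneg (integral_nonneg fun x => by positivity) (integral_nonneg fun x => by positivity)

theorem exists_tendstoWeakH1_of_sqNormH1_le (hΩ : IsOpen Ω) (hb : Bornology.IsBounded Ω)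
    {w : ℕ → Eu N → ℝ} (hw : ∀ n, MemH10 Ω (w n)) {R : ℝ} (hR : ∀ n, sqNormH1 Ω (w n) ≤ R) :
    ∃ (s : ℕ → ℕ) (a : Eu N → ℝ), StrictMono s ∧ MemH10 Ω a ∧
      TendstoWeakH1 Ω (fun n => w (s n)) a := by
  refine exists_tendstoWeakH1 hΩ hb hw (C := (√R).toNNReal) (fun n => ?_) (fun n => ?_)
  · refine eLpNorm_le_of_integral_sq_le (hw n).1.1 (le_trans ?_ (hR n))
    simp only [Real.norm_eq_abs, sq_abs]
    exact le_add_of_nonneg_right (integral_nonneg fun x => by positivity)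
  · exact eLpNorm_le_of_integral_sq_le ((hw n).1.memLp_weakGrad hΩ) (le_trans
      (le_add_of_nonneg_left (integral_nonneg fun x => by positivity)) (hR n))

theorem MemLp.ae_abs_le {c : Eu N → ℝ} {μ : Measure (Eu N)} (hc : MemLp c ∞ μ) :
    ∃ B, 0 ≤ B ∧ ∀ᵐ x ∂μ, |c x| ≤ B := by
  refine ⟨(eLpNormEssSup c μ).toReal, ENNReal.toReal_nonneg, ?_⟩
  have hfin : eLpNormEssSup c μ ≠ ⊤ := by simpa [eLpNorm_exponent_top] using hc.2.ne
  filter_upwards [enorm_ae_le_eLpNormEssSup c μ] with x hx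
  rw [← Real.norm_eq_abs, ← toReal_enorm]
  exact ENNReal.toReal_mono hfin hx

theorem integrable_mul_sq {u : Eu N → ℝ} (hb : MemLp b ∞ (volume.restrict Ω))
    (hu : MemLp u 2 (volume.restrict Ω)) : IntegrableOn (fun x => b x * u x ^ 2) Ω := by
  obtain ⟨B, -, hB⟩ := MemLp.ae_abs_le hb
  exact integrableOn_mul_of_le hb.1 hB (integrable_sq hu)

theorem tendsto_integral_mul_sq {u : ℕ → Eu N → ℝ} {a : Eu N → ℝ}
    (hb : MemLp b ∞ (volume.restrict Ω)) (hu : ∀ n, MemLp (u n) 2 (volume.restrict Ω))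
    (ha : MemLp a 2 (volume.restrict Ω))
    (h : Tendsto (fun n => eLpNorm (fun x => u n x - a x) 2 (volume.restrict Ω)) atTop (𝓝 0)) :
    Tendsto (fun n => ∫ x in Ω, b x * u n x ^ 2) atTop (𝓝 (∫ x in Ω, b x * a x ^ 2)) := by
  obtain ⟨B, hB0, hB⟩ := MemLp.ae_abs_le hb
  refine tendsto_integral_of_quadratic hu ha h (fun n => integrable_mul_sq hb (hu n))
    (integrable_mul_sq hb ha) (fun n => ?_) hB0
  filter_upwards [hB] with x hx
  have : b x * u n x ^ 2 - b x * a x ^ 2 = b x * (u n x + a x) * (u n x - a x) := by ring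
  rw [this, abs_mul, abs_mul]
  gcongr
  exact abs_add_le _ _

/-- The functional `∫ d² |G|²` lies above its tangents. -/
theorem integral_mul_norm_sq_ge (hΩ : IsOpen Ω) (hbd : Bornology.IsBounded Ω) (hne : Ω.Nonempty)
    (hd : IsDiffusion Ω d) {G G' : Eu N → Eu N} (hG : MemLp G 2 (volume.restrict Ω))
    (hG' : MemLp G' 2 (volume.restrict Ω)) :
    MemLp (fun x => d x ^ 2 • G x) 2 (volume.restrict Ω) ∧
    (∫ x in Ω, d x ^ 2 * ‖G x‖ ^ 2) + 2 * ((∫ x in Ω, inner ℝ (G' x) (d x ^ 2 • G x)) -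
      ∫ x in Ω, inner ℝ (G x) (d x ^ 2 • G x)) ≤ ∫ x in Ω, d x ^ 2 * ‖G' x‖ ^ 2 := by
  obtain ⟨m, M, hm, hM⟩ := hd.exists_bounds hbd hne
  have hZ : MemLp (fun x => d x ^ 2 • G x) 2 (volume.restrict Ω) := by
    refine (hG.const_smul M).of_le ((hd.aestronglyMeasurable_sq hΩ).smul hG.1) ?_
    filter_upwards [ae_restrict_mem hΩ.measurableSet] with x hx
    rw [norm_smul, Pi.smul_apply, norm_smul, Real.norm_of_nonneg (sq_nonneg _)]
    gcongr
    exact (hM x hx).2.trans (le_abs_self _)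
  refine ⟨hZ, ?_⟩
  have i1 := hd.integrable_mul_norm_sq hΩ hbd hne hG
  have i2 := hd.integrable_mul_norm_sq hΩ hbd hne hG'
  have i3 := memLp_two_inner hG' hZ
  have i4 := memLp_two_inner hG hZ
  have i5 : Integrable (fun x => 2 * (inner ℝ (G' x) (d x ^ 2 • G x) -
    inner ℝ (G x) (d x ^ 2 • G x))) (volume.restrict Ω) := (i3.sub i4).const_mul 2
  rw [← integral_sub i3 i4, ← integral_const_mul, ← integral_add i1 i5]
  refine integral_mono (i1.add i5) i2 fun x => ?_
  have h0 : 0 ≤ d x ^ 2 * ‖G' x - G x‖ ^ 2 := by positivity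
  rw [norm_sub_sq_real] at h0
  simp only [inner_smul_right, real_inner_self_eq_norm_sq]
  linarith

/-- The bounds are the tangents at the limit `a` to the convex functional; they are affine in the
gradient, so they converge under weak convergence. -/
theorem TendstoWeakH1.eventually_lower_bound (hΩ : IsOpen Ω) (hbd : Bornology.IsBounded Ω)
    (hne : Ω.Nonempty) (hd : IsDiffusion Ω d) {u : ℕ → Eu N → ℝ} {a : Eu N → ℝ}
    (hu : ∀ n, MemH1 Ω (u n)) (ha : MemH1 Ω a) (h : TendstoWeakH1 Ω u a) :
    ∃ e : ℕ → ℝ, (∀ n, e n ≤ ∫ x in Ω, d x ^ 2 * ‖weakGrad Ω (u n) x‖ ^ 2) ∧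
      Tendsto e atTop (𝓝 (∫ x in Ω, d x ^ 2 * ‖weakGrad Ω a x‖ ^ 2)) := by
  have hG := ha.memLp_weakGrad hΩ
  refine ⟨_, fun n => (integral_mul_norm_sq_ge hΩ hbd hne hd hG ((hu n).memLp_weakGrad hΩ)).2, ?_⟩
  have hZ := (integral_mul_norm_sq_ge hΩ hbd hne hd hG hG).1
  have t := (((h.weak _ hZ).sub_const
    (∫ x in Ω, inner ℝ (weakGrad Ω a x) (d x ^ 2 • weakGrad Ω a x))).const_mul 2).const_add
    (∫ x in Ω, d x ^ 2 * ‖weakGrad Ω a x‖ ^ 2)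
  rwa [sub_self, mul_zero, add_zero] at t

/-- The quadratic form `∫ (d² |∇w|² - b w²)` of assumption (A2). -/
noncomputable def quadForm (Ω : Set (Eu N)) (d b w : Eu N → ℝ) : ℝ :=
  ∫ x in Ω, (d x ^ 2 * ‖weakGrad Ω w x‖ ^ 2 - b x * w x ^ 2)

theorem quadForm_eq (hΩ : IsOpen Ω) (hbd : Bornology.IsBounded Ω) (hne : Ω.Nonempty)
    (hd : IsDiffusion Ω d) (hb : MemLp b ∞ (volume.restrict Ω)) {w : Eu N → ℝ} (hw : MemH1 Ω w) :
    quadForm Ω d b w = (∫ x in Ω, d x ^ 2 * ‖weakGrad Ω w x‖ ^ 2) - ∫ x in Ω, b x * w x ^ 2 :=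
  integral_sub (hd.integrable_mul_norm_sq hΩ hbd hne (hw.memLp_weakGrad hΩ))
    (integrable_mul_sq hb hw.1)

theorem quadForm_const_mul (hΩ : IsOpen Ω) {w : Eu N → ℝ} (hw : MemH1 Ω w) (t : ℝ) :
    quadForm Ω d b (fun x => t * w x) = t ^ 2 * quadForm Ω d b w := by
  rw [quadForm, quadForm, ← integral_const_mul]
  refine integral_congr_ae ?_
  filter_upwards [hw.weakGrad_const_mul hΩ t] with x hx
  rw [hx, norm_smul, mul_pow, mul_pow, Real.norm_eq_abs, sq_abs]
  ring

theorem sqNormH1_const_mul (hΩ : IsOpen Ω) {w : Eu N → ℝ} (hw : MemH1 Ω w) (t : ℝ) :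
    sqNormH1 Ω (fun x => t * w x) = t ^ 2 * sqNormH1 Ω w := by
  rw [sqNormH1, sqNormH1, mul_add, ← integral_const_mul, ← integral_const_mul]
  congr 1
  · exact integral_congr_ae (ae_of_all _ fun x => by simp only [mul_pow])
  · refine integral_congr_ae ?_
    filter_upwards [hw.weakGrad_const_mul hΩ t] with x hx
    rw [hx, norm_smul, mul_pow, Real.norm_eq_abs, sq_abs]

theorem MemH1.weakGrad_ae_zero (hΩ : IsOpen Ω) {w : Eu N → ℝ} (hw : MemH1 Ω w)
    (h0 : w =ᵐ[volume.restrict Ω] 0) : weakGrad Ω w =ᵐ[volume.restrict Ω] 0 := by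
  have h1 : w =ᵐ[volume.restrict Ω] fun x => 0 * w x := by
    filter_upwards [h0] with x hx
    simp [hx]
  filter_upwards [hw.weakGrad_congr hΩ h1, hw.weakGrad_const_mul hΩ 0] with x h2 h3
  rw [← h2, h3]; simp

/-- A positive quadratic form `∫ (d² |∇w|² - b w²)` is coercive on `H¹₀(Ω)`. -/
theorem exists_coercive (hΩ : IsOpen Ω) (hbd : Bornology.IsBounded Ω) (hne : Ω.Nonempty)
    (hd : IsDiffusion Ω d) (hb : MemLp b ∞ (volume.restrict Ω))
    (hpos : ∀ w : Eu N → ℝ, MemH10 Ω w → ¬ (w =ᵐ[volume.restrict Ω] 0) → 0 < quadForm Ω d b w) :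
    ∃ c > 0, ∀ w : Eu N → ℝ, MemH10 Ω w → c * sqNormH1 Ω w ≤ quadForm Ω d b w := by
  by_contra! hcon
  have hnonneg : ∀ w : Eu N → ℝ, MemH10 Ω w → 0 ≤ quadForm Ω d b w := by
    intro w hw
    by_cases h0 : w =ᵐ[volume.restrict Ω] 0
    · refine (integral_eq_zero_of_ae ?_).ge
      filter_upwards [h0, hw.1.weakGrad_ae_zero hΩ h0] with x h1 h2
      simp [h1, h2]
    · exact (hpos w hw h0).le
  set r : ℕ → ℝ := fun n => 1 / ((n : ℝ) + 1) with hr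
  have hrpos : ∀ n, 0 < r n := fun n => by positivity
  have hrlim : Tendsto r atTop (𝓝 0) := tendsto_one_div_add_atTop_nhds_zero_nat
  have hseq : ∀ n, ∃ z : Eu N → ℝ, MemH10 Ω z ∧ sqNormH1 Ω z = 1 ∧ quadForm Ω d b z < r n := by
    intro n
    obtain ⟨w, hw, hlt⟩ := hcon (r n) (hrpos n)
    have hN : 0 < sqNormH1 Ω w := by
      have := (hnonneg w hw).trans_lt hlt
      exact (mul_pos_iff_of_pos_left (hrpos n)).1 this
    refine ⟨fun x => (√(sqNormH1 Ω w))⁻¹ * w x, hw.const_mul hΩ _, ?_, ?_⟩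
    · rw [sqNormH1_const_mul hΩ hw.1, inv_pow, Real.sq_sqrt hN.le, inv_mul_cancel₀ hN.ne']
    · rw [quadForm_const_mul hΩ hw.1, inv_pow, Real.sq_sqrt hN.le, inv_mul_lt_iff₀ hN]
      linarith
  choose z hz hz1 hzr using hseq
  obtain ⟨s, a, hs, ha, hconv⟩ := exists_tendstoWeakH1_of_sqNormH1_le hΩ hbd hz
    (fun n => (hz1 n).le)
  have hm : ∀ n, MemLp (z (s n)) 2 (volume.restrict Ω) := fun n => (hz (s n)).1.1
  obtain ⟨e, he, helim⟩ := hconv.eventually_lower_bound hΩ hbd hne hd (fun n => (hz (s n)).1) ha.1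
  have tb := tendsto_integral_mul_sq hb hm ha.1.1 hconv.strong
  have t1 := tendsto_integral_mul_sq (b := fun _ => 1) (memLp_top_const 1) hm ha.1.1 hconv.strong
  simp only [one_mul] at t1
  have hrs := hrlim.comp hs.tendsto_atTop
  -- By lower semicontinuity the form at `a` is at most the limit 0 of `r`, so positivity excludes
  -- `a ≠ 0`.
  have ha0 : a =ᵐ[volume.restrict Ω] 0 := by
    by_contra hna
    refine (hpos a ha hna).not_ge ?_
    rw [quadForm_eq hΩ hbd hne hd hb ha.1]
    refine le_of_tendsto_of_tendsto' (helim.sub tb) hrs fun n => ?_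
    have h1 := hzr (s n)
    rw [quadForm_eq hΩ hbd hne hd hb (hz (s n)).1] at h1
    have h2 := he n
    simp only [Function.comp_apply]
    linarith
  have e1 : ∫ x in Ω, b x * a x ^ 2 = 0 := integral_eq_zero_of_ae (by
    filter_upwards [ha0] with x hx; simp [hx])
  have e2 : ∫ x in Ω, a x ^ 2 = 0 := integral_eq_zero_of_ae (by
    filter_upwards [ha0] with x hx; simp [hx])
  rw [e1] at tb
  rw [e2] at t1
  obtain ⟨m, M, hm0, hM⟩ := hd.exists_bounds hbd hne
  have hlim := t1.add ((hrs.add tb).div_const m)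
  rw [add_zero, zero_div, zero_add] at hlim
  -- The unit norm, with the gradient part estimated by the form and `d² ≥ m`. Only quantities
  -- tending to 0 remain on the right, which is absurd.
  have hle : ∀ n, (1 : ℝ) ≤ (∫ x in Ω, z (s n) x ^ 2) +
      ((r ∘ s) n + ∫ x in Ω, b x * z (s n) x ^ 2) / m := by
    intro n
    have hG := (hz (s n)).1.memLp_weakGrad hΩ
    rw [← hz1 (s n), sqNormH1]
    gcongr
    rw [le_div_iff₀' hm0, ← integral_const_mul]
    have h1 := hzr (s n)
    rw [quadForm_eq hΩ hbd hne hd hb (hz (s n)).1] at h1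
    have h2 : ∫ x in Ω, m * ‖weakGrad Ω (z (s n)) x‖ ^ 2 ≤
        ∫ x in Ω, d x ^ 2 * ‖weakGrad Ω (z (s n)) x‖ ^ 2 := by
      refine setIntegral_mono_on ((integrable_norm_sq hG).const_mul m)
        (hd.integrable_mul_norm_sq hΩ hbd hne hG) hΩ.measurableSet fun x hx => ?_
      gcongr
      exact (hM x hx).1
    simp only [Function.comp_apply]
    linarith
  have := ge_of_tendsto' hlim hle
  linarith

end Coercivity

/-! ### Coercivity and lower semicontinuity of the energy. -/

section Minimization

variable {d : Eu N → ℝ} {f : Eu N → ℝ → ℝ}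

theorem HasTrace.sub_memH10 (hN : 1 ≤ N) (hΩ : IsOpen Ω) (hb : Bornology.IsBounded Ω)
    (hL : HasLipschitzBoundary Ω) {u g φ : Eu N → ℝ} (hu : HasTrace Ω u φ) (hg : HasTrace Ω g φ) :
    MemH10 Ω (fun x => u x - g x) :=
  ((hu.sub hΩ hg).congr (ae_of_all _ fun x => by simp)).memH10 hN hΩ hb hL

/-- Expand both squares and absorb the mixed terms by Young's inequality with weight `c / 4`; the
rest involves only the fixed extension `g` and its gradient `e`. -/
theorem energyDensity_lower_bound {D β M B c w g P : ℝ} {a e : Eu N} (hc : 0 < c) (hD0 : 0 ≤ D)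
    (hD : D ≤ M) (hβ : |β| ≤ B) (hP : P ≤ 1 / 2 * β * (w + g) ^ 2) :
    1 / 2 * (D * ‖a‖ ^ 2 - β * w ^ 2) - c / 4 * (w ^ 2 + ‖a‖ ^ 2) -
      (M ^ 2 / c * ‖e‖ ^ 2 + (B ^ 2 / c + B / 2) * g ^ 2) ≤ 1 / 2 * D * ‖a + e‖ ^ 2 - P := by
  have hM0 : 0 ≤ M := hD0.trans hD
  have hB0 : 0 ≤ B := (abs_nonneg _).trans hβ
  have h1 : 1 / 2 * D * ‖a‖ ^ 2 - c / 4 * ‖a‖ ^ 2 - M ^ 2 / c * ‖e‖ ^ 2 ≤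
      1 / 2 * D * ‖a + e‖ ^ 2 := by
    rw [norm_add_sq_real]
    have h2 : -(M * (‖a‖ * ‖e‖)) ≤ D * inner ℝ a e := by
      have h3 : |D * inner ℝ a e| ≤ M * (‖a‖ * ‖e‖) := by
        rw [abs_mul, abs_of_nonneg hD0]
        gcongr
        exact abs_real_inner_le_norm a e
      exact (abs_le.1 h3).1
    have h4 : M * (‖a‖ * ‖e‖) ≤ c / 4 * ‖a‖ ^ 2 + M ^ 2 / c * ‖e‖ ^ 2 := by
      have h5 : c / 4 * ‖a‖ ^ 2 + M ^ 2 / c * ‖e‖ ^ 2 - M * (‖a‖ * ‖e‖) =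
          (c * ‖a‖ - 2 * M * ‖e‖) ^ 2 / (4 * c) := by field_simp; ring
      have : 0 ≤ (c * ‖a‖ - 2 * M * ‖e‖) ^ 2 / (4 * c) := by positivity
      linarith
    have h6 : 0 ≤ D * ‖e‖ ^ 2 := by positivity
    linarith
  have h7 : 1 / 2 * β * (w + g) ^ 2 ≤
      1 / 2 * β * w ^ 2 + c / 4 * w ^ 2 + (B ^ 2 / c + B / 2) * g ^ 2 := by
    have h8 : β * (w * g) ≤ B * (|w| * |g|) := by
      refine (le_abs_self _).trans ?_
      rw [abs_mul, abs_mul]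
      gcongr
    have h9 : B * (|w| * |g|) ≤ c / 4 * w ^ 2 + B ^ 2 / c * g ^ 2 := by
      have h5 : c / 4 * |w| ^ 2 + B ^ 2 / c * |g| ^ 2 - B * (|w| * |g|) =
          (c * |w| - 2 * B * |g|) ^ 2 / (4 * c) := by field_simp; ring
      have : 0 ≤ (c * |w| - 2 * B * |g|) ^ 2 / (4 * c) := by positivity
      rw [sq_abs, sq_abs] at h5
      linarith
    have h10 : β * g ^ 2 ≤ B * g ^ 2 := by
      gcongr
      exact (le_abs_self _).trans hβ
    linarith
  linarith

/-- Coercivity of the energy of one component, in terms of the difference with a fixed extension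
`g` of the boundary datum. -/
theorem exists_energy_lower_bound (hΩ : IsOpen Ω) (hbd : Bornology.IsBounded Ω) (hne : Ω.Nonempty)
    (hd : IsDiffusion Ω d)
    (hf_meas : ∀ s : ℝ, 0 ≤ s → AEMeasurable (fun x => f x s) (volume.restrict Ω))
    (hA1 : AssumptionA1 Ω f) (hA2 : AssumptionA2 Ω d f) {g : Eu N → ℝ} (hg : MemH1 Ω g) :
    ∃ c > 0, ∃ K, ∀ u : Eu N → ℝ, MemH1 Ω u → (∀ᵐ x ∂(volume.restrict Ω), 0 ≤ u x) →
      MemH10 Ω (fun x => u x - g x) →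
      c * sqNormH1 Ω (fun x => u x - g x) - K ≤ ∫ x in Ω, energyDensity Ω d f u x := by
  obtain ⟨b, hb, ⟨σ, hσ, hbσ⟩, hpos⟩ := hA2
  obtain ⟨L, hL⟩ := hA1.lipschitz
  obtain ⟨c, hc, hcoer⟩ := exists_coercive hΩ hbd hne hd hb hpos
  obtain ⟨m, M, hm0, hM⟩ := hd.exists_bounds hbd hne
  obtain ⟨B, hB0, hB⟩ := MemLp.ae_abs_le hb
  have : IsFiniteMeasure (volume.restrict Ω) := isFiniteMeasure_restrict.2 hbd.measure_lt_top.ne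
  have hgG := hg.memLp_weakGrad hΩ
  set R : Eu N → ℝ := fun x => (M ^ 2 / c * ‖weakGrad Ω g x‖ ^ 2 + (B ^ 2 / c + B / 2) * g x ^ 2) +
    L * σ ^ 2 with hR
  have hRi : IntegrableOn R Ω := (((integrable_norm_sq hgG).const_mul _).add
    ((integrable_sq hg.1).const_mul _)).add (integrable_const _)
  -- Half of the form gives `c / 2` times the squared norm, and Young's inequality takes back `c /
  -- 4`.
  refine ⟨c / 4, by positivity, ∫ x in Ω, R x, fun u hu hu0 hw => ?_⟩
  set w : Eu N → ℝ := fun x => u x - g x with hwdef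
  have hwG := hw.1.memLp_weakGrad hΩ
  have i1 : IntegrableOn (fun x => d x ^ 2 * ‖weakGrad Ω w x‖ ^ 2 - b x * w x ^ 2) Ω :=
    (hd.integrable_mul_norm_sq hΩ hbd hne hwG).sub (integrable_mul_sq hb hw.1.1)
  have i2 : IntegrableOn (fun x => w x ^ 2 + ‖weakGrad Ω w x‖ ^ 2) Ω :=
    (integrable_sq hw.1.1).add (integrable_norm_sq hwG)
  have hmain : ∫ x in Ω, (1 / 2 * (d x ^ 2 * ‖weakGrad Ω w x‖ ^ 2 - b x * w x ^ 2) -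
      c / 4 * (w x ^ 2 + ‖weakGrad Ω w x‖ ^ 2) - R x) ≤ ∫ x in Ω, energyDensity Ω d f u x := by
    refine integral_mono_ae (((i1.const_mul _).sub (i2.const_mul _)).sub hRi)
      (integrableOn_energyDensity hΩ hbd hne hd hf_meas hA1 hu hu0) ?_
    have hadd := hw.1.weakGrad_add hΩ hg
    have hwg : (fun x => w x + g x) = u := by ext x; simp [hwdef]
    rw [hwg] at hadd
    filter_upwards [hadd, ae_restrict_mem hΩ.measurableSet, hB, hu0] with x h1 hx h2 h3
    have h4 := potential_le (hL x hx) (hA1.zero x hx) hσ (hbσ x hx) h3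
    have h5 : w x + g x = u x := by simp [hwdef]
    rw [← h5] at h4
    have h6 := energyDensity_lower_bound (D := d x ^ 2) (M := M) (a := weakGrad Ω w x)
      (e := weakGrad Ω g x) hc (sq_nonneg _) (hM x hx).2 h2 (sub_le_iff_le_add.2 h4)
    rw [energyDensity, h1, ← h5]
    simp only [hR]
    linarith
  have j1 : IntegrableOn (fun x => 1 / 2 * (d x ^ 2 * ‖weakGrad Ω w x‖ ^ 2 - b x * w x ^ 2)) Ω :=
    i1.const_mul _
  have j2 : IntegrableOn (fun x => c / 4 * (w x ^ 2 + ‖weakGrad Ω w x‖ ^ 2)) Ω := i2.const_mul _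
  have j3 : IntegrableOn (fun x => 1 / 2 * (d x ^ 2 * ‖weakGrad Ω w x‖ ^ 2 - b x * w x ^ 2) -
      c / 4 * (w x ^ 2 + ‖weakGrad Ω w x‖ ^ 2)) Ω := j1.sub j2
  rw [integral_sub j3 hRi, integral_sub j1 j2, integral_const_mul, integral_const_mul,
    integral_add (integrable_sq hw.1.1) (integrable_norm_sq hwG)] at hmain
  have h := hcoer w hw
  rw [quadForm] at h
  rw [sqNormH1] at h ⊢
  linarith

/-- Lower semicontinuity of the energy of one component. -/
theorem exists_energy_approx (hΩ : IsOpen Ω) (hbd : Bornology.IsBounded Ω) (hne : Ω.Nonempty)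
    (hd : IsDiffusion Ω d)
    (hf_meas : ∀ s : ℝ, 0 ≤ s → AEMeasurable (fun x => f x s) (volume.restrict Ω))
    (hA1 : AssumptionA1 Ω f) {u : ℕ → Eu N → ℝ} {a : Eu N → ℝ} (hu : ∀ n, MemH1 Ω (u n))
    (hu0 : ∀ n, ∀ᵐ x ∂(volume.restrict Ω), 0 ≤ u n x) (ha : MemH1 Ω a)
    (ha0 : ∀ᵐ x ∂(volume.restrict Ω), 0 ≤ a x) (h : TendstoWeakH1 Ω u a) :
    ∃ e : ℕ → ℝ, (∀ n, e n ≤ ∫ x in Ω, energyDensity Ω d f (u n) x) ∧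
      Tendsto e atTop (𝓝 (∫ x in Ω, energyDensity Ω d f a x)) := by
  obtain ⟨L, hL⟩ := hA1.lipschitz
  obtain ⟨e, he, helim⟩ := h.eventually_lower_bound hΩ hbd hne hd hu ha
  have hF : Tendsto (fun n => ∫ x in Ω, potential f x (u n x)) atTop
      (𝓝 (∫ x in Ω, potential f x (a x))) := by
    refine tendsto_integral_of_quadratic (fun n => (hu n).1) ha.1 h.strong
      (fun n => integrable_potential hΩ hf_meas hA1 (hu n).1 (hu0 n))
      (integrable_potential hΩ hf_meas hA1 ha.1 ha0) (fun n => ?_) L.2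
    filter_upwards [ae_restrict_mem hΩ.measurableSet, hu0 n, ha0] with x hx h1 h2
    rw [abs_of_nonneg h1, abs_of_nonneg h2]
    exact potential_sub_le (hL x hx) (hA1.zero x hx) h1 h2
  have hE : ∀ v, MemH1 Ω v → (∀ᵐ x ∂(volume.restrict Ω), 0 ≤ v x) →
      ∫ x in Ω, energyDensity Ω d f v x =
        1 / 2 * (∫ x in Ω, d x ^ 2 * ‖weakGrad Ω v x‖ ^ 2) - ∫ x in Ω, potential f x (v x) := by
    intro v hv hv0
    rw [← integral_const_mul, ← integral_sub ((hd.integrable_mul_norm_sq hΩ hbd hne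
      (hv.memLp_weakGrad hΩ)).const_mul _) (integrable_potential hΩ hf_meas hA1 hv.1 hv0)]
    refine integral_congr_ae (ae_of_all _ fun x => ?_)
    simp only [energyDensity]
    ring
  refine ⟨fun n => 1 / 2 * e n - ∫ x in Ω, potential f x (u n x), fun n => ?_, ?_⟩
  · rw [hE _ (hu n) (hu0 n)]
    linarith [he n]
  · rw [hE a ha ha0]
    exact (helim.const_mul _).sub hF

/-- Finitely many bounded sequences in `H¹₀(Ω)` converge along a common subsequence. -/
theorem exists_common_subseq (hΩ : IsOpen Ω) (hb : Bornology.IsBounded Ω) {ι : Type*}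
    (t : Finset ι) {w : ι → ℕ → Eu N → ℝ} (hw : ∀ i n, MemH10 Ω (w i n)) {R : ι → ℝ}
    (hR : ∀ i n, sqNormH1 Ω (w i n) ≤ R i) :
    ∃ s : ℕ → ℕ, StrictMono s ∧ ∀ i ∈ t, ∃ a, MemH10 Ω a ∧
      TendstoWeakH1 Ω (fun n => w i (s n)) a := by
  classical
  induction t using Finset.induction_on with
  | empty => exact ⟨id, strictMono_id, by simp⟩
  | insert i t hi ih =>
    obtain ⟨s, hs, hsa⟩ := ih
    obtain ⟨s', a, hs', ha, hconv⟩ := exists_tendstoWeakH1_of_sqNormH1_le hΩ hb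
      (fun n => hw i (s n)) (fun n => hR i (s n))
    refine ⟨fun n => s (s' n), hs.comp hs', fun j hj => ?_⟩
    rcases Finset.mem_insert.1 hj with rfl | hj
    · exact ⟨a, ha, hconv⟩
    · obtain ⟨a', ha', hconv'⟩ := hsa j hj
      exact ⟨a', ha', hconv'.comp hs'⟩

end Minimization

end Segregation

/-! ### The direct method. -/

theorem mainTheorem1 (N k : ℕ) (hN : 2 ≤ N) (hk : 2 ≤ k)
    (Ω : Set (Segregation.Eu N)) (hΩ_open : IsOpen Ω) (hΩ_conn : IsConnected Ω)
    (hΩ_bdd : Bornology.IsBounded Ω) (hΩ_bdry : Segregation.HasLipschitzBoundary Ω)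
    (φ : Fin k → Segregation.Eu N → ℝ) (hφ : Segregation.IsAdmissibleDatum Ω φ)
    (d : Fin k → Segregation.Eu N → ℝ) (hd : ∀ i, Segregation.IsDiffusion Ω (d i))
    (f : Fin k → Segregation.Eu N → ℝ → ℝ)
    (hf_meas : ∀ i, ∀ s : ℝ, 0 ≤ s → AEMeasurable (fun x => f i x s) (volume.restrict Ω))
    (hA1 : ∀ i, Segregation.AssumptionA1 Ω (f i))
    (hA2 : ∀ i, Segregation.AssumptionA2 Ω (d i) (f i)) :
    (∀ V, Segregation.IsSegregated Ω φ V →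
      ∀ i, IntegrableOn (Segregation.energyDensity Ω (d i) (f i) (V i)) Ω) ∧
    ∃ U, Segregation.IsSegregated Ω φ U ∧
      ∀ V, Segregation.IsSegregated Ω φ V →
        Segregation.energy Ω d f U ≤ Segregation.energy Ω d f V := by
  have hne := hΩ_conn.nonempty
  have hN1 : 1 ≤ N := by omega
  refine ⟨fun V hV i => Segregation.integrableOn_energyDensity hΩ_open hΩ_bdd hne (hd i)
    (hf_meas i) (hA1 i) (hV.mem i) (hV.nonneg i), ?_⟩
  choose g hg using hφ.mem
  choose c hc K hK using fun i => Segregation.exists_energy_lower_bound hΩ_open hΩ_bdd hne (hd i)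
    (hf_meas i) (hA1 i) (hA2 i) (hg i).1
  have hdiff : ∀ V, Segregation.IsSegregated Ω φ V → ∀ i,
      Segregation.MemH10 Ω (fun x => V i x - g i x) := fun V hV i =>
    (hV.trace i).sub_memH10 hN1 hΩ_open hΩ_bdd hΩ_bdry (hg i)
  have hlow : ∀ V, Segregation.IsSegregated Ω φ V → ∀ i,
      c i * Segregation.sqNormH1 Ω (fun x => V i x - g i x) - K i ≤
        ∫ x in Ω, Segregation.energyDensity Ω (d i) (f i) (V i) x := fun V hV i =>
    hK i (V i) (hV.mem i) (hV.nonneg i) (hdiff V hV i)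
  -- Coercivity holds for the sum of the components; since all these terms are nonnegative, the
  -- total energy controls each one.
  have hlow' : ∀ V, Segregation.IsSegregated Ω φ V → ∀ i,
      c i * Segregation.sqNormH1 Ω (fun x => V i x - g i x) ≤
        Segregation.energy Ω d f V + ∑ j, K j := by
    intro V hV i
    rw [Segregation.energy, ← Finset.sum_add_distrib]
    have hterm : ∀ j, 0 ≤ c j * Segregation.sqNormH1 Ω (fun x => V j x - g j x) := fun j =>
      mul_nonneg (hc j).le (Segregation.sqNormH1_nonneg _ _)
    calc c i * Segregation.sqNormH1 Ω (fun x => V i x - g i x)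
        ≤ ∑ j, c j * Segregation.sqNormH1 Ω (fun x => V j x - g j x) :=
          Finset.single_le_sum (f := fun j => c j * Segregation.sqNormH1 Ω
            (fun x => V j x - g j x)) (fun j _ => hterm j) (Finset.mem_univ i)
      _ ≤ _ := Finset.sum_le_sum fun j _ => by linarith [hlow V hV j]
  -- a minimizing sequence
  set E : Set ℝ := {e | ∃ V, Segregation.IsSegregated Ω φ V ∧ e = Segregation.energy Ω d f V} with hE
  have hEne : E.Nonempty := by
    obtain ⟨V, hV⟩ := Segregation.exists_isSegregated hΩ_open hφ
    exact ⟨_, V, hV, rfl⟩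
  have hEbdd : BddBelow E := by
    refine ⟨-∑ j, K j, ?_⟩
    rintro e ⟨V, hV, rfl⟩
    have h1 := hlow' V hV ⟨0, by omega⟩
    have h2 := mul_nonneg (hc ⟨0, by omega⟩).le
      (Segregation.sqNormH1_nonneg Ω (fun x => V ⟨0, by omega⟩ x - g ⟨0, by omega⟩ x))
    linarith
  have hseq : ∀ n : ℕ, ∃ V, Segregation.IsSegregated Ω φ V ∧
      Segregation.energy Ω d f V < sInf E + 1 / ((n : ℝ) + 1) := by
    intro n
    obtain ⟨e, ⟨V, hV, rfl⟩, he⟩ := exists_lt_of_csInf_lt hEne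
      (show sInf E < sInf E + 1 / ((n : ℝ) + 1) from lt_add_of_pos_right _ (by positivity))
    exact ⟨V, hV, he⟩
  choose V hV hVE using hseq
  have hR : ∀ i n, Segregation.sqNormH1 Ω (fun x => V n i x - g i x) ≤
      (sInf E + 1 + ∑ j, K j) / c i := by
    intro i n
    rw [le_div_iff₀' (hc i)]
    have h1 : 1 / ((n : ℝ) + 1) ≤ 1 := by
      rw [div_le_one (by positivity)]
      linarith [Nat.cast_nonneg (α := ℝ) n]
    linarith [hlow' (V n) (hV n) i, hVE n]
  obtain ⟨s, hs, hsa⟩ := Segregation.exists_common_subseq hΩ_open hΩ_bdd Finset.univ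
    (fun i n => hdiff (V n) (hV n) i) hR
  choose a ha hconv using fun i => hsa i (Finset.mem_univ i)
  -- Adding the extension back restores the boundary values, as `a i` has zero trace.
  set U : Fin k → Segregation.Eu N → ℝ := fun i x => a i x + g i x with hU
  have htrace : ∀ i, Segregation.HasTrace Ω (U i) (φ i) := fun i =>
    (((ha i).hasTrace_zero hΩ_open).add hΩ_open (hg i)).congr (ae_of_all _ fun x => by simp)
  have hUconv : ∀ i, Segregation.TendstoWeakH1 Ω (fun n => V (s n) i) (U i) := by
    intro i
    simpa using (hconv i).add_const hΩ_open (fun n => (hdiff _ (hV (s n)) i).1) (ha i).1 (hg i).1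
  have hmV : ∀ i n, MemLp (V n i) 2 (volume.restrict Ω) := fun i n => ((hV n).mem i).1
  have hmU : ∀ i, MemLp (U i) 2 (volume.restrict Ω) := fun i => (htrace i).1.1
  have hnonneg : ∀ i, ∀ᵐ x ∂(volume.restrict Ω), 0 ≤ U i x := by
    intro i
    obtain ⟨r, -, hr⟩ := Segregation.exists_subseq_tendsto_ae (fun n => hmV i (s n)) (hmU i)
      (hUconv i).strong
    filter_upwards [hr, ae_all_iff.2 fun n => (hV n).nonneg i] with x h1 h2
    exact ge_of_tendsto' h1 fun n => h2 _
  have hdisj : ∀ i j, i ≠ j → ∀ᵐ x ∂(volume.restrict Ω), U i x * U j x = 0 := by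
    intro i j hij
    obtain ⟨r, hr, hri⟩ := Segregation.exists_subseq_tendsto_ae (fun n => hmV i (s n)) (hmU i)
      (hUconv i).strong
    -- Extracted from the subsequence for `i`, so that both components converge almost everywhere
    -- along the same indices and the product passes to the limit.
    obtain ⟨r', hr', hrj⟩ := Segregation.exists_subseq_tendsto_ae (fun n => hmV j (s (r n)))
      (hmU j) ((hUconv j).comp hr).strong
    filter_upwards [hri, hrj, ae_all_iff.2 fun n => (hV n).disjoint i j hij] with x h1 h2 h3
    have h4 := (h1.comp hr'.tendsto_atTop).mul h2
    refine tendsto_nhds_unique h4 (tendsto_const_nhds.congr fun n => ?_)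
    exact (h3 _).symm
  refine ⟨U, ⟨fun i => (htrace i).1, htrace, hnonneg, hdisj⟩, fun W hW => ?_⟩
  choose e he helim using fun i => Segregation.exists_energy_approx hΩ_open hΩ_bdd hne (hd i)
    (hf_meas i) (hA1 i) (fun n => (hV (s n)).mem i) (fun n => (hV (s n)).nonneg i) (htrace i).1
    (hnonneg i) (hUconv i)
  have hsum : Tendsto (fun n => ∑ i, e i n) atTop (𝓝 (Segregation.energy Ω d f U)) :=
    tendsto_finsetSum _ fun i _ => helim i
  have hlim : Tendsto (fun n => sInf E + 1 / ((s n : ℝ) + 1)) atTop (𝓝 (sInf E)) := by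
    simpa using (tendsto_one_div_add_atTop_nhds_zero_nat (𝕜 := ℝ)).comp hs.tendsto_atTop
      |>.const_add (sInf E)
  have hmin : Segregation.energy Ω d f U ≤ sInf E :=
    le_of_tendsto_of_tendsto' hsum hlim fun n =>
      (Finset.sum_le_sum fun i _ => he i n).trans (hVE (s n)).le
  exact hmin.trans (csInf_le hEbdd ⟨W, hW, rfl⟩)
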